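/- Consider intuitionistic linear logic with connectives $\otimes, \&, \multimap, {!}$ over a set of atoms (no units, no quantifiers), with the usual sequent calculus rules: axiom, exchange, cut, left and right rules for $\otimes, \&, \multimap$, and dereliction, weakening, contraction and promotion for ${!}$. Proofs of a sequent are identified up to \emph{equivalence under cut-elimination}, written $\sim$: the congruence on proofs generated by the cut-elimination steps (commutation of exchange with all rules, cut against an axiom, cut against cut, principal cuts, promotion against dereliction, weakening, contraction and promotion, commutation of cut with rules that do not introduce the cut formula) and the $\eta$-expansions of axioms, together with the structural identities which say that contraction and weakening are coassociative, cocommutative and counital and commute with promotion. The formula $X_1\otimes\cdots\otimes X_s$ ($s\ge 1$) is bracketed to the right, and $nX$ denotes $n$ copies of $X$ in a context. A proof of ${!}A_1,\ldots,{!}A_r\vdash B$ ($r\ge 0$) is \emph{plain} if for some integers $n_1,\ldots,n_r\ge 0$ and some proof $\pi$ of $n_1A_1,\ldots,n_rA_r\vdash B$ it is equivalent to the proof obtained from $\pi$ by derelictions, giving $n_1{!}A_1,\ldots,n_r{!}A_r\vdash B$, followed for each $i$ by $n_i-1$ contractions if $n_i\ge 1$ and by a weakening if $n_i=0$, giving ${!}A_1,\ldots,{!}A_r\vdash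 B$. A proof $\psi$ of ${!}A_1,\ldots,{!}A_r\vdash {!}B_1\otimes\cdots\otimes{!}B_s$ ($r\ge 0$, $s\ge 1$) is \emph{component-wise plain} if there are plain proofs $\psi_i$ of ${!}A_1,\ldots,{!}A_r\vdash B_i$ for $1\le i\le s$ such that $\psi$ is equivalent to the proof obtained from the tensor product $\bigotimes_{i=1}^s\operatorname{prom}(\psi_i)$ of the promotions of the $\psi_i$, a proof of $s\,{!}A_1,\ldots,s\,{!}A_r\vdash{!}B_1\otimes\cdots\otimes{!}B_s$, by contracting, for each $j$, the $s$ copies of ${!}A_j$ to one. \textbf{Proposition.} Let $r\ge 0$ and $s,t\ge 1$, and let \[ \psi:\ {!}A_1,\ldots,{!}A_r\vdash{!}B_1\otimes\cdots\otimes{!}B_s,\qquad \phi:\ {!}B_1,\ldots,{!}B_s\vdash{!}C_1\otimes\cdots\otimes{!}C_t \] be component-wise plain proofs. Let $\phi\,|\,\psi$ be the proof of ${!}A_1,\ldots,{!}A_r\vdash{!}C_1\otimes\cdots\otimes{!}C_t$ obtained by applying left tensor introductions to $\phi$, giving a proof of ${!}B_1\otimes\cdots\otimes{!}B_s\vdash{!}C_1\otimes\cdots\otimes{!}C_t$,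 and cutting the result against $\psi$. Then $\phi\,|\,\psi$ is component-wise plain. -/

import Mathlib

universe u

namespace ILL

/-- Formulas of intuitionistic linear logic over a type `α` of atoms. -/
inductive Formula (α : Type u) : Type u
  | atom (x : α) : Formula α
  | tensor (A B : Formula α) : Formula α
  | amp (A B : Formula α) : Formula α
  | limp (A B : Formula α) : Formula α
  | bang (A : Formula α) : Formula α

variable {α : Type u}

/-! A context is a family of formulas `Γ : ι → Formula α`; the elements of `ι` name the occurrences
of formulas in it. Concatenation of contexts is the disjoint union of families, and the exchange
rule renames the occurrences along a bijection. The context `A₁, …, Aᵣ` is a family over `Fin r`.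
Every provable sequent has a finite index type, so finiteness need not be required. -/

/-- The context consisting of one occurrence of `A`. -/
abbrev single (A : Formula α) : Unit → Formula α := fun _ => A

/-- The empty context. -/
abbrev emp : Empty → Formula α := fun x => nomatch x

/-- The context `!A₁, …, !Aᵣ`. -/
abbrev bangs {ι : Type} (Γ : ι → Formula α) : ι → Formula α := fun i => (Γ i).bang

/-- Concatenation of contexts. -/
abbrev app {ι κ : Type} (Γ : ι → Formula α) (Δ : κ → Formula α) : ι ⊕ κ → Formula α :=
  Sum.elim Γ Δ

infixr:67 " ∔ " => app

theorem app_sumEmpty {ι : Type} (Γ : ι → Formula α) (i : ι) :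
    (Γ ∔ emp) ((Equiv.sumEmpty ι Empty).symm i) = Γ i := rfl

theorem app_emptySum {ι κ : Type} [IsEmpty ι] (Γ : ι → Formula α) (Δ : κ → Formula α) (i : κ) :
    (Γ ∔ Δ) ((Equiv.emptySum ι κ).symm i) = Δ i := rfl

theorem uniqueProd_snd {ι : Type} (Γ : ι → Formula α) (i : ι) :
    Γ ((Equiv.uniqueProd ι (Fin 1)).symm i).2 = Γ i := rfl

/-- Proofs of the sequent `Γ ⊢ A`. -/
inductive Proof : {ι : Type} → (ι → Formula α) → Formula α → Type (max u 1)
  | ax (A : Formula α) : Proof (single A) A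
  | ex {ι κ : Type} {Γ : ι → Formula α} {Δ : κ → Formula α} {A : Formula α}
      (e : ι ≃ κ) (h : ∀ i, Δ (e i) = Γ i) (π : Proof Γ A) : Proof Δ A
  | cut {ι κ : Type} {Γ : ι → Formula α} {Δ : κ → Formula α} {A B : Formula α}
      (π : Proof Γ A) (ρ : Proof (single A ∔ Δ) B) : Proof (Γ ∔ Δ) B
  | tensorR {ι κ : Type} {Γ : ι → Formula α} {Δ : κ → Formula α} {A B : Formula α}
      (π : Proof Γ A) (ρ : Proof Δ B) : Proof (Γ ∔ Δ) (A.tensor B)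
  | tensorL {ι : Type} {Γ : ι → Formula α} {A B C : Formula α}
      (π : Proof (single A ∔ single B ∔ Γ) C) : Proof (single (A.tensor B) ∔ Γ) C
  | limpR {ι : Type} {Γ : ι → Formula α} {A B : Formula α}
      (π : Proof (single A ∔ Γ) B) : Proof Γ (A.limp B)
  | limpL {ι κ : Type} {Γ : ι → Formula α} {Δ : κ → Formula α} {A B C : Formula α}
      (π : Proof Γ A) (ρ : Proof (single B ∔ Δ) C) : Proof (single (A.limp B) ∔ Γ ∔ Δ) C
  | ampR {ι : Type} {Γ : ι → Formula α} {A B : Formula α}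
      (π : Proof Γ A) (ρ : Proof Γ B) : Proof Γ (A.amp B)
  | ampL₀ {ι : Type} {Γ : ι → Formula α} {A B C : Formula α}
      (π : Proof (single A ∔ Γ) C) : Proof (single (A.amp B) ∔ Γ) C
  | ampL₁ {ι : Type} {Γ : ι → Formula α} {A B C : Formula α}
      (π : Proof (single B ∔ Γ) C) : Proof (single (A.amp B) ∔ Γ) C
  | der {ι : Type} {Γ : ι → Formula α} {A B : Formula α}
      (π : Proof (single A ∔ Γ) B) : Proof (single A.bang ∔ Γ) B
  | wk {ι : Type} {Γ : ι → Formula α} {A B : Formula α}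
      (π : Proof Γ B) : Proof (single A.bang ∔ Γ) B
  | ctr {ι : Type} {Γ : ι → Formula α} {A B : Formula α}
      (π : Proof (single A.bang ∔ single A.bang ∔ Γ) B) : Proof (single A.bang ∔ Γ) B
  | prom {ι : Type} {Γ : ι → Formula α} {A : Formula α}
      (h : ∀ i, ∃ B : Formula α, Γ i = B.bang) (π : Proof Γ A) : Proof Γ A.bang

namespace Proof

section Exchange

/-! Instances of the exchange rule. -/

variable {ι κ θ ν : Type} {Γ : ι → Formula α} {Δ : κ → Formula α} {Θ : θ → Formula α}
  {Λ : ν → Formula α} {A : Formula α}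

def assoc (π : Proof ((Γ ∔ Δ) ∔ Θ) A) : Proof (Γ ∔ Δ ∔ Θ) A :=
  ex (Equiv.sumAssoc ι κ θ) (by rintro ((_ | _) | _) <;> rfl) π

def unassoc (π : Proof (Γ ∔ Δ ∔ Θ) A) : Proof ((Γ ∔ Δ) ∔ Θ) A :=
  ex (Equiv.sumAssoc ι κ θ).symm (by rintro (_ | _ | _) <;> rfl) π

def assocTail (π : Proof (Γ ∔ (Δ ∔ Θ) ∔ Λ) A) : Proof (Γ ∔ Δ ∔ Θ ∔ Λ) A :=
  ex (Equiv.sumCongr (Equiv.refl ι) (Equiv.sumAssoc κ θ ν))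
    (by rintro (_ | (_ | _) | _) <;> rfl) π

def unassocTail (π : Proof (Γ ∔ Δ ∔ Θ ∔ Λ) A) : Proof (Γ ∔ (Δ ∔ Θ) ∔ Λ) A :=
  ex (Equiv.sumCongr (Equiv.refl ι) (Equiv.sumAssoc κ θ ν).symm)
    (by rintro (_ | _ | _ | _) <;> rfl) π

def assoc₂ (π : Proof ((Γ ∔ Δ ∔ Θ) ∔ Λ) A) : Proof (Γ ∔ Δ ∔ Θ ∔ Λ) A :=
  assocTail (assoc π)

def unassoc₂ (π : Proof (Γ ∔ Δ ∔ Θ ∔ Λ) A) : Proof ((Γ ∔ Δ ∔ Θ) ∔ Λ) A :=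
  unassoc (unassocTail π)

def swap (π : Proof (Γ ∔ Δ) A) : Proof (Δ ∔ Γ) A :=
  ex (Equiv.sumComm ι κ) (by rintro (_ | _) <;> rfl) π

/-- Exchange of the first two parts of a context. -/
def exl (π : Proof (Γ ∔ Δ ∔ Θ) A) : Proof (Δ ∔ Γ ∔ Θ) A :=
  ex ((Equiv.sumAssoc ι κ θ).symm.trans
      ((Equiv.sumCongr (Equiv.sumComm ι κ) (Equiv.refl θ)).trans (Equiv.sumAssoc κ ι θ)))
    (by rintro (_ | _ | _) <;> rfl) π

/-- Exchange `Γ` past `Δ, Θ`. -/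
def push (π : Proof (Γ ∔ Δ ∔ Θ ∔ Λ) A) : Proof (Δ ∔ Θ ∔ Γ ∔ Λ) A :=
  assoc (exl (unassocTail π))

/-- Exchange `Θ` past `Γ, Δ`. -/
def pull (π : Proof (Γ ∔ Δ ∔ Θ ∔ Λ) A) : Proof (Θ ∔ Γ ∔ Δ ∔ Λ) A :=
  assocTail (exl (unassoc π))

/-- Adjoin the empty context. -/
def pad (π : Proof Γ A) : Proof (Γ ∔ emp) A :=
  ex (Γ := Γ) (Equiv.sumEmpty ι Empty).symm (app_sumEmpty Γ) π

/-- Drop the empty context. -/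
def unpad (π : Proof (Γ ∔ emp) A) : Proof Γ A :=
  ex (Equiv.sumEmpty ι Empty) (by rintro (_ | x); exacts [rfl, nomatch x]) π

end Exchange

end Proof

/-- Splitting off the first index. -/
def headTail (r : ℕ) : Fin (r + 1) ≃ Unit ⊕ Fin r where
  toFun := Fin.cases (Sum.inl ()) Sum.inr
  invFun := Sum.elim (fun _ => 0) Fin.succ
  left_inv := by
    intro i
    refine Fin.cases rfl (fun _ => rfl) i
  right_inv := by rintro (_ | _) <;> rfl

/-- Splitting off the first block. -/
def sigmaSucc {r : ℕ} (n : Fin (r + 1) → ℕ) :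
    (Σ i : Fin (r + 1), Fin (n i)) ≃ Fin (n 0) ⊕ (Σ i : Fin r, Fin (n i.succ)) where
  toFun p := Fin.cases (motive := fun i => Fin (n i) →
    Fin (n 0) ⊕ (Σ i : Fin r, Fin (n i.succ))) Sum.inl (fun i k => Sum.inr ⟨i, k⟩) p.1 p.2
  invFun := Sum.elim (fun k => ⟨0, k⟩) (fun p => ⟨p.1.succ, p.2⟩)
  left_inv := by
    rintro ⟨i, k⟩
    revert k
    refine Fin.cases (fun _ => rfl) (fun _ _ => rfl) i
  right_inv := by rintro (_ | _) <;> rfl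

/-- Splitting off the first copy. -/
def copiesSucc (s : ℕ) (ι : Type) : ι ⊕ (Fin s × ι) ≃ Fin (s + 1) × ι where
  toFun := Sum.elim (fun x => (0, x)) (fun p => (p.1.succ, p.2))
  invFun p := Fin.cases (motive := fun _ => ι ⊕ (Fin s × ι))
    (Sum.inl p.2) (fun k => Sum.inr (k, p.2)) p.1
  left_inv := by rintro (_ | _) <;> rfl
  right_inv := by
    rintro ⟨i, x⟩
    refine Fin.cases rfl (fun _ => rfl) i

/-- Two copies of `Fin r`, grouped by index. -/
def pairs (r : ℕ) : Fin r ⊕ Fin r ≃ (Σ _ : Fin r, Fin 2) where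
  toFun := Sum.elim (fun i => ⟨i, 0⟩) (fun i => ⟨i, 1⟩)
  invFun p := if p.2 = 0 then Sum.inl p.1 else Sum.inr p.1
  left_inv := by rintro (_ | _) <;> rfl
  right_inv := by
    rintro ⟨i, k⟩
    fin_cases k <;> rfl

/-- `s` copies of `Fin r`, grouped by index. -/
def group (s r : ℕ) : Fin s × Fin r ≃ (Σ _ : Fin r, Fin s) where
  toFun p := ⟨p.2, p.1⟩
  invFun p := (p.2, p.1)
  left_inv _ := rfl
  right_inv _ := rfl

theorem group_fst {s r : ℕ} (Γ : Fin r → Formula α) (p : Fin s × Fin r) :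
    Γ (group s r p).1 = Γ p.2 := rfl

namespace Proof

section Derived

variable {κ : Type} {Δ : κ → Formula α} {A B : Formula α}

/-- Exchange: view the first formula of `Γ, Δ` separately. -/
def uncons {r : ℕ} {Γ : Fin (r + 1) → Formula α} (π : Proof (Γ ∔ Δ) B) :
    Proof (single (Γ 0) ∔ (fun i : Fin r => Γ i.succ) ∔ Δ) B :=
  ex ((Equiv.sumCongr (headTail r) (Equiv.refl κ)).trans (Equiv.sumAssoc Unit (Fin r) κ))
    (by
      rintro (i | _)
      · exact Fin.cases rfl (fun _ => rfl) i
      · rfl) π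

/-- Exchange: the inverse of `uncons`. -/
def cons {r : ℕ} {Γ : Fin (r + 1) → Formula α}
    (π : Proof (single (Γ 0) ∔ (fun i : Fin r => Γ i.succ) ∔ Δ) B) : Proof (Γ ∔ Δ) B :=
  ex ((Equiv.sumAssoc Unit (Fin r) κ).symm.trans
      (Equiv.sumCongr (headTail r).symm (Equiv.refl κ)))
    (by rintro (_ | _ | _) <;> rfl) π

/-- From `A₁, …, Aₘ, Δ ⊢ B` to `!A₁, …, !Aₘ, Δ ⊢ B` by `m` derelictions. -/
def derFin : (m : ℕ) → {κ : Type} → {Δ : κ → Formula α} → {Γ : Fin m → Formula α} →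
    Proof (Γ ∔ Δ) B → Proof (bangs Γ ∔ Δ) B
  | 0, _, _, _, π => ex (Equiv.refl _) (by rintro (i | _); exacts [i.elim0, rfl]) π
  | m + 1, _, _, _, π => cons (exl (derFin m (exl (der (uncons π)))))

/-- From `n₁ A₁, …, nᵣ Aᵣ ⊢ B` to `n₁ !A₁, …, nᵣ !Aᵣ ⊢ B` by derelictions. -/
def derAll {r : ℕ} {A : Fin r → Formula α} (n : Fin r → ℕ)
    (π : Proof (fun p : Σ i, Fin (n i) => A p.1) B) :
    Proof (fun p : Σ i, Fin (n i) => (A p.1).bang) B :=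
  ex (Γ := bangs fun k => A (finSigmaFinEquiv.symm k).1) finSigmaFinEquiv.symm (by intro i; rfl)
    (unpad (derFin (∑ i, n i)
      (pad (ex (Γ := fun p : Σ i, Fin (n i) => A p.1)
        (Δ := fun k => A (finSigmaFinEquiv.symm k).1) finSigmaFinEquiv
        (fun p => by rw [Equiv.symm_apply_apply]) π))))

/-- From `n !A, Δ ⊢ B` to `!A, Δ ⊢ B`: a weakening if `n = 0`, nothing if `n = 1`, and `n - 1`
contractions if `n > 1`. -/
def contractOne : (n : ℕ) → {κ : Type} → {Δ : κ → Formula α} →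
    Proof ((fun _ : Fin n => A.bang) ∔ Δ) B → Proof (single A.bang ∔ Δ) B
  | 0, κ, _, π => wk (ex (Equiv.emptySum (Fin 0) κ) (by rintro (i | _); exacts [i.elim0, rfl]) π)
  | 1, κ, _, π => ex (Equiv.sumCongr finOneEquiv (Equiv.refl κ)) (by rintro (_ | _) <;> rfl) π
  | n + 2, _, _, π => ctr (contractOne (n + 1) (exl (uncons π)))

/-- From `n₁ !A₁, …, nᵣ !Aᵣ, Δ ⊢ B` to `!A₁, …, !Aᵣ, Δ ⊢ B` by contractions and weakenings. -/
def contract : {r : ℕ} → {A : Fin r → Formula α} → {κ : Type} → {Δ : κ → Formula α} →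
    (n : Fin r → ℕ) →
    Proof ((fun p : Σ i, Fin (n i) => (A p.1).bang) ∔ Δ) B → Proof (bangs A ∔ Δ) B
  | 0, _, κ, _, _, π =>
      ex (Equiv.sumCongr (Equiv.equivOfIsEmpty _ (Fin 0)) (Equiv.refl κ))
        (by rintro (p | _); exacts [p.1.elim0, rfl]) π
  | _ + 1, A, κ, Δ, n, π =>
      let π₁ : Proof ((fun _ : Fin (n 0) => (A 0).bang) ∔
          (fun p : Σ i, Fin (n (Fin.succ i)) => (A p.1.succ).bang) ∔ Δ) B :=
        assoc (ex (Equiv.sumCongr (sigmaSucc n) (Equiv.refl κ))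
          (by
            rintro (⟨i, k⟩ | _)
            · revert k
              exact Fin.cases (fun _ => rfl) (fun _ _ => rfl) i
            · rfl) π)
      cons (exl (contract (fun i => n i.succ) (exl (contractOne (n 0) π₁))))

/-- From `Δ ⊢ B` to `!A₁, …, !Aᵣ, Δ ⊢ B` by weakenings. -/
def wkCtx {r : ℕ} {A : Fin r → Formula α} (π : Proof Δ B) : Proof (bangs A ∔ Δ) B :=
  haveI : IsEmpty (Σ _ : Fin r, Fin 0) := ⟨fun p => p.2.elim0⟩
  contract (fun _ => 0)
    (ex (Γ := Δ) (Equiv.emptySum (Σ _ : Fin r, Fin 0) κ).symm (app_emptySum _ Δ) π)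

/-- From `!A₁, …, !Aᵣ, !A₁, …, !Aᵣ, Δ ⊢ B` to `!A₁, …, !Aᵣ, Δ ⊢ B` by contractions. -/
def ctrCtx {r : ℕ} {A : Fin r → Formula α} (π : Proof (bangs A ∔ bangs A ∔ Δ) B) :
    Proof (bangs A ∔ Δ) B :=
  contract (fun _ => 2)
    (ex (Equiv.sumCongr (pairs r) (Equiv.refl κ)) (by rintro ((_ | _) | _) <;> rfl) (unassoc π))

end Derived

end Proof

/-- `B₀ ⊗ (B₁ ⊗ (⋯ ⊗ Bₛ))`. -/
def bigTensor : {s : ℕ} → (Fin (s + 1) → Formula α) → Formula α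
  | 0, B => B 0
  | _ + 1, B => (B 0).tensor (bigTensor fun i => B i.succ)

namespace Proof

/-- The tensor product of proofs of `Γ ⊢ B₀`, …, `Γ ⊢ Bₛ`, with one copy of `Γ` for each. -/
def tensorAll {ι : Type} {Γ : ι → Formula α} : {s : ℕ} → {B : Fin (s + 1) → Formula α} →
    (∀ i, Proof Γ (B i)) → Proof (fun p : Fin (s + 1) × ι => Γ p.2) (bigTensor B)
  | 0, _, ψ => ex (Γ := Γ) (Equiv.uniqueProd ι (Fin 1)).symm (uniqueProd_snd Γ) (ψ 0)
  | s + 1, _, ψ => ex (copiesSucc (s + 1) ι) (by rintro (_ | _) <;> rfl)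
      (tensorR (ψ 0) (tensorAll fun i => ψ i.succ))

/-- From `B₀, …, Bₛ, Δ ⊢ C` to `B₀ ⊗ ⋯ ⊗ Bₛ, Δ ⊢ C` by left tensor introductions. -/
def tensorLAll {C : Formula α} : {s : ℕ} → {B : Fin (s + 1) → Formula α} → {κ : Type} →
    {Δ : κ → Formula α} → Proof (B ∔ Δ) C → Proof (single (bigTensor B) ∔ Δ) C
  | 0, B, κ, _, π =>
      ex (Equiv.sumCongr finOneEquiv (Equiv.refl κ))
        (by
          rintro (i | _)
          · exact congrArg B (Subsingleton.elim 0 i)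
          · rfl) π
  | _ + 1, _, _, _, π => tensorL (exl (tensorLAll (exl (uncons π))))

end Proof

open Proof

/-- Equivalence of proofs under cut-elimination: the congruence generated by the cut-elimination
steps (including the exchange steps and the `η`-expansions of axioms), by the laws which say that
contraction and weakening are coassociative, cocommutative and counital, and by the commutation
of contraction and weakening with promotion. Arguments named `h'`, `hb'` are facts about contexts
that always hold; they only make the right hand side well formed. -/
inductive Conv : {ι : Type} → {Γ : ι → Formula α} → {A : Formula α} →
    Proof Γ A → Proof Γ A → Prop
  -- Equivalence relation.
  | refl {ι : Type} {Γ : ι → Formula α} {A : Formula α} (π : Proof Γ A) : Conv π π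
  | symm {ι : Type} {Γ : ι → Formula α} {A : Formula α} {π π' : Proof Γ A} :
      Conv π π' → Conv π' π
  | trans {ι : Type} {Γ : ι → Formula α} {A : Formula α} {π π' π'' : Proof Γ A} :
      Conv π π' → Conv π' π'' → Conv π π''
  -- Congruence for every rule.
  | congr_ex {ι κ : Type} {Γ : ι → Formula α} {Δ : κ → Formula α} {A : Formula α}
      {π π' : Proof Γ A} (e : ι ≃ κ) (h : ∀ i, Δ (e i) = Γ i) :
      Conv π π' → Conv (ex e h π) (ex e h π')
  | congr_cut {ι κ : Type} {Γ : ι → Formula α} {Δ : κ → Formula α} {A B : Formula α}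
      {π π' : Proof Γ A} {ρ ρ' : Proof (single A ∔ Δ) B} :
      Conv π π' → Conv ρ ρ' → Conv (cut π ρ) (cut π' ρ')
  | congr_tensorR {ι κ : Type} {Γ : ι → Formula α} {Δ : κ → Formula α} {A B : Formula α}
      {π π' : Proof Γ A} {ρ ρ' : Proof Δ B} :
      Conv π π' → Conv ρ ρ' → Conv (tensorR π ρ) (tensorR π' ρ')
  | congr_tensorL {ι : Type} {Γ : ι → Formula α} {A B C : Formula α}
      {π π' : Proof (single A ∔ single B ∔ Γ) C} :
      Conv π π' → Conv (tensorL π) (tensorL π')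
  | congr_limpR {ι : Type} {Γ : ι → Formula α} {A B : Formula α}
      {π π' : Proof (single A ∔ Γ) B} : Conv π π' → Conv (limpR π) (limpR π')
  | congr_limpL {ι κ : Type} {Γ : ι → Formula α} {Δ : κ → Formula α} {A B C : Formula α}
      {π π' : Proof Γ A} {ρ ρ' : Proof (single B ∔ Δ) C} :
      Conv π π' → Conv ρ ρ' → Conv (limpL π ρ) (limpL π' ρ')
  | congr_ampR {ι : Type} {Γ : ι → Formula α} {A B : Formula α}
      {π π' : Proof Γ A} {ρ ρ' : Proof Γ B} :
      Conv π π' → Conv ρ ρ' → Conv (ampR π ρ) (ampR π' ρ')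
  | congr_ampL₀ {ι : Type} {Γ : ι → Formula α} {A B C : Formula α}
      {π π' : Proof (single A ∔ Γ) C} :
      Conv π π' → Conv (ampL₀ (B := B) π) (ampL₀ π')
  | congr_ampL₁ {ι : Type} {Γ : ι → Formula α} {A B C : Formula α}
      {π π' : Proof (single B ∔ Γ) C} :
      Conv π π' → Conv (ampL₁ (A := A) π) (ampL₁ π')
  | congr_der {ι : Type} {Γ : ι → Formula α} {A B : Formula α}
      {π π' : Proof (single A ∔ Γ) B} : Conv π π' → Conv (der π) (der π')
  | congr_wk {ι : Type} {Γ : ι → Formula α} {A B : Formula α} {π π' : Proof Γ B} :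
      Conv π π' → Conv (wk (A := A) π) (wk π')
  | congr_ctr {ι : Type} {Γ : ι → Formula α} {A B : Formula α}
      {π π' : Proof (single A.bang ∔ single A.bang ∔ Γ) B} :
      Conv π π' → Conv (ctr π) (ctr π')
  | congr_prom {ι : Type} {Γ : ι → Formula α} {A : Formula α} {π π' : Proof Γ A}
      (h : ∀ i, ∃ B : Formula α, Γ i = B.bang) : Conv π π' → Conv (prom h π) (prom h π')
  -- Exchange composes, and commutes with every rule.
  | ex_refl {ι : Type} {Γ : ι → Formula α} {A : Formula α} (π : Proof Γ A)
      (h : ∀ i, Γ (Equiv.refl ι i) = Γ i) : Conv (ex (Equiv.refl ι) h π) π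
  | ex_ex {ι κ θ : Type} {Γ : ι → Formula α} {Δ : κ → Formula α} {Θ : θ → Formula α}
      {A : Formula α} (π : Proof Γ A) (e : ι ≃ κ) (f : κ ≃ θ) (h : ∀ i, Δ (e i) = Γ i)
      (k : ∀ i, Θ (f i) = Δ i) (h' : ∀ i, Θ (e.trans f i) = Γ i) :
      Conv (ex f k (ex e h π)) (ex (e.trans f) h' π)
  | ex_cut_left {ι ι' κ : Type} {Γ : ι → Formula α} {Γ' : ι' → Formula α} {Δ : κ → Formula α}
      {A B : Formula α} (π : Proof Γ A) (ρ : Proof (single A ∔ Δ) B) (e : ι ≃ ι')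
      (h : ∀ i, Γ' (e i) = Γ i)
      (h' : ∀ i, (Γ' ∔ Δ) (Equiv.sumCongr e (Equiv.refl κ) i) = (Γ ∔ Δ) i) :
      Conv (cut (ex e h π) ρ) (ex (Equiv.sumCongr e (Equiv.refl κ)) h' (cut π ρ))
  | ex_cut_right {ι κ κ' : Type} {Γ : ι → Formula α} {Δ : κ → Formula α} {Δ' : κ' → Formula α}
      {A B : Formula α} (π : Proof Γ A) (ρ : Proof (single A ∔ Δ) B) (e : κ ≃ κ')
      (h : ∀ i, (single A ∔ Δ') (Equiv.sumCongr (Equiv.refl Unit) e i) = (single A ∔ Δ) i)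
      (h' : ∀ i, (Γ ∔ Δ') (Equiv.sumCongr (Equiv.refl ι) e i) = (Γ ∔ Δ) i) :
      Conv (cut π (ex (Equiv.sumCongr (Equiv.refl Unit) e) h ρ))
        (ex (Equiv.sumCongr (Equiv.refl ι) e) h' (cut π ρ))
  | ex_tensorR_left {ι ι' κ : Type} {Γ : ι → Formula α} {Γ' : ι' → Formula α}
      {Δ : κ → Formula α} {A B : Formula α} (π : Proof Γ A) (ρ : Proof Δ B) (e : ι ≃ ι')
      (h : ∀ i, Γ' (e i) = Γ i)
      (h' : ∀ i, (Γ' ∔ Δ) (Equiv.sumCongr e (Equiv.refl κ) i) = (Γ ∔ Δ) i) :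
      Conv (tensorR (ex e h π) ρ) (ex (Equiv.sumCongr e (Equiv.refl κ)) h' (tensorR π ρ))
  | ex_tensorR_right {ι κ κ' : Type} {Γ : ι → Formula α} {Δ : κ → Formula α}
      {Δ' : κ' → Formula α} {A B : Formula α} (π : Proof Γ A) (ρ : Proof Δ B) (e : κ ≃ κ')
      (h : ∀ i, Δ' (e i) = Δ i)
      (h' : ∀ i, (Γ ∔ Δ') (Equiv.sumCongr (Equiv.refl ι) e i) = (Γ ∔ Δ) i) :
      Conv (tensorR π (ex e h ρ)) (ex (Equiv.sumCongr (Equiv.refl ι) e) h' (tensorR π ρ))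
  | ex_tensorL {ι ι' : Type} {Γ : ι → Formula α} {Γ' : ι' → Formula α} {A B C : Formula α}
      (π : Proof (single A ∔ single B ∔ Γ) C) (e : ι ≃ ι')
      (h : ∀ i, (single A ∔ single B ∔ Γ') (Equiv.sumCongr (Equiv.refl Unit)
        (Equiv.sumCongr (Equiv.refl Unit) e) i) = (single A ∔ single B ∔ Γ) i)
      (h' : ∀ i, (single (A.tensor B) ∔ Γ') (Equiv.sumCongr (Equiv.refl Unit) e i) =
        (single (A.tensor B) ∔ Γ) i) :
      Conv (tensorL (ex (Equiv.sumCongr (Equiv.refl Unit)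
          (Equiv.sumCongr (Equiv.refl Unit) e)) h π))
        (ex (Equiv.sumCongr (Equiv.refl Unit) e) h' (tensorL π))
  | ex_limpR {ι ι' : Type} {Γ : ι → Formula α} {Γ' : ι' → Formula α} {A B : Formula α}
      (π : Proof (single A ∔ Γ) B) (e : ι ≃ ι')
      (h : ∀ i, (single A ∔ Γ') (Equiv.sumCongr (Equiv.refl Unit) e i) = (single A ∔ Γ) i)
      (h' : ∀ i, Γ' (e i) = Γ i) :
      Conv (limpR (ex (Equiv.sumCongr (Equiv.refl Unit) e) h π)) (ex e h' (limpR π))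
  | ex_limpL_left {ι ι' κ : Type} {Γ : ι → Formula α} {Γ' : ι' → Formula α}
      {Δ : κ → Formula α} {A B C : Formula α} (π : Proof Γ A) (ρ : Proof (single B ∔ Δ) C)
      (e : ι ≃ ι') (h : ∀ i, Γ' (e i) = Γ i)
      (h' : ∀ i, (single (A.limp B) ∔ Γ' ∔ Δ) (Equiv.sumCongr (Equiv.refl Unit)
        (Equiv.sumCongr e (Equiv.refl κ)) i) = (single (A.limp B) ∔ Γ ∔ Δ) i) :
      Conv (limpL (ex e h π) ρ)
        (ex (Equiv.sumCongr (Equiv.refl Unit) (Equiv.sumCongr e (Equiv.refl κ))) h'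
          (limpL π ρ))
  | ex_limpL_right {ι κ κ' : Type} {Γ : ι → Formula α} {Δ : κ → Formula α}
      {Δ' : κ' → Formula α} {A B C : Formula α} (π : Proof Γ A)
      (ρ : Proof (single B ∔ Δ) C) (e : κ ≃ κ')
      (h : ∀ i, (single B ∔ Δ') (Equiv.sumCongr (Equiv.refl Unit) e i) = (single B ∔ Δ) i)
      (h' : ∀ i, (single (A.limp B) ∔ Γ ∔ Δ') (Equiv.sumCongr (Equiv.refl Unit)
        (Equiv.sumCongr (Equiv.refl ι) e) i) = (single (A.limp B) ∔ Γ ∔ Δ) i) :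
      Conv (limpL π (ex (Equiv.sumCongr (Equiv.refl Unit) e) h ρ))
        (ex (Equiv.sumCongr (Equiv.refl Unit) (Equiv.sumCongr (Equiv.refl ι) e)) h'
          (limpL π ρ))
  | ex_ampR {ι ι' : Type} {Γ : ι → Formula α} {Γ' : ι' → Formula α} {A B : Formula α}
      (π : Proof Γ A) (ρ : Proof Γ B) (e : ι ≃ ι') (h : ∀ i, Γ' (e i) = Γ i) :
      Conv (ampR (ex e h π) (ex e h ρ)) (ex e h (ampR π ρ))
  | ex_ampL₀ {ι ι' : Type} {Γ : ι → Formula α} {Γ' : ι' → Formula α} {A B C : Formula α}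
      (π : Proof (single A ∔ Γ) C) (e : ι ≃ ι')
      (h : ∀ i, (single A ∔ Γ') (Equiv.sumCongr (Equiv.refl Unit) e i) = (single A ∔ Γ) i)
      (h' : ∀ i, (single (A.amp B) ∔ Γ') (Equiv.sumCongr (Equiv.refl Unit) e i) =
        (single (A.amp B) ∔ Γ) i) :
      Conv (ampL₀ (B := B) (ex (Equiv.sumCongr (Equiv.refl Unit) e) h π))
        (ex (Equiv.sumCongr (Equiv.refl Unit) e) h' (ampL₀ π))
  | ex_ampL₁ {ι ι' : Type} {Γ : ι → Formula α} {Γ' : ι' → Formula α} {A B C : Formula α}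
      (π : Proof (single B ∔ Γ) C) (e : ι ≃ ι')
      (h : ∀ i, (single B ∔ Γ') (Equiv.sumCongr (Equiv.refl Unit) e i) = (single B ∔ Γ) i)
      (h' : ∀ i, (single (A.amp B) ∔ Γ') (Equiv.sumCongr (Equiv.refl Unit) e i) =
        (single (A.amp B) ∔ Γ) i) :
      Conv (ampL₁ (A := A) (ex (Equiv.sumCongr (Equiv.refl Unit) e) h π))
        (ex (Equiv.sumCongr (Equiv.refl Unit) e) h' (ampL₁ π))
  | ex_der {ι ι' : Type} {Γ : ι → Formula α} {Γ' : ι' → Formula α} {A B : Formula α}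
      (π : Proof (single A ∔ Γ) B) (e : ι ≃ ι')
      (h : ∀ i, (single A ∔ Γ') (Equiv.sumCongr (Equiv.refl Unit) e i) = (single A ∔ Γ) i)
      (h' : ∀ i, (single A.bang ∔ Γ') (Equiv.sumCongr (Equiv.refl Unit) e i) =
        (single A.bang ∔ Γ) i) :
      Conv (der (ex (Equiv.sumCongr (Equiv.refl Unit) e) h π))
        (ex (Equiv.sumCongr (Equiv.refl Unit) e) h' (der π))
  | ex_wk {ι ι' : Type} {Γ : ι → Formula α} {Γ' : ι' → Formula α} {A B : Formula α}
      (π : Proof Γ B) (e : ι ≃ ι') (h : ∀ i, Γ' (e i) = Γ i)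
      (h' : ∀ i, (single A.bang ∔ Γ') (Equiv.sumCongr (Equiv.refl Unit) e i) =
        (single A.bang ∔ Γ) i) :
      Conv (wk (A := A) (ex e h π)) (ex (Equiv.sumCongr (Equiv.refl Unit) e) h' (wk π))
  | ex_ctr {ι ι' : Type} {Γ : ι → Formula α} {Γ' : ι' → Formula α} {A B : Formula α}
      (π : Proof (single A.bang ∔ single A.bang ∔ Γ) B) (e : ι ≃ ι')
      (h : ∀ i, (single A.bang ∔ single A.bang ∔ Γ') (Equiv.sumCongr (Equiv.refl Unit)
        (Equiv.sumCongr (Equiv.refl Unit) e) i) = (single A.bang ∔ single A.bang ∔ Γ) i)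
      (h' : ∀ i, (single A.bang ∔ Γ') (Equiv.sumCongr (Equiv.refl Unit) e i) =
        (single A.bang ∔ Γ) i) :
      Conv (ctr (ex (Equiv.sumCongr (Equiv.refl Unit)
          (Equiv.sumCongr (Equiv.refl Unit) e)) h π))
        (ex (Equiv.sumCongr (Equiv.refl Unit) e) h' (ctr π))
  | ex_prom {ι ι' : Type} {Γ : ι → Formula α} {Γ' : ι' → Formula α} {A : Formula α}
      (π : Proof Γ A) (e : ι ≃ ι') (h : ∀ i, Γ' (e i) = Γ i)
      (hb : ∀ i, ∃ B : Formula α, Γ' i = B.bang) (hb' : ∀ i, ∃ B : Formula α, Γ i = B.bang) :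
      Conv (prom hb (ex e h π)) (ex e h (prom hb' π))
  -- Cuts against axioms and cuts against cuts.
  | cut_ax_left {κ : Type} {Δ : κ → Formula α} {A B : Formula α}
      (ρ : Proof (single A ∔ Δ) B) : Conv (cut (ax A) ρ) ρ
  | cut_ax_right {ι : Type} {Γ : ι → Formula α} {A : Formula α} (π : Proof Γ A) :
      Conv (cut π (pad (ax A))) (pad π)
  | cut_cut {ι κ θ : Type} {Γ : ι → Formula α} {Δ : κ → Formula α} {Θ : θ → Formula α}
      {A B C : Formula α} (π : Proof Γ A) (ρ : Proof (single A ∔ Δ) B)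
      (τ : Proof (single B ∔ Θ) C) :
      Conv (cut (cut π ρ) τ) (unassoc (cut π (assoc (cut ρ τ))))
  | cut_cut_parallel {ι κ θ : Type} {Γ : ι → Formula α} {Δ : κ → Formula α}
      {Θ : θ → Formula α} {A B C : Formula α} (π : Proof Γ A) (ρ : Proof Δ B)
      (τ : Proof (single A ∔ single B ∔ Θ) C) :
      Conv (cut ρ (exl (cut π τ))) (exl (cut π (exl (cut ρ (exl τ)))))
  -- Principal cuts.
  | cut_tensor {ι κ θ : Type} {Γ : ι → Formula α} {Δ : κ → Formula α} {Θ : θ → Formula α}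
      {A B C : Formula α} (π : Proof Γ A) (ρ : Proof Δ B)
      (τ : Proof (single A ∔ single B ∔ Θ) C) :
      Conv (cut (tensorR π ρ) (tensorL τ)) (unassoc (cut π (exl (cut ρ (exl τ)))))
  | cut_limp {ι κ θ : Type} {Γ : ι → Formula α} {Δ : κ → Formula α} {Θ : θ → Formula α}
      {A B C : Formula α} (π : Proof (single A ∔ Γ) B) (ρ : Proof Δ A)
      (τ : Proof (single B ∔ Θ) C) :
      Conv (cut (limpR π) (limpL ρ τ)) (assoc (cut (swap (cut ρ π)) τ))
  | cut_amp₀ {ι κ : Type} {Γ : ι → Formula α} {Δ : κ → Formula α} {A B C : Formula α}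
      (π : Proof Γ A) (ρ : Proof Γ B) (τ : Proof (single A ∔ Δ) C) :
      Conv (cut (ampR π ρ) (ampL₀ τ)) (cut π τ)
  | cut_amp₁ {ι κ : Type} {Γ : ι → Formula α} {Δ : κ → Formula α} {A B C : Formula α}
      (π : Proof Γ A) (ρ : Proof Γ B) (τ : Proof (single B ∔ Δ) C) :
      Conv (cut (ampR π ρ) (ampL₁ τ)) (cut ρ τ)
  | cut_prom_der {ι κ : Type} {Γ : ι → Formula α} {Δ : κ → Formula α} {A B : Formula α}
      (h : ∀ i, ∃ B : Formula α, Γ i = B.bang) (π : Proof Γ A)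
      (ρ : Proof (single A ∔ Δ) B) :
      Conv (cut (prom h π) (der ρ)) (cut π ρ)
  | cut_prom_wk {r : ℕ} {κ : Type} {G : Fin r → Formula α} {Δ : κ → Formula α}
      {A B : Formula α} (h : ∀ i, ∃ B : Formula α, bangs G i = B.bang)
      (π : Proof (bangs G) A) (ρ : Proof Δ B) :
      Conv (cut (prom h π) (wk ρ)) (wkCtx ρ)
  | cut_prom_ctr {r : ℕ} {κ : Type} {G : Fin r → Formula α} {Δ : κ → Formula α}
      {A B : Formula α} (h : ∀ i, ∃ B : Formula α, bangs G i = B.bang)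
      (π : Proof (bangs G) A) (ρ : Proof (single A.bang ∔ single A.bang ∔ Δ) B) :
      Conv (cut (prom h π) (ctr ρ)) (ctrCtx (cut (prom h π) (exl (cut (prom h π) ρ))))
  | cut_prom_prom {ι κ : Type} {Γ : ι → Formula α} {Δ : κ → Formula α} {A B : Formula α}
      (h : ∀ i, ∃ B : Formula α, Γ i = B.bang) (π : Proof Γ A)
      (hb : ∀ i, ∃ B : Formula α, (single A.bang ∔ Δ) i = B.bang)
      (ρ : Proof (single A.bang ∔ Δ) B)
      (hb' : ∀ i, ∃ B : Formula α, (Γ ∔ Δ) i = B.bang) :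
      Conv (cut (prom h π) (prom hb ρ)) (prom hb' (cut (prom h π) ρ))
  -- The left premise of the cut ends with a left rule.
  | cut_left_tensorL {ι κ : Type} {Γ : ι → Formula α} {Δ : κ → Formula α}
      {A B C D : Formula α} (π : Proof (single A ∔ single B ∔ Γ) C)
      (ρ : Proof (single C ∔ Δ) D) :
      Conv (cut (tensorL π) ρ) (unassoc (tensorL (assoc₂ (cut π ρ))))
  | cut_left_limpL {ι κ θ : Type} {Γ : ι → Formula α} {Δ : κ → Formula α} {Θ : θ → Formula α}
      {A B C D : Formula α} (π : Proof Γ A) (ρ : Proof (single B ∔ Δ) C)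
      (τ : Proof (single C ∔ Θ) D) :
      Conv (cut (limpL π ρ) τ) (unassoc₂ (limpL π (assoc (cut ρ τ))))
  | cut_left_ampL₀ {ι κ : Type} {Γ : ι → Formula α} {Δ : κ → Formula α}
      {A B C D : Formula α} (π : Proof (single A ∔ Γ) C) (ρ : Proof (single C ∔ Δ) D) :
      Conv (cut (ampL₀ (B := B) π) ρ) (unassoc (ampL₀ (assoc (cut π ρ))))
  | cut_left_ampL₁ {ι κ : Type} {Γ : ι → Formula α} {Δ : κ → Formula α}
      {A B C D : Formula α} (π : Proof (single B ∔ Γ) C) (ρ : Proof (single C ∔ Δ) D) :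
      Conv (cut (ampL₁ (A := A) π) ρ) (unassoc (ampL₁ (assoc (cut π ρ))))
  | cut_left_der {ι κ : Type} {Γ : ι → Formula α} {Δ : κ → Formula α}
      {A C D : Formula α} (π : Proof (single A ∔ Γ) C) (ρ : Proof (single C ∔ Δ) D) :
      Conv (cut (der π) ρ) (unassoc (der (assoc (cut π ρ))))
  | cut_left_wk {ι κ : Type} {Γ : ι → Formula α} {Δ : κ → Formula α}
      {A C D : Formula α} (π : Proof Γ C) (ρ : Proof (single C ∔ Δ) D) :
      Conv (cut (wk (A := A) π) ρ) (unassoc (wk (cut π ρ)))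
  | cut_left_ctr {ι κ : Type} {Γ : ι → Formula α} {Δ : κ → Formula α}
      {A C D : Formula α} (π : Proof (single A.bang ∔ single A.bang ∔ Γ) C)
      (ρ : Proof (single C ∔ Δ) D) :
      Conv (cut (ctr π) ρ) (unassoc (ctr (assoc₂ (cut π ρ))))
  -- The right premise of the cut ends with a rule that does not introduce the cut formula.
  | cut_right_tensorR_left {ι κ θ : Type} {Γ : ι → Formula α} {Δ : κ → Formula α}
      {Θ : θ → Formula α} {A B D : Formula α} (π : Proof Γ D) (ρ : Proof (single D ∔ Δ) A)
      (τ : Proof Θ B) :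
      Conv (cut π (assoc (tensorR ρ τ))) (assoc (tensorR (cut π ρ) τ))
  | cut_right_tensorR_right {ι κ θ : Type} {Γ : ι → Formula α} {Δ : κ → Formula α}
      {Θ : θ → Formula α} {A B D : Formula α} (π : Proof Γ D) (ρ : Proof Δ A)
      (τ : Proof (single D ∔ Θ) B) :
      Conv (cut π (exl (tensorR ρ τ))) (exl (tensorR ρ (cut π τ)))
  | cut_right_tensorL {ι κ : Type} {Γ : ι → Formula α} {Δ : κ → Formula α}
      {A B C D : Formula α} (π : Proof Γ D)
      (ρ : Proof (single A ∔ single B ∔ single D ∔ Δ) C) :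
      Conv (cut π (exl (tensorL ρ))) (exl (tensorL (push (cut π (pull ρ)))))
  | cut_right_limpR {ι κ : Type} {Γ : ι → Formula α} {Δ : κ → Formula α}
      {A B D : Formula α} (π : Proof Γ D) (ρ : Proof (single A ∔ single D ∔ Δ) B) :
      Conv (cut π (limpR ρ)) (limpR (exl (cut π (exl ρ))))
  | cut_right_limpL_left {ι κ θ : Type} {Γ : ι → Formula α} {Δ : κ → Formula α}
      {Θ : θ → Formula α} {A B C D : Formula α} (π : Proof Γ D)
      (ρ : Proof (single D ∔ Δ) A) (τ : Proof (single B ∔ Θ) C) :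
      Conv (cut π (exl (assocTail (limpL ρ τ)))) (exl (assocTail (limpL (cut π ρ) τ)))
  | cut_right_limpL_right {ι κ θ : Type} {Γ : ι → Formula α} {Δ : κ → Formula α}
      {Θ : θ → Formula α} {A B C D : Formula α} (π : Proof Γ D) (ρ : Proof Δ A)
      (τ : Proof (single B ∔ single D ∔ Θ) C) :
      Conv (cut π (pull (limpL ρ τ))) (pull (limpL ρ (exl (cut π (exl τ)))))
  | cut_right_ampR {ι κ : Type} {Γ : ι → Formula α} {Δ : κ → Formula α}
      {A B D : Formula α} (π : Proof Γ D) (ρ : Proof (single D ∔ Δ) A)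
      (τ : Proof (single D ∔ Δ) B) :
      Conv (cut π (ampR ρ τ)) (ampR (cut π ρ) (cut π τ))
  | cut_right_ampL₀ {ι κ : Type} {Γ : ι → Formula α} {Δ : κ → Formula α}
      {A B C D : Formula α} (π : Proof Γ D) (ρ : Proof (single A ∔ single D ∔ Δ) C) :
      Conv (cut π (exl (ampL₀ (B := B) ρ))) (exl (ampL₀ (exl (cut π (exl ρ)))))
  | cut_right_ampL₁ {ι κ : Type} {Γ : ι → Formula α} {Δ : κ → Formula α}
      {A B C D : Formula α} (π : Proof Γ D) (ρ : Proof (single B ∔ single D ∔ Δ) C) :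
      Conv (cut π (exl (ampL₁ (A := A) ρ))) (exl (ampL₁ (exl (cut π (exl ρ)))))
  | cut_right_der {ι κ : Type} {Γ : ι → Formula α} {Δ : κ → Formula α}
      {A C D : Formula α} (π : Proof Γ D) (ρ : Proof (single A ∔ single D ∔ Δ) C) :
      Conv (cut π (exl (der ρ))) (exl (der (exl (cut π (exl ρ)))))
  | cut_right_wk {ι κ : Type} {Γ : ι → Formula α} {Δ : κ → Formula α}
      {A C D : Formula α} (π : Proof Γ D) (ρ : Proof (single D ∔ Δ) C) :
      Conv (cut π (exl (wk (A := A) ρ))) (exl (wk (cut π ρ)))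
  | cut_right_ctr {ι κ : Type} {Γ : ι → Formula α} {Δ : κ → Formula α}
      {A C D : Formula α} (π : Proof Γ D)
      (ρ : Proof (single A.bang ∔ single A.bang ∔ single D ∔ Δ) C) :
      Conv (cut π (exl (ctr ρ))) (exl (ctr (push (cut π (pull ρ)))))
  -- Expansion of axioms.
  | eta_tensor (A B : Formula α) :
      Conv (ax (A.tensor B)) (unpad (tensorL (assoc (pad (tensorR (ax A) (ax B))))))
  | eta_limp (A B : Formula α) :
      Conv (ax (A.limp B)) (limpR (unpad (unassoc (exl (limpL (ax A) (pad (ax B)))))))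
  | eta_amp (A B : Formula α) :
      Conv (ax (A.amp B))
        (ampR (unpad (ampL₀ (pad (ax A)))) (unpad (ampL₁ (pad (ax B)))))
  | eta_bang (A : Formula α) :
      Conv (ax A.bang) (prom (fun _ => ⟨A, rfl⟩) (unpad (der (pad (ax A)))))
  -- Contraction and weakening.
  | ctr_comm {ι : Type} {Γ : ι → Formula α} {A B : Formula α}
      (π : Proof (single A.bang ∔ single A.bang ∔ Γ) B) : Conv (ctr (exl π)) (ctr π)
  | ctr_assoc {ι : Type} {Γ : ι → Formula α} {A B : Formula α}
      (π : Proof (single A.bang ∔ single A.bang ∔ single A.bang ∔ Γ) B) :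
      Conv (ctr (ctr π)) (ctr (exl (ctr (push π))))
  | ctr_wk {ι : Type} {Γ : ι → Formula α} {A B : Formula α}
      (π : Proof (single A.bang ∔ Γ) B) : Conv (ctr (wk π)) π
  | prom_ctr {ι : Type} {Γ : ι → Formula α} {A B : Formula α}
      (π : Proof (single A.bang ∔ single A.bang ∔ Γ) B)
      (h : ∀ i, ∃ B : Formula α, (single A.bang ∔ Γ) i = B.bang)
      (hb' : ∀ i, ∃ B : Formula α, (single A.bang ∔ single A.bang ∔ Γ) i = B.bang) :
      Conv (prom h (ctr π)) (ctr (prom hb' π))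
  | prom_wk {ι : Type} {Γ : ι → Formula α} {A B : Formula α} (π : Proof Γ B)
      (h : ∀ i, ∃ B : Formula α, (single A.bang ∔ Γ) i = B.bang)
      (hb' : ∀ i, ∃ B : Formula α, Γ i = B.bang) :
      Conv (prom h (wk π)) (wk (prom hb' π))

namespace Proof

/-- A proof of `!A₁, …, !Aᵣ ⊢ B` is plain if for some `n₁, …, nᵣ` it is equivalent to one obtained
from a proof of `n₁ A₁, …, nᵣ Aᵣ ⊢ B` by derelictions, and then contractions and weakenings. -/
def Plain {r : ℕ} {A : Fin r → Formula α} {B : Formula α} (ψ : Proof (bangs A) B) : Prop :=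
  ∃ (n : Fin r → ℕ) (π : Proof (fun p : Σ i, Fin (n i) => A p.1) B),
    Conv ψ (unpad (contract n (pad (derAll n π))))

/-- The tensor product of the promotions of the `ψᵢ`, followed by contractions that identify the
copies of `!A₁, …, !Aᵣ`. -/
def ofComponents {r s : ℕ} {A : Fin r → Formula α} {B : Fin (s + 1) → Formula α}
    (ψ : ∀ i, Proof (bangs A) (B i)) : Proof (bangs A) (bigTensor (bangs B)) :=
  unpad (contract (fun _ => s + 1) (pad
    (ex (Γ := fun p : Fin (s + 1) × Fin r => bangs A p.2) (group (s + 1) r)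
      (group_fst (bangs A))
      (tensorAll (B := bangs B) fun i => prom (fun j => ⟨A j, rfl⟩) (ψ i)))))

/-- A proof of `!A₁, …, !Aᵣ ⊢ !B₀ ⊗ ⋯ ⊗ !Bₛ` is component-wise plain if it is equivalent to the
proof with plain components `ψ₀, …, ψₛ`. -/
def ComponentwisePlain {r s : ℕ} {A : Fin r → Formula α} {B : Fin (s + 1) → Formula α}
    (ψ : Proof (bangs A) (bigTensor (bangs B))) : Prop :=
  ∃ ψ' : ∀ i, Proof (bangs A) (B i), (∀ i, (ψ' i).Plain) ∧ Conv ψ (ofComponents ψ')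

/-- The composite `φ | ψ`: left tensor introductions turn `φ` into a proof of
`B₀ ⊗ ⋯ ⊗ Bₛ ⊢ C`, which is cut against `ψ`. -/
def comp {ι : Type} {Γ : ι → Formula α} {s : ℕ} {B : Fin (s + 1) → Formula α} {C : Formula α}
    (φ : Proof B C) (ψ : Proof Γ (bigTensor B)) : Proof Γ C :=
  unpad (cut ψ (tensorLAll (pad φ)))

end Proof

end ILL

/-! ### Proofs modulo cut-elimination -/

namespace ILL

variable {α : Type u}

/-! Proofs up to `Conv` are organised into a symmetric monoidal category `Ctx`. Its objects are
contexts, its tensor product is concatenation, and a morphism from `X` to `Y` is a natural operation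
turning proofs in a context `X, Θ` into proofs in `Y, Θ`. Cutting against a proof of `X ⊢ A` gives a
morphism `sub` from the context `A` to `X`. In this direction contraction and weakening make `!A`,
and hence `!A₁, …, !Aᵣ`, a commutative monoid, and finite families of morphisms into it can be
multiplied. By commutativity a product depends only on the family (`IsProd.unique`), so two
arrangements of exchanges, contractions and weakenings agree as soon as their factors agree.

Every ingredient of the theorem is such a product. Contractions and weakenings act by products of
the injections `inj A i` (`exists_contract`). A plain proof is `act S y` with `S` a product of
derelicted injections (`plain_iff`). A component-wise plain `ψ` is the action, on the axiom for the
iterated tensor, of the product `U` of the morphisms `sub (prom ψᵢ)` (`exists_ofComponents`), and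
then `φ | ψ` is simply `U` applied to `φ` (`mk_comp`).

Two properties of `U` carry the argument. The principal cuts of a promotion against contraction and
weakening say that each `sub (prom ψᵢ)` is a monoid homomorphism (`isMonHom_sub_prom`); hence so is
`U`, and it restricts to `sub (prom ψᵢ)` along the `i`-th injection (`isMonHom_of_isProd`). Moreover
`U` commutes with promotion (`Promotes.of_isProd`).

Let `V` be the product belonging to `φ`. Then `φ | ψ` is the action of `V ≫ U` on the tensor axiom,
and, `U` being a homomorphism, `V ≫ U` is the product of the morphisms `sub (prom φₖ) ≫ U = sub
(prom (act U φₖ))`. So the components of the composite are the `act U φₖ`. They are plain: if `φₖ`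
is a product of derelicted injections applied to a proof `y`, composing with `U` turns each factor
into some `sub ψⱼ`, since dereliction cancels promotion. Thus `act U φₖ` is `y` with plain proofs
substituted and their contexts contracted, which is plain by `IsPlain.act`. -/

theorem Conv.equivalence {ι : Type} (Γ : ι → Formula α) (A : Formula α) :
    Equivalence (Conv (Γ := Γ) (A := A)) :=
  ⟨Conv.refl, Conv.symm, Conv.trans⟩

/-- Proofs of `Γ ⊢ A` up to equivalence under cut-elimination. -/
def Cls {ι : Type} (Γ : ι → Formula α) (A : Formula α) : Type (max u 1) :=
  Quotient ⟨Conv (Γ := Γ) (A := A), Conv.equivalence Γ A⟩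

namespace Cls

variable {ι κ θ ν ι' κ' θ' : Type} {Γ : ι → Formula α} {Δ : κ → Formula α} {Θ : θ → Formula α}
  {Λ : ν → Formula α} {Γ' : ι' → Formula α} {Δ' : κ' → Formula α} {Θ' : θ' → Formula α}
  {A B C D E : Formula α}

/-- The class of a proof. -/
def mk (π : Proof Γ A) : Cls Γ A := Quotient.mk _ π

theorem mk_eq_mk {π ρ : Proof Γ A} : mk π = mk ρ ↔ Conv π ρ :=
  ⟨fun h => Quotient.exact h, fun h => Quotient.sound h⟩

theorem sound {π ρ : Proof Γ A} (h : Conv π ρ) : mk π = mk ρ := mk_eq_mk.2 h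

theorem ind {p : Cls Γ A → Prop} (h : ∀ π, p (mk π)) (x : Cls Γ A) : p x :=
  Quotient.ind h x

def ax (A : Formula α) : Cls (single A) A := mk (Proof.ax A)

def ex (e : ι ≃ κ) (h : ∀ i, Δ (e i) = Γ i) : Cls Γ A → Cls Δ A :=
  Quotient.map (Proof.ex e h) fun _ _ => Conv.congr_ex e h

def cut : Cls Γ A → Cls (single A ∔ Δ) B → Cls (Γ ∔ Δ) B :=
  Quotient.map₂ Proof.cut fun _ _ h _ _ k => Conv.congr_cut h k

def tensorR : Cls Γ A → Cls Δ B → Cls (Γ ∔ Δ) (A.tensor B) :=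
  Quotient.map₂ Proof.tensorR fun _ _ h _ _ k => Conv.congr_tensorR h k

def tensorL : Cls (single A ∔ single B ∔ Γ) C → Cls (single (A.tensor B) ∔ Γ) C :=
  Quotient.map Proof.tensorL fun _ _ => Conv.congr_tensorL

def der : Cls (single A ∔ Γ) B → Cls (single A.bang ∔ Γ) B :=
  Quotient.map Proof.der fun _ _ => Conv.congr_der

def wk : Cls Γ B → Cls (single A.bang ∔ Γ) B :=
  Quotient.map Proof.wk fun _ _ => Conv.congr_wk

def ctr : Cls (single A.bang ∔ single A.bang ∔ Γ) B → Cls (single A.bang ∔ Γ) B :=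
  Quotient.map Proof.ctr fun _ _ => Conv.congr_ctr

def prom (h : ∀ i, ∃ B : Formula α, Γ i = B.bang) : Cls Γ A → Cls Γ A.bang :=
  Quotient.map (Proof.prom h) fun _ _ => Conv.congr_prom h

section Exchange

theorem ex_refl (e : ι ≃ ι) (he : ∀ i, e i = i) (h : ∀ i, Γ (e i) = Γ i) (x : Cls Γ A) :
    ex e h x = x := by
  obtain rfl : e = Equiv.refl ι := Equiv.ext he
  induction x using ind with
  | h π => exact sound (Conv.ex_refl π h)

theorem trans_eq {e : ι ≃ κ} {f : κ ≃ θ} (h : ∀ i, Δ (e i) = Γ i) (k : ∀ i, Θ (f i) = Δ i)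
    (i : ι) : Θ ((e.trans f) i) = Γ i :=
  (k _).trans (h i)

theorem ex_ex (e : ι ≃ κ) (f : κ ≃ θ) (h : ∀ i, Δ (e i) = Γ i) (k : ∀ i, Θ (f i) = Δ i)
    (x : Cls Γ A) : ex f k (ex e h x) = ex (e.trans f) (trans_eq h k) x := by
  induction x using ind with
  | h π => exact sound (Conv.ex_ex π e f h k _)

/-- Once consecutive exchanges are fused by `ex_ex`, any two rearrangements of a context are
compared by a pointwise check of the bijections. -/
theorem ex_congr {e f : ι ≃ κ} (hef : ∀ i, e i = f i) {h : ∀ i, Δ (e i) = Γ i}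
    {k : ∀ i, Δ (f i) = Γ i} (x : Cls Γ A) : ex e h x = ex f k x := by
  obtain rfl : e = f := Equiv.ext hef
  rfl

theorem sumCongr_left {e : ι ≃ ι'} (h : ∀ i, Γ' (e i) = Γ i) (Δ : κ → Formula α) :
    ∀ i, (Γ' ∔ Δ) (Equiv.sumCongr e (Equiv.refl κ) i) = (Γ ∔ Δ) i := by
  rintro (i | i)
  exacts [h i, rfl]

theorem sumCongr_right {e : κ ≃ κ'} (h : ∀ i, Δ' (e i) = Δ i) (Γ : ι → Formula α) :
    ∀ i, (Γ ∔ Δ') (Equiv.sumCongr (Equiv.refl ι) e i) = (Γ ∔ Δ) i := by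
  rintro (i | i)
  exacts [rfl, h i]

/-- Exchange in the first part of a context. -/
def exLeft (e : ι ≃ ι') (h : ∀ i, Γ' (e i) = Γ i) (x : Cls (Γ ∔ Δ) A) : Cls (Γ' ∔ Δ) A :=
  ex (Equiv.sumCongr e (Equiv.refl κ)) (sumCongr_left h Δ) x

/-- Exchange in the second part of a context. -/
def exRight (e : κ ≃ κ') (h : ∀ i, Δ' (e i) = Δ i) (x : Cls (Γ ∔ Δ) A) : Cls (Γ ∔ Δ') A :=
  ex (Equiv.sumCongr (Equiv.refl ι) e) (sumCongr_right h Γ) x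

def assoc (x : Cls ((Γ ∔ Δ) ∔ Θ) A) : Cls (Γ ∔ Δ ∔ Θ) A :=
  ex (Equiv.sumAssoc ι κ θ) (by rintro ((_ | _) | _) <;> rfl) x

def unassoc (x : Cls (Γ ∔ Δ ∔ Θ) A) : Cls ((Γ ∔ Δ) ∔ Θ) A :=
  ex (Equiv.sumAssoc ι κ θ).symm (by rintro (_ | _ | _) <;> rfl) x

def exl (x : Cls (Γ ∔ Δ ∔ Θ) A) : Cls (Δ ∔ Γ ∔ Θ) A :=
  ex ((Equiv.sumAssoc ι κ θ).symm.trans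
      ((Equiv.sumCongr (Equiv.sumComm ι κ) (Equiv.refl θ)).trans (Equiv.sumAssoc κ ι θ)))
    (by rintro (_ | _ | _) <;> rfl) x

def pad (x : Cls Γ A) : Cls (Γ ∔ emp) A :=
  ex (Γ := Γ) (Equiv.sumEmpty ι Empty).symm (app_sumEmpty Γ) x

def unpad (x : Cls (Γ ∔ emp) A) : Cls Γ A :=
  ex (Equiv.sumEmpty ι Empty) (by rintro (_ | x); exacts [rfl, nomatch x]) x

@[simp] theorem assoc_unassoc (x : Cls (Γ ∔ Δ ∔ Θ) A) : assoc (unassoc x) = x := by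
  rw [assoc, unassoc, ex_ex]; exact ex_refl _ (by rintro (_ | _ | _) <;> rfl) _ _

@[simp] theorem unassoc_assoc (x : Cls ((Γ ∔ Δ) ∔ Θ) A) : unassoc (assoc x) = x := by
  rw [assoc, unassoc, ex_ex]; exact ex_refl _ (by rintro ((_ | _) | _) <;> rfl) _ _

@[simp] theorem exl_exl (x : Cls (Γ ∔ Δ ∔ Θ) A) : exl (exl x) = x := by
  rw [exl, exl, ex_ex]; exact ex_refl _ (by rintro (_ | _ | _) <;> rfl) _ _

@[simp] theorem unpad_pad (x : Cls Γ A) : unpad (pad x) = x := by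
  rw [pad, unpad, ex_ex]; exact ex_refl _ (fun _ => rfl) _ _

@[simp] theorem pad_unpad (x : Cls (Γ ∔ emp) A) : pad (unpad x) = x := by
  rw [pad, unpad, ex_ex]; exact ex_refl _ (by rintro (_ | x); exacts [rfl, nomatch x]) _ _

end Exchange

section Cut

theorem ex_cut_left (x : Cls Γ A) (y : Cls (single A ∔ Δ) B) (e : ι ≃ ι')
    (h : ∀ i, Γ' (e i) = Γ i) : cut (ex e h x) y = exLeft e h (cut x y) := by
  induction x using ind with | h π
  induction y using ind with | h ρ
  exact sound (Conv.ex_cut_left π ρ e h _)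

theorem ex_cut_right (x : Cls Γ A) (y : Cls (single A ∔ Δ) B) (e : κ ≃ κ')
    (h : ∀ i, Δ' (e i) = Δ i) : cut x (exRight e h y) = exRight e h (cut x y) := by
  induction x using ind with | h π
  induction y using ind with | h ρ
  exact sound (Conv.ex_cut_right π ρ e _ _)

theorem cut_ax_left (y : Cls (single A ∔ Δ) B) : cut (ax A) y = y := by
  induction y using ind with | h ρ
  exact sound (Conv.cut_ax_left ρ)

theorem cut_ax_right (x : Cls Γ A) : cut x (pad (ax A)) = pad x := by
  induction x using ind with | h π
  exact sound (Conv.cut_ax_right π)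

theorem cut_cut (x : Cls Γ A) (y : Cls (single A ∔ Δ) B) (z : Cls (single B ∔ Θ) C) :
    cut (cut x y) z = unassoc (cut x (assoc (cut y z))) := by
  induction x using ind with | h π
  induction y using ind with | h ρ
  induction z using ind with | h τ
  exact sound (Conv.cut_cut π ρ τ)

theorem cut_cut_parallel (x : Cls Γ A) (y : Cls Δ B) (z : Cls (single A ∔ single B ∔ Θ) C) :
    cut y (exl (cut x z)) = exl (cut x (exl (cut y (exl z)))) := by
  induction x using ind with | h π
  induction y using ind with | h ρ
  induction z using ind with | h τ
  exact sound (Conv.cut_cut_parallel π ρ τ)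

theorem cut_tensor (x : Cls Γ A) (y : Cls Δ B) (z : Cls (single A ∔ single B ∔ Θ) C) :
    cut (tensorR x y) (tensorL z) = unassoc (cut x (exl (cut y (exl z)))) := by
  induction x using ind with | h π
  induction y using ind with | h ρ
  induction z using ind with | h τ
  exact sound (Conv.cut_tensor π ρ τ)

theorem cut_prom_der (h : ∀ i, ∃ B : Formula α, Γ i = B.bang) (x : Cls Γ A)
    (y : Cls (single A ∔ Δ) B) : cut (prom h x) (der y) = cut x y := by
  induction x using ind with | h π
  induction y using ind with | h ρ
  exact sound (Conv.cut_prom_der h π ρ)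

theorem cut_prom_prom (h : ∀ i, ∃ B : Formula α, Γ i = B.bang) (x : Cls Γ A)
    (hb : ∀ i, ∃ B : Formula α, (single A.bang ∔ Δ) i = B.bang) (y : Cls (single A.bang ∔ Δ) B)
    (hb' : ∀ i, ∃ B : Formula α, (Γ ∔ Δ) i = B.bang) :
    cut (prom h x) (prom hb y) = prom hb' (cut (prom h x) y) := by
  induction x using ind with | h π
  induction y using ind with | h ρ
  exact sound (Conv.cut_prom_prom h π hb ρ hb')

theorem cut_der_left (x : Cls (single A ∔ Γ) C) (y : Cls (single C ∔ Δ) D) :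
    cut (der x) y = unassoc (der (assoc (cut x y))) := by
  induction x using ind with | h π
  induction y using ind with | h ρ
  exact sound (Conv.cut_left_der π ρ)

theorem cut_wk_left (x : Cls Γ C) (y : Cls (single C ∔ Δ) D) :
    cut (wk (A := A) x) y = unassoc (wk (cut x y)) := by
  induction x using ind with | h π
  induction y using ind with | h ρ
  exact sound (Conv.cut_left_wk π ρ)

theorem cut_wk_right (x : Cls Γ D) (y : Cls (single D ∔ Δ) C) :
    cut x (exl (wk (A := A) y)) = exl (wk (cut x y)) := by
  induction x using ind with | h π
  induction y using ind with | h ρ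
  exact sound (Conv.cut_right_wk π ρ)

theorem cut_tensorR_left (x : Cls Γ D) (y : Cls (single D ∔ Δ) A) (z : Cls Θ B) :
    cut x (assoc (tensorR y z)) = assoc (tensorR (cut x y) z) := by
  induction x using ind with | h π
  induction y using ind with | h ρ
  induction z using ind with | h τ
  exact sound (Conv.cut_right_tensorR_left π ρ τ)

theorem cut_tensorR_right (x : Cls Γ D) (y : Cls Δ A) (z : Cls (single D ∔ Θ) B) :
    cut x (exl (tensorR y z)) = exl (tensorR y (cut x z)) := by
  induction x using ind with | h π
  induction y using ind with | h ρ
  induction z using ind with | h τ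
  exact sound (Conv.cut_right_tensorR_right π ρ τ)

theorem cut_tensorL_left (x : Cls (single A ∔ single B ∔ Γ) C) (y : Cls (single C ∔ Δ) D) :
    cut (tensorL x) y = unassoc (tensorL (exRight (Equiv.sumAssoc _ _ _)
      (by rintro ((_ | _) | _) <;> rfl) (assoc (cut x y)))) := by
  induction x using ind with | h π
  induction y using ind with | h ρ
  exact sound (Conv.cut_left_tensorL π ρ)

theorem cut_ctr_left (x : Cls (single A.bang ∔ single A.bang ∔ Γ) C)
    (y : Cls (single C ∔ Δ) D) :
    cut (ctr x) y = unassoc (ctr (exRight (Equiv.sumAssoc _ _ _)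
      (by rintro ((_ | _) | _) <;> rfl) (assoc (cut x y)))) := by
  induction x using ind with | h π
  induction y using ind with | h ρ
  exact sound (Conv.cut_left_ctr π ρ)

/-- Exchange `Γ` past `Δ, Θ`. -/
def push (x : Cls (Γ ∔ Δ ∔ Θ ∔ Λ) A) : Cls (Δ ∔ Θ ∔ Γ ∔ Λ) A :=
  assoc (exl (exRight (Equiv.sumAssoc κ θ ν).symm (by rintro (_ | _ | _) <;> rfl) x))

/-- Exchange `Θ` past `Γ, Δ`. -/
def pull (x : Cls (Γ ∔ Δ ∔ Θ ∔ Λ) A) : Cls (Θ ∔ Γ ∔ Δ ∔ Λ) A :=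
  exRight (Equiv.sumAssoc ι κ ν) (by rintro ((_ | _) | _) <;> rfl) (exl (unassoc x))

theorem cut_tensorL_right (x : Cls Γ D) (y : Cls (single A ∔ single B ∔ single D ∔ Δ) C) :
    cut x (exl (tensorL y)) = exl (tensorL (push (cut x (pull y)))) := by
  induction x using ind with | h π
  induction y using ind with | h ρ
  exact sound (Conv.cut_right_tensorL π ρ)

theorem cut_ctr_right (x : Cls Γ D)
    (y : Cls (single A.bang ∔ single A.bang ∔ single D ∔ Δ) C) :
    cut x (exl (ctr y)) = exl (ctr (push (cut x (pull y)))) := by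
  induction x using ind with | h π
  induction y using ind with | h ρ
  exact sound (Conv.cut_right_ctr π ρ)

end Cut

section Rules

theorem ex_tensorL (x : Cls (single A ∔ single B ∔ Γ) C) (e : ι ≃ ι') (h : ∀ i, Γ' (e i) = Γ i) :
    tensorL (exRight (Equiv.sumCongr (Equiv.refl Unit) e) (sumCongr_right h _) x) =
      exRight e h (tensorL x) := by
  induction x using ind with | h π
  exact sound (Conv.ex_tensorL π e _ _)

theorem ex_ctr (x : Cls (single A.bang ∔ single A.bang ∔ Γ) C) (e : ι ≃ ι')
    (h : ∀ i, Γ' (e i) = Γ i) :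
    ctr (exRight (Equiv.sumCongr (Equiv.refl Unit) e) (sumCongr_right h _) x) =
      exRight e h (ctr x) := by
  induction x using ind with | h π
  exact sound (Conv.ex_ctr π e _ _)

theorem ex_wk (x : Cls Γ B) (e : ι ≃ ι') (h : ∀ i, Γ' (e i) = Γ i) :
    wk (A := A) (ex e h x) = exRight e h (wk x) := by
  induction x using ind with | h π
  exact sound (Conv.ex_wk π e h _)

theorem ex_der (x : Cls (single A ∔ Γ) B) (e : ι ≃ ι') (h : ∀ i, Γ' (e i) = Γ i) :
    der (exRight e h x) = exRight e h (der x) := by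
  induction x using ind with | h π
  exact sound (Conv.ex_der π e _ _)

theorem ex_prom (x : Cls Γ A) (e : ι ≃ ι') (h : ∀ i, Γ' (e i) = Γ i)
    (hb : ∀ i, ∃ B : Formula α, Γ' i = B.bang) (hb' : ∀ i, ∃ B : Formula α, Γ i = B.bang) :
    prom hb (ex e h x) = ex e h (prom hb' x) := by
  induction x using ind with | h π
  exact sound (Conv.ex_prom π e h hb hb')

theorem ex_tensorR_left (x : Cls Γ A) (y : Cls Δ B) (e : ι ≃ ι') (h : ∀ i, Γ' (e i) = Γ i) :
    tensorR (ex e h x) y = exLeft e h (tensorR x y) := by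
  induction x using ind with | h π
  induction y using ind with | h ρ
  exact sound (Conv.ex_tensorR_left π ρ e h _)

theorem ex_tensorR_right (x : Cls Γ A) (y : Cls Δ B) (e : κ ≃ κ') (h : ∀ i, Δ' (e i) = Δ i) :
    tensorR x (ex e h y) = exRight e h (tensorR x y) := by
  induction x using ind with | h π
  induction y using ind with | h ρ
  exact sound (Conv.ex_tensorR_right π ρ e h _)

theorem eta_tensor (A B : Formula α) :
    ax (A.tensor B) = unpad (tensorL (assoc (pad (tensorR (ax A) (ax B))))) :=
  sound (Conv.eta_tensor A B)

theorem ctr_comm (x : Cls (single A.bang ∔ single A.bang ∔ Γ) B) : ctr (exl x) = ctr x := by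
  induction x using ind with | h π
  exact sound (Conv.ctr_comm π)

theorem ctr_assoc (x : Cls (single A.bang ∔ single A.bang ∔ single A.bang ∔ Γ) B) :
    ctr (ctr x) = ctr (exl (ctr (push x))) := by
  induction x using ind with | h π
  exact sound (Conv.ctr_assoc π)

theorem ctr_wk (x : Cls (single A.bang ∔ Γ) B) : ctr (wk x) = x := by
  induction x using ind with | h π
  exact sound (Conv.ctr_wk π)

theorem prom_ctr (x : Cls (single A.bang ∔ single A.bang ∔ Γ) B)
    (h : ∀ i, ∃ B : Formula α, (single A.bang ∔ Γ) i = B.bang)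
    (hb' : ∀ i, ∃ B : Formula α, (single A.bang ∔ single A.bang ∔ Γ) i = B.bang) :
    prom h (ctr x) = ctr (prom hb' x) := by
  induction x using ind with | h π
  exact sound (Conv.prom_ctr π h hb')

theorem prom_wk (x : Cls Γ B) (h : ∀ i, ∃ B : Formula α, (single A.bang ∔ Γ) i = B.bang)
    (hb' : ∀ i, ∃ B : Formula α, Γ i = B.bang) : prom h (wk x) = wk (prom hb' x) := by
  induction x using ind with | h π
  exact sound (Conv.prom_wk π h hb')

end Rules

end Cls

end ILL

/-! ### Natural operations on part of a context -/

namespace ILL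

variable {α : Type u}

open Cls

/-- An operation that replaces `Γ` by `Δ` in the context of a proof, naturally in the rest of the
sequent. -/
structure NatOp {γ δ : Type} (Γ : γ → Formula α) (Δ : δ → Formula α) : Type (max u 1) where
  app : ∀ {θ : Type} {Θ : θ → Formula α} {E : Formula α}, Cls (Γ ∔ Θ) E → Cls (Δ ∔ Θ) E
  app_ex : ∀ {θ θ' : Type} {Θ : θ → Formula α} {Θ' : θ' → Formula α} {E : Formula α}
    (e : θ ≃ θ') (h : ∀ i, Θ' (e i) = Θ i) (x : Cls (Γ ∔ Θ) E),
    app (exRight e h x) = exRight e h (app x)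
  cut_app_left : ∀ {θ ν : Type} {Θ : θ → Formula α} {Λ : ν → Formula α} {D E : Formula α}
    (x : Cls (Γ ∔ Θ) D) (y : Cls (single D ∔ Λ) E),
    cut (app x) y = unassoc (app (assoc (cut x y)))
  cut_app_right : ∀ {θ ν : Type} {Θ : θ → Formula α} {Λ : ν → Formula α} {D E : Formula α}
    (x : Cls Λ D) (y : Cls (Γ ∔ single D ∔ Θ) E),
    cut x (exl (app y)) = exl (app (exl (cut x (exl y))))

namespace Cls

variable {ι κ θ ν : Type} {Γ : ι → Formula α} {Δ : κ → Formula α} {Θ : θ → Formula α}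
  {Λ : ν → Formula α} {A B : Formula α}

theorem assoc_cut (x : Cls ((Γ ∔ Δ) ∔ Θ) A) (y : Cls (single A ∔ Λ) B) :
    cut (assoc x) y =
      exLeft (Equiv.sumAssoc ι κ θ) (by rintro ((_ | _) | _) <;> rfl) (cut x y) :=
  ex_cut_left _ _ _ _

theorem unassoc_cut (x : Cls (Γ ∔ Δ ∔ Θ) A) (y : Cls (single A ∔ Λ) B) :
    cut (unassoc x) y =
      exLeft (Equiv.sumAssoc ι κ θ).symm (by rintro (_ | _ | _) <;> rfl) (cut x y) :=
  ex_cut_left _ _ _ _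

end Cls

namespace NatOp

variable {γ δ ε γ' δ' θ θ' κ κ' ν : Type} {Γ : γ → Formula α} {Δ : δ → Formula α}
  {Λ : ε → Formula α} {Γ' : γ' → Formula α} {Δ' : δ' → Formula α} {Θ : θ → Formula α}
  {Θ' : θ' → Formula α} {Κ : κ → Formula α} {Κ' : κ' → Formula α} {Ν : ν → Formula α}
  {A B C D E : Formula α}

/-- The action on a proof with no further context. -/
def act (F : NatOp Γ Δ) (x : Cls Γ E) : Cls Δ E := unpad (F.app (pad x))

/-- Cutting against the result of an action is the operation applied to the cut. -/
theorem cut_act (F : NatOp Γ Δ) (x : Cls Γ D) (y : Cls (single D ∔ Θ) E) :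
    cut (F.act x) y = F.app (cut x y) := by
  -- The empty context added by `pad` is moved over to the passive part `Θ`, where naturality of `F`
  -- under renaming takes it out again.
  have h : assoc (Θ := Θ) (exLeft (Δ := Θ) (Equiv.sumEmpty γ Empty).symm (app_sumEmpty Γ)
      (cut x y)) = exRight (Equiv.emptySum Empty θ).symm (app_emptySum emp Θ) (cut x y) := by
    simp only [assoc, exLeft, exRight, ex_ex]
    refine ex_congr ?_ _
    rintro (_ | _) <;> rfl
  rw [act, unpad, ex_cut_left, F.cut_app_left, pad, ex_cut_left, h, F.app_ex]
  simp only [unassoc, exLeft, exRight, ex_ex]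
  refine ex_refl _ ?_ _ _
  rintro (_ | _) <;> rfl

/-- Exchange before and after an operation. -/
theorem app_ex_congr (F : NatOp Γ Δ) (c : θ ≃ θ') (hc : ∀ i, Θ' (c i) = Θ i)
    {b : κ ≃ γ ⊕ θ} {b' : κ ≃ γ ⊕ θ'} {a : δ ⊕ θ ≃ κ'} {a' : δ ⊕ θ' ≃ κ'}
    {hb : ∀ i, (Γ ∔ Θ) (b i) = Κ i} {hb' : ∀ i, (Γ ∔ Θ') (b' i) = Κ i}
    {ha : ∀ i, Κ' (a i) = (Δ ∔ Θ) i} {ha' : ∀ i, Κ' (a' i) = (Δ ∔ Θ') i}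
    (h : ∀ i, b' i = Equiv.sumCongr (Equiv.refl γ) c (b i))
    (k : ∀ i, a i = a' (Equiv.sumCongr (Equiv.refl δ) c i)) (x : Cls Κ E) :
    ex a ha (F.app (ex b hb x)) = ex a' ha' (F.app (ex b' hb' x)) := by
  have h₁ : ex b' hb' x = exRight c hc (ex b hb x) := by
    rw [exRight, ex_ex]
    exact ex_congr h x
  rw [h₁, F.app_ex, exRight, ex_ex]
  exact ex_congr k _

/-- Renaming of occurrences. -/
def ofEquiv (e : γ ≃ δ) (h : ∀ i, Δ (e i) = Γ i) : NatOp Γ Δ where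
  app := exLeft e h
  app_ex f k x := by
    simp only [exLeft, exRight, ex_ex]
    refine ex_congr ?_ _
    rintro (_ | _) <;> rfl
  cut_app_left x y := by
    rw [exLeft, ex_cut_left]
    simp only [unassoc, assoc, exLeft, ex_ex]
    refine ex_congr ?_ _
    rintro ((_ | _) | _) <;> rfl
  cut_app_right {θ ν Θ Λ D E} x y := by
    have h₁ : exl (exLeft e h y) = exRight (Equiv.sumCongr e (Equiv.refl _))
        (sumCongr_left h _) (exl y) := by
      simp only [exl, exLeft, exRight, ex_ex]
      refine ex_congr ?_ _
      rintro (_ | _ | _) <;> rfl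
    rw [h₁, ex_cut_right]
    simp only [exl, exLeft, exRight, ex_ex]
    refine ex_congr ?_ _
    rintro (_ | _ | _) <;> rfl

/-- Composition of operations. -/
def comp (F : NatOp Γ Δ) (G : NatOp Δ Λ) : NatOp Γ Λ where
  app x := G.app (F.app x)
  app_ex f k x := by rw [F.app_ex, G.app_ex]
  cut_app_left x y := by rw [G.cut_app_left, F.cut_app_left, assoc_unassoc]
  cut_app_right x y := by rw [G.cut_app_right, F.cut_app_right, exl_exl]

/-- The operation of cutting against `σ`. -/
def ofCut (σ : Cls Γ A) : NatOp (single A) Γ where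
  app x := cut σ x
  app_ex f k x := ex_cut_right σ x f k
  cut_app_left x y := cut_cut σ x y
  cut_app_right x y := by
    have h := cut_cut_parallel x σ (exl y)
    rw [exl_exl] at h
    rw [h, exl_exl]

/-- An operation on two formulas given by a rule. -/
def ofRule (L : ∀ {θ : Type} {Θ : θ → Formula α} {E : Formula α},
      Cls (single A ∔ single B ∔ Θ) E → Cls (single C ∔ Θ) E)
    (hex : ∀ {θ θ' : Type} {Θ : θ → Formula α} {Θ' : θ' → Formula α} {E : Formula α}
      (x : Cls (single A ∔ single B ∔ Θ) E) (e : θ ≃ θ') (h : ∀ i, Θ' (e i) = Θ i),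
      L (exRight (Equiv.sumCongr (Equiv.refl Unit) e) (sumCongr_right h _) x) =
        exRight e h (L x))
    (hleft : ∀ {θ ν : Type} {Θ : θ → Formula α} {Λ : ν → Formula α} {D E : Formula α}
      (x : Cls (single A ∔ single B ∔ Θ) D) (y : Cls (single D ∔ Λ) E),
      cut (L x) y = unassoc (L (exRight (Equiv.sumAssoc _ _ _)
        (by rintro ((_ | _) | _) <;> rfl) (assoc (cut x y)))))
    (hright : ∀ {θ ν : Type} {Θ : θ → Formula α} {Λ : ν → Formula α} {D E : Formula α}
      (x : Cls Λ D) (y : Cls (single A ∔ single B ∔ single D ∔ Θ) E),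
      cut x (exl (L y)) = exl (L (push (cut x (pull y))))) :
    NatOp (single A ∔ single B : Unit ⊕ Unit → Formula α) (single C) where
  app x := L (assoc x)
  app_ex f k x := by
    rw [← hex]
    congr 1
    simp only [assoc, exRight, ex_ex]
    refine ex_congr ?_ _
    rintro ((_ | _) | _) <;> rfl
  cut_app_left x y := by
    rw [hleft]
    congr 2
    rw [assoc_cut]
    simp only [assoc, exLeft, exRight, ex_ex]
    refine ex_congr ?_ _
    rintro (((_ | _) | _) | _) <;> rfl
  cut_app_right {θ ν Θ Λ D E} x y := by
    rw [hright]
    congr 2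
    have h : pull (assoc y) = exRight (Equiv.sumAssoc _ _ _)
        (by rintro ((_ | _) | _) <;> rfl) (exl y) := by
      simp only [pull, assoc, unassoc, exl, exRight, ex_ex]
      refine ex_congr ?_ _
      rintro ((_ | _) | _ | _) <;> rfl
    rw [h, ex_cut_right]
    simp only [push, assoc, exl, exRight, ex_ex]
    refine ex_congr ?_ _
    rintro (_ | (_ | _) | _) <;> rfl

/-- The left tensor rule. -/
def tensorL (A B : Formula α) :
    NatOp (single A ∔ single B : Unit ⊕ Unit → Formula α) (single (A.tensor B)) :=
  ofRule Cls.tensorL ex_tensorL cut_tensorL_left cut_tensorL_right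

/-- The contraction rule. -/
def ctr (A : Formula α) :
    NatOp (single A.bang ∔ single A.bang : Unit ⊕ Unit → Formula α) (single A.bang) :=
  ofRule Cls.ctr ex_ctr cut_ctr_left cut_ctr_right

/-- The weakening rule. -/
def wk (A : Formula α) : NatOp (emp : Empty → Formula α) (single A.bang) where
  app {θ Θ E} x := Cls.wk (ex (Equiv.emptySum Empty θ) (by rintro (x | _); exacts [x.elim, rfl]) x)
  app_ex f k x := by
    rw [← ex_wk]
    congr 1
    simp only [exRight, ex_ex]
    exact ex_congr (by rintro (x | _); exacts [x.elim, rfl]) _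
  cut_app_left x y := by
    rw [cut_wk_left, ex_cut_left]
    congr 2
    simp only [assoc, exLeft, ex_ex]
    refine ex_congr ?_ _
    rintro ((x | _) | _); exacts [x.elim, rfl, rfl]
  cut_app_right {θ ν Θ Λ D E} x y := by
    rw [cut_wk_right]
    congr 2
    have h : exl y = exRight (Equiv.emptySum Empty θ).symm (app_emptySum emp Θ)
        (ex (Equiv.emptySum Empty _) (by rintro (x | _); exacts [x.elim, rfl]) y) := by
      simp only [exl, exRight, ex_ex]
      refine ex_congr ?_ _
      rintro (x | _ | _); exacts [x.elim, rfl, rfl]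
    rw [h, ex_cut_right]
    simp only [exl, exRight, ex_ex]
    symm
    refine ex_refl _ ?_ _ _
    rintro (_ | _) <;> rfl

/-- The operation on a longer context. -/
def whiskerRight (F : NatOp Γ Δ) {ε : Type} (Λ : ε → Formula α) : NatOp (Γ ∔ Λ) (Δ ∔ Λ) where
  app x := unassoc (F.app (assoc x))
  app_ex f k x := by
    simp only [unassoc, assoc, exRight, ex_ex]
    refine F.app_ex_congr (Θ := Λ ∔ _) (Equiv.sumCongr (Equiv.refl _) f.symm)
      (sumCongr_right (fun i => by rw [← k, Equiv.apply_symm_apply]) _) ?_ ?_ _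
    · rintro ((_ | _) | _) <;> simp
    · rintro (_ | _ | _) <;> simp
  cut_app_left x y := by
    rw [unassoc_cut, F.cut_app_left, assoc_cut]
    simp only [unassoc, assoc, exLeft, ex_ex]
    refine F.app_ex_congr (Equiv.sumAssoc _ _ _) ?_ ?_ ?_ _
    · rintro ((_ | _) | _) <;> rfl
    · rintro (((_ | _) | _) | _) <;> rfl
    · rintro (_ | (_ | _) | _) <;> rfl
  cut_app_right {θ ν Θ Ν D E} x y := by
    -- `F` is natural only in a cut formula that stands right next to the part it acts on, so `Λ` is
    -- first moved behind the cut formula into the passive context.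
    have h₁ : exl (unassoc (F.app (assoc y))) = exRight (Equiv.sumAssoc _ _ _).symm
        (by rintro (_ | _ | _) <;> rfl) (exl (Γ := Δ) (Δ := single D)
          (Θ := Λ ∔ Θ) (F.app (exl (exRight (Equiv.sumAssoc _ _ _)
          (by rintro ((_ | _) | _) <;> rfl) (exl y))))) := by
      simp only [unassoc, assoc, exl, exRight, ex_ex]
      refine F.app_ex_congr ((Equiv.sumAssoc _ _ _).symm.trans
        ((Equiv.sumCongr (Equiv.sumComm _ _) (Equiv.refl _)).trans (Equiv.sumAssoc _ _ _)))
        ?_ ?_ ?_ _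
      · rintro (_ | _ | _) <;> rfl
      · rintro ((_ | _) | _ | _) <;> rfl
      · rintro (_ | _ | _ | _) <;> rfl
    rw [h₁, ex_cut_right, F.cut_app_right, exl_exl, ex_cut_right]
    simp only [unassoc, assoc, exl, exRight, ex_ex]
    refine F.app_ex_congr ((Equiv.sumAssoc _ _ _).symm.trans
        ((Equiv.sumCongr (Equiv.sumComm _ _) (Equiv.refl _)).trans (Equiv.sumAssoc _ _ _)))
        ?_ ?_ ?_ _
    · rintro (_ | _ | _) <;> rfl
    · rintro (_ | (_ | _) | _) <;> rfl
    · rintro (_ | _ | _ | _) <;> rfl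

end NatOp

end ILL

/-! ### Central operations -/

namespace ILL

variable {α : Type u}

open Cls

/-- An operation on part of a context that commutes with every operation on a disjoint part. -/
structure Op {γ δ : Type} (Γ : γ → Formula α) (Δ : δ → Formula α) : Type (max u 1)
    extends NatOp Γ Δ where
  central : ∀ {γ' δ' θ : Type} {Γ' : γ' → Formula α} {Δ' : δ' → Formula α} {Θ : θ → Formula α}
    {E : Formula α} (N : NatOp Γ' Δ') (x : Cls (Γ ∔ Γ' ∔ Θ) E),
    N.app (exl (app x)) = exl (app (exl (N.app (exl x))))

namespace Op

variable {γ δ ε γ' δ' θ θ' κ κ' ν : Type} {Γ : γ → Formula α} {Δ : δ → Formula α}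
  {Λ : ε → Formula α} {Γ' : γ' → Formula α} {Δ' : δ' → Formula α} {Θ : θ → Formula α}
  {Θ' : θ' → Formula α} {Κ : κ → Formula α} {Κ' : κ' → Formula α} {Ν : ν → Formula α}
  {A B C D E : Formula α}

@[ext]
theorem ext {F G : Op Γ Δ} (h : ∀ {θ : Type} {Θ : θ → Formula α} {E : Formula α}
    (x : Cls (Γ ∔ Θ) E), F.app x = G.app x) : F = G := by
  obtain ⟨⟨F, _, _, _⟩, _⟩ := F
  obtain ⟨⟨G, _, _, _⟩, _⟩ := G
  have : @F = @G := by
    funext θ Θ E x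
    exact h x
  subst this
  rfl

/-- Renaming of occurrences. -/
def ofEquiv (e : γ ≃ δ) (h : ∀ i, Δ (e i) = Γ i) : Op Γ Δ where
  toNatOp := .ofEquiv e h
  central {γ' δ' θ Γ' Δ' Θ E} N x := by
    have h₁ : exl ((NatOp.ofEquiv e h).app x) = exRight (Equiv.sumCongr e (Equiv.refl _))
        (sumCongr_left h _) (exl x) := by
      simp only [NatOp.ofEquiv, exl, exLeft, exRight, ex_ex]
      refine ex_congr ?_ _
      rintro (_ | _ | _) <;> rfl
    rw [h₁, N.app_ex]
    simp only [NatOp.ofEquiv, exl, exLeft, exRight, ex_ex]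
    refine ex_congr ?_ _
    rintro (_ | _ | _) <;> rfl

/-- Composition of operations. -/
def comp (F : Op Γ Δ) (G : Op Δ Λ) : Op Γ Λ where
  toNatOp := F.toNatOp.comp G.toNatOp
  central N x := by
    change N.app (exl (G.app (F.app x))) = _
    rw [G.central, F.central, exl_exl]
    rfl

/-- The operation of cutting against `σ`. -/
def ofCut (σ : Cls Γ A) : Op (single A) Γ where
  toNatOp := .ofCut σ
  central N x := by
    have h := N.cut_app_right σ (exl x)
    rw [exl_exl] at h
    change N.app (exl (cut σ x)) = exl (cut σ (exl (N.app (exl x))))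
    rw [h, exl_exl]

/-- The operation on a longer context. -/
def whiskerRight (F : Op Γ Δ) {ε : Type} (Λ : ε → Formula α) : Op (Γ ∔ Λ) (Δ ∔ Λ) where
  toNatOp := F.toNatOp.whiskerRight Λ
  central {γ' δ' θ Γ' Δ' Θ E} N x := by
    have h₁ : exl ((F.toNatOp.whiskerRight Λ).app x) = exRight (Equiv.sumAssoc _ _ _).symm
        (by rintro (_ | _ | _) <;> rfl) (exl (Γ := Δ) (Δ := Γ') (Θ := Λ ∔ Θ) (F.app
          (exl (exRight (Equiv.sumAssoc _ _ _) (by rintro ((_ | _) | _) <;> rfl) (exl x))))) := by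
      simp only [NatOp.whiskerRight, unassoc, assoc, exl, exRight, ex_ex]
      refine F.app_ex_congr ((Equiv.sumAssoc _ _ _).symm.trans
        ((Equiv.sumCongr (Equiv.sumComm _ _) (Equiv.refl _)).trans (Equiv.sumAssoc _ _ _)))
        ?_ ?_ ?_ _
      · rintro (_ | _ | _) <;> rfl
      · rintro ((_ | _) | _ | _) <;> rfl
      · rintro (_ | _ | _ | _) <;> rfl
    rw [h₁, N.app_ex, F.central, exl_exl, N.app_ex]
    simp only [NatOp.whiskerRight, unassoc, assoc, exl, exRight, ex_ex]
    refine F.app_ex_congr ((Equiv.sumAssoc _ _ _).symm.trans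
        ((Equiv.sumCongr (Equiv.sumComm _ _) (Equiv.refl _)).trans (Equiv.sumAssoc _ _ _)))
        ?_ ?_ ?_ _
    · rintro (_ | _ | _) <;> rfl
    · rintro (_ | (_ | _) | _) <;> rfl
    · rintro (_ | _ | _ | _) <;> rfl

/-- The principal tensor cut against two axioms inverts the left tensor rule. Hence an operation on
`A, B` is determined by its value on `A, B ⊢ A ⊗ B`. -/
theorem cut_tensorR_ax (z : Cls (single A ∔ single B ∔ Θ) C) :
    cut (tensorR (ax A) (ax B)) (Cls.tensorL z) = unassoc z := by
  rw [cut_tensor, cut_ax_left, cut_ax_left, exl_exl]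

/-- The left tensor rule. -/
def tensorL (A B : Formula α) :
    Op (single A ∔ single B : Unit ⊕ Unit → Formula α) (single (A.tensor B)) where
  toNatOp := .tensorL A B
  central {γ' δ' θ Γ' Δ' Θ E} N x := by
    -- `Conv` has no generator permuting two left rules. Instead the proof is cut against the
    -- η-expanded axiom for `A ⊗ B`: the outer left tensor rule comes out of the cut, `N` slides
    -- through it, and the principal cut cancels the inner left tensor rule.
    have hax : ax (A.tensor B) = (NatOp.tensorL A B).act (tensorR (ax A) (ax B)) :=
      eta_tensor A B
    have key : ∀ {θ : Type} {Θ : θ → Formula α} {E : Formula α}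
        (z : Cls ((single A ∔ single B) ∔ Θ) E),
        cut (tensorR (ax A) (ax B)) ((NatOp.tensorL A B).app z) = z := fun z =>
      (cut_tensorR_ax _).trans (unassoc_assoc z)
    have h := cut_ax_left (exl (N.app (exl ((NatOp.tensorL A B).app x))))
    rw [hax, NatOp.cut_act, N.cut_app_right, exl_exl, key] at h
    rw [h, exl_exl]

/-- An operation on two formulas is a left tensor rule and a cut. -/
theorem app_eq_cut (F : NatOp (single A ∔ single B : Unit ⊕ Unit → Formula α) Δ)
    (x : Cls ((single A ∔ single B) ∔ Θ) E) :
    F.app x = cut (F.act (tensorR (ax A) (ax B))) ((NatOp.tensorL A B).app x) := by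
  rw [NatOp.cut_act]
  congr 1
  exact ((cut_tensorR_ax _).trans (unassoc_assoc x)).symm

/-- The contraction rule. -/
def ctr (A : Formula α) :
    Op (single A.bang ∔ single A.bang : Unit ⊕ Unit → Formula α) (single A.bang) where
  toNatOp := .ctr A
  central N x := by
    -- Contraction is a left tensor rule followed by a cut, and both of these are already central.
    simp only [app_eq_cut (NatOp.ctr A)]
    exact ((tensorL A.bang A.bang).comp
      (ofCut ((NatOp.ctr A).act (tensorR (ax A.bang) (ax A.bang))))).central N x

/-- An operation on the empty context is a cut of the proof it is applied to. -/
theorem app_emptySum_symm (F : NatOp (emp : Empty → Formula α) Δ) (x : Cls Θ E) :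
    F.app (ex (Equiv.emptySum Empty θ).symm (app_emptySum emp Θ) x) =
      ex (((Equiv.sumCongr (Equiv.refl θ) (Equiv.sumEmpty δ Empty))).trans (Equiv.sumComm θ δ))
        (by rintro (_ | _ | x); exacts [rfl, rfl, x.elim])
        (cut x (exl (F.app (ex (Equiv.emptySum Empty _).symm (app_emptySum emp _)
          (pad (ax E)))))) := by
  have h : exl (ex (Δ := emp ∔ single E ∔ emp) (Equiv.emptySum Empty _).symm
      (app_emptySum emp _) (pad (ax E))) = exRight (Equiv.emptySum Empty Empty).symm
        (app_emptySum emp emp) (pad (ax E)) := by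
    simp only [exl, exRight, ex_ex]
    refine ex_congr ?_ _
    rintro (_ | _) <;> rfl
  rw [F.cut_app_right, h, ex_cut_right, cut_ax_right]
  simp only [pad, exl, exRight, ex_ex]
  have h' : ex (Δ := Δ ∔ Θ) (Equiv.refl _) (by rintro (_ | _) <;> rfl) (F.app
      (ex (Equiv.emptySum Empty θ).symm (app_emptySum emp Θ) x)) =
      F.app (ex (Equiv.emptySum Empty θ).symm (app_emptySum emp Θ) x) :=
    ex_refl _ (fun _ => rfl) _ _
  rw [← h']
  refine F.app_ex_congr (Equiv.sumEmpty θ Empty).symm ?_ ?_ ?_ x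
  · exact fun _ => rfl
  · exact fun _ => rfl
  · rintro (_ | _) <;> rfl

/-- The weakening rule. -/
def wk (A : Formula α) : Op (emp : Empty → Formula α) (single A.bang) where
  toNatOp := .wk A
  central {γ' δ' θ Γ' Δ' Θ E} N x := by
    obtain ⟨y, rfl⟩ : ∃ y, x = ex (Equiv.emptySum Empty _).symm (app_emptySum emp _) y :=
      ⟨ex (Equiv.emptySum Empty _) (by rintro (x | _); exacts [x.elim, rfl]) x, by
        rw [ex_ex]
        symm
        refine ex_refl _ ?_ _ _
        rintro (x | _); exacts [x.elim, rfl]⟩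
    have h₁ : exl (ex (Δ := emp ∔ Γ' ∔ Θ) (Equiv.emptySum Empty _).symm (app_emptySum emp _) y) =
        exRight (Equiv.emptySum Empty _).symm (app_emptySum emp _) y := by
      simp only [exl, exRight, ex_ex]
      refine ex_congr ?_ _
      rintro (_ | _) <;> rfl
    have h₂ : ∀ z : Cls (Δ' ∔ Θ) E, exl (Γ := Δ') (Δ := emp) (exRight
        (Equiv.emptySum Empty _).symm (app_emptySum emp _) z) =
        ex (Equiv.emptySum Empty _).symm (app_emptySum emp _) z := by
      intro z
      simp only [exl, exRight, ex_ex]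
      refine ex_congr ?_ _
      rintro (_ | _) <;> rfl
    have h₃ : ∀ {ι κ : Type} {Γ : ι → Formula α} {Κ : κ → Formula α}
        (z : Cls ((Γ ∔ Θ) ∔ Κ ∔ emp) E), exl (ex (Δ := Κ ∔ Γ ∔ Θ)
          ((Equiv.sumCongr (Equiv.refl _) (Equiv.sumEmpty _ _)).trans (Equiv.sumComm _ _))
          (by rintro ((_ | _) | _ | x); exacts [rfl, rfl, rfl, x.elim]) z) =
        exRight (((Equiv.sumCongr (Equiv.refl θ) (Equiv.sumEmpty κ Empty))).trans
          (Equiv.sumComm θ κ)) (by rintro (_ | _ | x); exacts [rfl, rfl, x.elim]) (assoc z) := by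
      intro ι κ Γ Κ z
      simp only [exl, assoc, exRight, ex_ex]
      refine ex_congr ?_ _
      rintro ((_ | _) | _ | x); exacts [rfl, rfl, rfl, x.elim]
    -- A weakened proof is that proof cut against a weakened axiom. The weakening then sits in the
    -- right premise and `N` acts on the left premise only, so the two commute.
    rw [h₁, N.app_ex, h₂, app_emptySum_symm _ y, app_emptySum_symm _ (N.app y), h₃, h₃,
      N.app_ex, N.cut_app_left, assoc_unassoc]

end Op

end ILL

/-! ### The symmetric monoidal category of contexts -/

namespace ILL

variable {α : Type u}

open Cls CategoryTheory MonoidalCategory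

/-- Contexts, as the objects of the category of operations. -/
structure Ctx (α : Type u) : Type (max u 1) where
  ix : Type
  fm : ix → Formula α

namespace Ctx

/-- A family of formulas as an object. -/
abbrev of {ι : Type} (Γ : ι → Formula α) : Ctx α := ⟨ι, Γ⟩

/-- With this direction of arrows proofs are acted on covariantly, and contraction and weakening
appear as a multiplication and a unit rather than as a comultiplication and a counit. -/
instance : Category (Ctx α) where
  Hom X Y := Op X.fm Y.fm
  id X := Op.ofEquiv (Equiv.refl X.ix) fun _ => rfl
  comp F G := F.comp G
  id_comp F := by
    ext θ Θ E x
    exact congrArg F.app (ex_refl _ (by rintro (_ | _) <;> rfl) _ x)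
  comp_id F := by
    ext θ Θ E x
    exact ex_refl _ (by rintro (_ | _) <;> rfl) _ _
  assoc _ _ _ := rfl

variable {X X' Y Y' Z Z' : Ctx α} {θ : Type} {Θ : θ → Formula α} {E : Formula α}

/-- The application of a morphism to the class of a proof. -/
def app (F : X ⟶ Y) (x : Cls (X.fm ∔ Θ) E) : Cls (Y.fm ∔ Θ) E := Op.toNatOp F |>.app x

@[ext]
theorem hom_ext {F G : X ⟶ Y} (h : ∀ {θ : Type} {Θ : θ → Formula α} {E : Formula α}
    (x : Cls (X.fm ∔ Θ) E), app F x = app G x) : F = G :=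
  Op.ext h

@[simp]
theorem comp_app (F : X ⟶ Y) (G : Y ⟶ Z) (x : Cls (X.fm ∔ Θ) E) :
    app (F ≫ G) x = app G (app F x) := rfl

/-- Renaming of occurrences as a morphism. -/
def re (e : X.ix ≃ Y.ix) (h : ∀ i, Y.fm (e i) = X.fm i) : X ⟶ Y := Op.ofEquiv e h

theorem re_app (e : X.ix ≃ Y.ix) (h : ∀ i, Y.fm (e i) = X.fm i) (x : Cls (X.fm ∔ Θ) E) :
    app (re e h) x = exLeft e h x := rfl

/-- All structural isomorphisms below are renamings, so each coherence law reduces to an equality of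
bijections of index types. -/
theorem re_comp (e : X.ix ≃ Y.ix) (h : ∀ i, Y.fm (e i) = X.fm i) (f : Y.ix ≃ Z.ix)
    (k : ∀ i, Z.fm (f i) = Y.fm i) : re e h ≫ re f k = re (e.trans f) (trans_eq h k) := by
  ext θ Θ E x
  rw [comp_app, re_app, re_app, re_app, exLeft, exLeft, exLeft, ex_ex]
  refine ex_congr ?_ _
  rintro (_ | _) <;> rfl

theorem re_congr {e f : X.ix ≃ Y.ix} (hef : ∀ i, e i = f i) (h : ∀ i, Y.fm (e i) = X.fm i)
    (k : ∀ i, Y.fm (f i) = X.fm i) : re e h = re f k := by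
  obtain rfl : e = f := Equiv.ext hef
  rfl

theorem re_refl {e : X.ix ≃ X.ix} (he : ∀ i, e i = i) (h : ∀ i, X.fm (e i) = X.fm i) :
    re e h = 𝟙 X :=
  re_congr (f := Equiv.refl X.ix) he h fun _ => rfl

theorem symm_eq {e : X.ix ≃ Y.ix} (h : ∀ i, Y.fm (e i) = X.fm i) (i : Y.ix) :
    X.fm (e.symm i) = Y.fm i := by
  rw [← h, Equiv.apply_symm_apply]

/-- Renaming of occurrences as an isomorphism. -/
@[simps]
def iso (e : X.ix ≃ Y.ix) (h : ∀ i, Y.fm (e i) = X.fm i) : X ≅ Y where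
  hom := re e h
  inv := re e.symm (symm_eq h)
  hom_inv_id := by rw [re_comp]; exact re_refl (by simp) _
  inv_hom_id := by rw [re_comp]; exact re_refl (by simp) _

section

variable {ι κ θ : Type} (Γ : ι → Formula α) (Δ : κ → Formula α) (Θ : θ → Formula α)

theorem refl_eq (i : ι) : Γ (Equiv.refl ι i) = Γ i := rfl

theorem assoc_eq : ∀ i, (Γ ∔ Δ ∔ Θ) (Equiv.sumAssoc ι κ θ i) = ((Γ ∔ Δ) ∔ Θ) i := by
  rintro ((_ | _) | _) <;> rfl

theorem comm_eq : ∀ i, (Δ ∔ Γ) (Equiv.sumComm ι κ i) = (Γ ∔ Δ) i := by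
  rintro (_ | _) <;> rfl

theorem empty_left_eq : ∀ i, Γ (Equiv.emptySum Empty ι i) = (emp ∔ Γ) i := by
  rintro (x | _)
  exacts [x.elim, rfl]

theorem empty_right_eq : ∀ i, Γ (Equiv.sumEmpty ι Empty i) = (Γ ∔ emp) i := by
  rintro (_ | x)
  exacts [rfl, x.elim]

end

/-- Exchange of two parts of a context. -/
def swap (X Y : Ctx α) : of (X.fm ∔ Y.fm) ≅ of (Y.fm ∔ X.fm) :=
  iso (Equiv.sumComm X.ix Y.ix) (comm_eq X.fm Y.fm)

/-- Left whiskering is right whiskering conjugated by exchange; naturality of the braiding then only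
needs that exchange is an involution. -/
instance : MonoidalCategoryStruct (Ctx α) where
  tensorObj X Y := of (X.fm ∔ Y.fm)
  whiskerRight F Y := Op.whiskerRight F Y.fm
  whiskerLeft X Y Z F := (swap X Y).hom ≫ Op.whiskerRight F X.fm ≫ (swap Z X).hom
  tensorUnit := of emp
  associator X Y Z := iso (Equiv.sumAssoc X.ix Y.ix Z.ix) (assoc_eq X.fm Y.fm Z.fm)
  leftUnitor X := iso (Equiv.emptySum Empty X.ix) (empty_left_eq X.fm)
  rightUnitor X := iso (Equiv.sumEmpty X.ix Empty) (empty_right_eq X.fm)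

theorem id_eq_re (X : Ctx α) : 𝟙 X = re (Equiv.refl X.ix) (refl_eq X.fm) := rfl

theorem associator_hom_eq (X Y Z : Ctx α) : (α_ X Y Z).hom =
    re (X := (X ⊗ Y) ⊗ Z) (Y := X ⊗ (Y ⊗ Z)) (Equiv.sumAssoc X.ix Y.ix Z.ix)
      (assoc_eq X.fm Y.fm Z.fm) := rfl

theorem associator_inv_eq (X Y Z : Ctx α) : (α_ X Y Z).inv =
    re (Y := (X ⊗ Y) ⊗ Z) (X := X ⊗ (Y ⊗ Z)) (Equiv.sumAssoc X.ix Y.ix Z.ix).symm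
      (symm_eq (assoc_eq X.fm Y.fm Z.fm)) := rfl

theorem leftUnitor_hom_eq (X : Ctx α) : (λ_ X).hom =
    re (X := 𝟙_ (Ctx α) ⊗ X) (Equiv.emptySum Empty X.ix) (empty_left_eq X.fm) := rfl

theorem rightUnitor_hom_eq (X : Ctx α) : (ρ_ X).hom =
    re (X := X ⊗ 𝟙_ (Ctx α)) (Equiv.sumEmpty X.ix Empty) (empty_right_eq X.fm) := rfl

theorem swap_hom_eq (X Y : Ctx α) : (swap X Y).hom =
    re (X := X ⊗ Y) (Y := Y ⊗ X) (Equiv.sumComm X.ix Y.ix) (comm_eq X.fm Y.fm) := rfl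

theorem whiskerRight_app (F : X ⟶ Y) (Z : Ctx α) (x : Cls ((X ⊗ Z).fm ∔ Θ) E) :
    app (F ▷ Z) x = unassoc (Γ := Y.fm) (Δ := Z.fm) (app F (assoc x)) := rfl

theorem app_ex_congr (F : X ⟶ Y) {θ θ' κ κ' : Type} {Θ : θ → Formula α}
    {Θ' : θ' → Formula α} {Κ : κ → Formula α} {Κ' : κ' → Formula α} (c : θ ≃ θ')
    (hc : ∀ i, Θ' (c i) = Θ i)
    {b : κ ≃ X.ix ⊕ θ} {b' : κ ≃ X.ix ⊕ θ'} {a : Y.ix ⊕ θ ≃ κ'} {a' : Y.ix ⊕ θ' ≃ κ'}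
    {hb : ∀ i, (X.fm ∔ Θ) (b i) = Κ i} {hb' : ∀ i, (X.fm ∔ Θ') (b' i) = Κ i}
    {ha : ∀ i, Κ' (a i) = (Y.fm ∔ Θ) i} {ha' : ∀ i, Κ' (a' i) = (Y.fm ∔ Θ') i}
    (h : ∀ i, b' i = Equiv.sumCongr (Equiv.refl X.ix) c (b i))
    (k : ∀ i, a i = a' (Equiv.sumCongr (Equiv.refl Y.ix) c i)) (x : Cls Κ E) :
    ex a ha (app F (ex b hb x)) = ex a' ha' (app F (ex b' hb' x)) :=
  NatOp.app_ex_congr (Op.toNatOp F) c hc h k x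

theorem whiskerLeft_app (F : X ⟶ Y) (Z : Ctx α) (x : Cls ((Z ⊗ X).fm ∔ Θ) E) :
    app (Z ◁ F) x = unassoc (Γ := Z.fm) (Δ := Y.fm) (exl (app F (exl (assoc x)))) := by
  change exLeft _ (comm_eq Y.fm Z.fm) (unassoc (Γ := Y.fm) (Δ := Z.fm) (app F
    (assoc (Γ := X.fm) (Δ := Z.fm) (exLeft _ (comm_eq Z.fm X.fm) x)))) = _
  simp only [exLeft, assoc, unassoc, exl, ex_ex]
  refine app_ex_congr F (Equiv.refl _) (fun _ => rfl) ?_ ?_ _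
  · rintro ((_ | _) | _) <;> rfl
  · rintro (_ | _ | _) <;> rfl

theorem central (F : X ⟶ Y) (G : X' ⟶ Y') (x : Cls (X.fm ∔ X'.fm ∔ Θ) E) :
    app G (exl (app F x)) = exl (app F (exl (app G (exl x)))) :=
  Op.central F (Op.toNatOp G) x

/-- The interchange law is exactly what centrality provides; the naturality conditions of `NatOp` do
not include it. -/
theorem whisker_exchange' (F : X ⟶ Y) (G : X' ⟶ Y') : F ▷ X' ≫ Y ◁ G = X ◁ G ≫ F ▷ Y' := by
  ext θ Θ E x
  simp only [comp_app, whiskerLeft_app, whiskerRight_app]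
  erw [assoc_unassoc, central, exl_exl, assoc_unassoc]

theorem re_whiskerRight (e : X.ix ≃ Y.ix) (h : ∀ i, Y.fm (e i) = X.fm i) (Z : Ctx α) :
    re e h ▷ Z = re (X := X ⊗ Z) (Y := Y ⊗ Z) (Equiv.sumCongr e (Equiv.refl Z.ix))
      (sumCongr_left h Z.fm) := by
  ext θ Θ E x
  rw [whiskerRight_app, re_app, re_app]
  simp only [exLeft, assoc, unassoc, ex_ex]
  refine ex_congr ?_ _
  rintro ((_ | _) | _) <;> rfl

theorem re_whiskerLeft (e : X.ix ≃ Y.ix) (h : ∀ i, Y.fm (e i) = X.fm i) (Z : Ctx α) :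
    Z ◁ re e h = re (X := Z ⊗ X) (Y := Z ⊗ Y) (Equiv.sumCongr (Equiv.refl Z.ix) e)
      (sumCongr_right h Z.fm) := by
  ext θ Θ E x
  rw [whiskerLeft_app, re_app, re_app]
  simp only [exLeft, assoc, unassoc, exl, ex_ex]
  refine ex_congr ?_ _
  rintro ((_ | _) | _) <;> rfl

theorem comp_whiskerRight' (F : X ⟶ Y) (G : Y ⟶ Z) (W : Ctx α) :
    (F ≫ G) ▷ W = F ▷ W ≫ G ▷ W := by
  ext θ Θ E x
  simp only [comp_app, whiskerRight_app]
  erw [assoc_unassoc]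

theorem whiskerLeft_comp' (F : X ⟶ Y) (G : Y ⟶ Z) (W : Ctx α) :
    W ◁ (F ≫ G) = W ◁ F ≫ W ◁ G := by
  ext θ Θ E x
  simp only [comp_app, whiskerLeft_app]
  erw [assoc_unassoc, exl_exl]

theorem whiskerRight_associator (F : X ⟶ X') (Y Z : Ctx α) :
    (F ▷ Y) ▷ Z ≫ (α_ X' Y Z).hom = (α_ X Y Z).hom ≫ F ▷ (Y ⊗ Z) := by
  ext θ Θ E x
  change exLeft _ (assoc_eq X'.fm Y.fm Z.fm) (unassoc (Γ := X'.fm ∔ Y.fm) (Δ := Z.fm)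
    (unassoc (Γ := X'.fm) (Δ := Y.fm)
    (app F (assoc (Γ := X.fm) (Δ := Y.fm) (assoc (Γ := X.fm ∔ Y.fm) (Δ := Z.fm) x))))) =
    unassoc (Γ := X'.fm) (Δ := Y.fm ∔ Z.fm)
      (app F (assoc (Γ := X.fm) (Δ := Y.fm ∔ Z.fm) (exLeft _ (assoc_eq X.fm Y.fm Z.fm) x)))
  simp only [exLeft, assoc, unassoc, ex_ex]
  refine app_ex_congr F (Equiv.sumAssoc _ _ _).symm ?_ ?_ ?_ _
  · rintro (_ | _ | _) <;> rfl
  · rintro (((_ | _) | _) | _) <;> rfl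
  · rintro (_ | _ | _ | _) <;> rfl

theorem whiskerLeft_whiskerRight_associator (F : Y ⟶ Y') (X Z : Ctx α) :
    (X ◁ F) ▷ Z ≫ (α_ X Y' Z).hom = (α_ X Y Z).hom ≫ X ◁ (F ▷ Z) := by
  ext θ Θ E x
  rw [comp_app, comp_app, whiskerRight_app, whiskerLeft_app, whiskerLeft_app, whiskerRight_app]
  change exLeft _ (assoc_eq X.fm Y'.fm Z.fm) (unassoc (Γ := X.fm ∔ Y'.fm) (Δ := Z.fm)
    (unassoc (Γ := X.fm) (Δ := Y'.fm)
    (exl (app F (exl (assoc (Γ := X.fm) (Δ := Y.fm)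
      (assoc (Γ := X.fm ∔ Y.fm) (Δ := Z.fm) x))))))) =
    unassoc (Γ := X.fm) (Δ := Y'.fm ∔ Z.fm) (exl (unassoc (Γ := Y'.fm) (Δ := Z.fm)
      (app F (assoc (Γ := Y.fm) (Δ := Z.fm) (exl
        (assoc (Γ := X.fm) (Δ := Y.fm ∔ Z.fm) (exLeft _ (assoc_eq X.fm Y.fm Z.fm) x)))))))
  simp only [exLeft, assoc, unassoc, exl, ex_ex]
  refine app_ex_congr F ((Equiv.sumAssoc _ _ _).symm.trans
        ((Equiv.sumCongr (Equiv.sumComm _ _) (Equiv.refl _)).trans (Equiv.sumAssoc _ _ _)))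
        ?_ ?_ ?_ _
  · rintro (_ | _ | _) <;> rfl
  · rintro (((_ | _) | _) | _) <;> rfl
  · rintro (_ | _ | _ | _) <;> rfl

theorem whiskerLeft_associator (F : Z ⟶ Z') (X Y : Ctx α) :
    (X ⊗ Y) ◁ F ≫ (α_ X Y Z').hom = (α_ X Y Z).hom ≫ X ◁ (Y ◁ F) := by
  ext θ Θ E x
  rw [comp_app, comp_app, whiskerLeft_app, whiskerLeft_app, whiskerLeft_app]
  change exLeft _ (assoc_eq X.fm Y.fm Z'.fm) (unassoc (Γ := X.fm ∔ Y.fm) (Δ := Z'.fm)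
    (exl (app F (exl (assoc (Γ := X.fm ∔ Y.fm) (Δ := Z.fm) x))))) =
    unassoc (Γ := X.fm) (Δ := Y.fm ∔ Z'.fm) (exl (unassoc (Γ := Y.fm) (Δ := Z'.fm)
      (exl (app F (exl (assoc (Γ := Y.fm) (Δ := Z.fm) (exl
        (assoc (Γ := X.fm) (Δ := Y.fm ∔ Z.fm) (exLeft _ (assoc_eq X.fm Y.fm Z.fm) x)))))))))
  simp only [exLeft, assoc, unassoc, exl, ex_ex]
  refine app_ex_congr F ((Equiv.sumCongr (Equiv.sumComm _ _) (Equiv.refl _)).trans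
    (Equiv.sumAssoc _ _ _)) ?_ ?_ ?_ _
  · rintro ((_ | _) | _) <;> rfl
  · rintro (((_ | _) | _) | _) <;> rfl
  · rintro (_ | (_ | _) | _) <;> rfl

theorem whiskerRight_unit (F : X ⟶ Y) : F ▷ 𝟙_ (Ctx α) ≫ (ρ_ Y).hom = (ρ_ X).hom ≫ F := by
  ext θ Θ E x
  change exLeft _ (empty_right_eq Y.fm) (unassoc (Γ := Y.fm) (Δ := emp)
    (app F (assoc (Γ := X.fm) (Δ := emp) x))) = app F (exLeft _ (empty_right_eq X.fm) x)
  rw [← ex_refl (Equiv.refl _) (fun _ => rfl) (fun _ => rfl)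
    (app F (exLeft _ (empty_right_eq X.fm) x))]
  simp only [exLeft, assoc, unassoc, ex_ex]
  refine app_ex_congr F (Equiv.emptySum _ _) ?_ ?_ ?_ _
  · rintro (x | _); exacts [x.elim, rfl]
  · rintro ((_ | x) | _); exacts [rfl, x.elim, rfl]
  · rintro (_ | x | _); exacts [rfl, x.elim, rfl]

theorem whiskerLeft_unit (F : X ⟶ Y) : 𝟙_ (Ctx α) ◁ F ≫ (λ_ Y).hom = (λ_ X).hom ≫ F := by
  ext θ Θ E x
  rw [comp_app, comp_app, whiskerLeft_app]
  change exLeft _ (empty_left_eq Y.fm) (unassoc (Γ := emp) (Δ := Y.fm)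
    (exl (app F (exl (assoc (Γ := emp) (Δ := X.fm) x))))) = app F (exLeft _ (empty_left_eq X.fm) x)
  rw [← ex_refl (Equiv.refl _) (fun _ => rfl) (fun _ => rfl)
    (app F (exLeft _ (empty_left_eq X.fm) x))]
  simp only [exLeft, assoc, unassoc, exl, ex_ex]
  refine app_ex_congr F (Equiv.emptySum _ _) ?_ ?_ ?_ _
  · rintro (x | _); exacts [x.elim, rfl]
  · rintro ((x | _) | _); exacts [x.elim, rfl, rfl]
  · rintro (_ | x | _); exacts [rfl, x.elim, rfl]

instance : MonoidalCategory (Ctx α) where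
  id_tensorHom_id X Y := by
    change 𝟙 X ▷ Y ≫ X ◁ 𝟙 Y = _
    rw [id_eq_re X,
      id_eq_re Y, re_whiskerRight, re_whiskerLeft,
      re_comp]
    refine re_refl ?_ _
    rintro (_ | _) <;> rfl
  tensorHom_comp_tensorHom {X₁ Y₁ Z₁ X₂ Y₂ Z₂} F₁ F₂ G₁ G₂ := by
    change (F₁ ▷ X₂ ≫ Y₁ ◁ F₂) ≫ G₁ ▷ Y₂ ≫ Z₁ ◁ G₂ = (F₁ ≫ G₁) ▷ X₂ ≫ Z₁ ◁ (F₂ ≫ G₂)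
    rw [comp_whiskerRight', whiskerLeft_comp', Category.assoc, Category.assoc,
      ← Category.assoc (Y₁ ◁ F₂), ← whisker_exchange', Category.assoc]
  whiskerLeft_id X Y := by
    rw [id_eq_re Y, re_whiskerLeft]
    refine re_refl ?_ _
    rintro (_ | _) <;> rfl
  id_whiskerRight X Y := by
    rw [id_eq_re X, re_whiskerRight]
    refine re_refl ?_ _
    rintro (_ | _) <;> rfl
  associator_naturality {X₁ X₂ X₃ Y₁ Y₂ Y₃} F₁ F₂ F₃ := by
    change ((F₁ ▷ X₂ ≫ Y₁ ◁ F₂) ▷ X₃ ≫ (Y₁ ⊗ Y₂) ◁ F₃) ≫ _ =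
      _ ≫ F₁ ▷ (X₂ ⊗ X₃) ≫ Y₁ ◁ (F₂ ▷ X₃ ≫ Y₂ ◁ F₃)
    rw [comp_whiskerRight', Category.assoc, Category.assoc, whiskerLeft_associator,
      ← Category.assoc ((Y₁ ◁ F₂) ▷ X₃), whiskerLeft_whiskerRight_associator, Category.assoc,
      ← Category.assoc ((F₁ ▷ X₂) ▷ X₃), whiskerRight_associator, Category.assoc,
      whiskerLeft_comp']
  leftUnitor_naturality := whiskerLeft_unit
  rightUnitor_naturality := whiskerRight_unit
  pentagon W X Y Z := by
    simp only [associator_hom_eq, re_whiskerRight, re_whiskerLeft, re_comp]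
    refine re_congr ?_ _ _
    rintro (((_ | _) | _) | _) <;> rfl
  triangle X Y := by
    simp only [associator_hom_eq, leftUnitor_hom_eq, rightUnitor_hom_eq, re_whiskerRight,
      re_whiskerLeft, re_comp]
    refine re_congr ?_ _ _
    rintro ((_ | x) | _); exacts [rfl, x.elim, rfl]

instance : SymmetricCategory (Ctx α) where
  braiding := swap
  braiding_naturality_left {X Y} F Z := by
    change _ = (swap X Z).hom ≫ (swap Z X).hom ≫ F ▷ Z ≫ (swap Y Z).hom
    have h : (swap X Z).hom ≫ (swap Z X).hom = 𝟙 _ := by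
      rw [swap_hom_eq, swap_hom_eq, re_comp]
      refine re_refl ?_ _
      rintro (_ | _) <;> rfl
    rw [← Category.assoc (swap X Z).hom, h, Category.id_comp]
  braiding_naturality_right X Y Z F := by
    change ((swap X Y).hom ≫ F ▷ X ≫ (swap Z X).hom) ≫ (swap X Z).hom = (swap X Y).hom ≫ F ▷ X
    have h : (swap Z X).hom ≫ (swap X Z).hom = 𝟙 (Z ⊗ X) := by
      rw [swap_hom_eq, swap_hom_eq, re_comp]
      refine re_refl ?_ _
      rintro (_ | _) <;> rfl
    rw [Category.assoc, Category.assoc, h, Category.comp_id]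
  hexagon_forward X Y Z := by
    simp only [associator_hom_eq, swap_hom_eq, re_whiskerRight, re_whiskerLeft, re_comp]
    refine re_congr ?_ _ _
    rintro ((_ | _) | _) <;> rfl
  hexagon_reverse X Y Z := by
    simp only [associator_inv_eq, swap_hom_eq, re_whiskerRight, re_whiskerLeft, re_comp]
    refine re_congr ?_ _ _
    rintro (_ | _ | _) <;> rfl
  symmetry X Y := by
    rw [swap_hom_eq, swap_hom_eq, re_comp]
    refine re_refl ?_ _
    rintro (_ | _) <;> rfl

end Ctx

end ILL

/-! ### Contraction and weakening as a commutative monoid structure -/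

namespace ILL

variable {α : Type u}

open Cls CategoryTheory MonoidalCategory MonObj

namespace Ctx

section Monoid

theorem ctr_app (A : Formula α) {θ : Type} {Θ : θ → Formula α} {E : Formula α}
    (x : Cls ((of (single A.bang) ⊗ of (single A.bang)).fm ∔ Θ) E) :
    app (X := of (single A.bang) ⊗ of (single A.bang)) (Y := of (single A.bang)) (Op.ctr A) x =
      Cls.ctr (assoc x) := rfl

theorem wk_app (A : Formula α) {θ : Type} {Θ : θ → Formula α} {E : Formula α}
    (x : Cls ((𝟙_ (Ctx α)).fm ∔ Θ) E) :
    app (X := 𝟙_ (Ctx α)) (Y := of (single A.bang)) (Op.wk A) x =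
      Cls.wk (ex (Equiv.emptySum Empty θ) (empty_left_eq Θ) x) := rfl

theorem braiding_hom_eq (X Y : Ctx α) : (β_ X Y).hom =
    re (X := X ⊗ Y) (Y := Y ⊗ X) (Equiv.sumComm X.ix Y.ix) (comm_eq X.fm Y.fm) := rfl

theorem braiding_ctr (A : Formula α) : (β_ (of (single A.bang)) (of (single A.bang))).hom ≫
    (show of (single A.bang) ⊗ of (single A.bang) ⟶ of (single A.bang) from Op.ctr A) =
      Op.ctr A := by
  ext θ Θ E x
  erw [comp_app, ctr_app, braiding_hom_eq, re_app, ctr_app]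
  rw [← Cls.ctr_comm]
  congr 1
  simp only [exLeft, assoc, exl, ex_ex]
  refine ex_congr ?_ _
  rintro ((_ | _) | _) <;> rfl

theorem wk_ctr (A : Formula α) :
    (show 𝟙_ (Ctx α) ⟶ of (single A.bang) from Op.wk A) ▷ of (single A.bang) ≫
      (show of (single A.bang) ⊗ of (single A.bang) ⟶ of (single A.bang) from Op.ctr A) =
        (λ_ (of (single A.bang))).hom := by
  ext θ Θ E x
  erw [comp_app, ctr_app, whiskerRight_app, wk_app, assoc_unassoc, Cls.ctr_wk]
  rw [leftUnitor_hom_eq, re_app]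
  simp only [exLeft, assoc, ex_ex]
  refine ex_congr ?_ _
  rintro ((x | _) | _); exacts [x.elim, rfl, rfl]

instance (A : Formula α) : MonObj (of (single A.bang)) where
  one := Op.wk A
  mul := Op.ctr A
  one_mul := wk_ctr A
  mul_one := by
    -- The counit law is given on one side only; commutativity of contraction supplies the other
    -- side.
    rw [← braiding_ctr, ← Category.assoc, BraidedCategory.braiding_naturality_right,
      Category.assoc, wk_ctr, braiding_leftUnitor]
  mul_assoc := by
    ext θ Θ E x
    change Cls.ctr (assoc (unassoc (Γ := single A.bang) (Δ := single A.bang)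
      (Cls.ctr (assoc (Γ := single A.bang) (Δ := single A.bang)
        (assoc (Γ := single A.bang ∔ single A.bang) (Δ := single A.bang) x))))) =
      Cls.ctr (assoc (app (of (single A.bang) ◁ (show of (single A.bang) ⊗ of (single A.bang) ⟶
        of (single A.bang) from Op.ctr A))
        (exLeft _ (assoc_eq (single A.bang) (single A.bang) (single A.bang)) x)))
    rw [whiskerLeft_app]
    erw [ctr_app]
    rw [assoc_unassoc, Cls.ctr_assoc, assoc_unassoc]
    congr 3
    simp only [exLeft, push, exRight, assoc, exl, ex_ex]
    refine ex_congr ?_ _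
    rintro (((_ | _) | _) | _) <;> rfl

instance (A : Formula α) : IsCommMonObj (of (single A.bang)) where
  mul_comm := braiding_ctr A

end Monoid

theorem isCommMonObj_ofIso {C : Type*} [Category C] [MonoidalCategory C] [BraidedCategory C]
    {M X : C} [MonObj M] [IsCommMonObj M] (e : M ≅ X) :
    letI := MonObj.ofIso e; IsCommMonObj X := by
  let := MonObj.ofIso e
  constructor
  change (β_ X X).hom ≫ (e.inv ⊗ₘ e.inv) ≫ μ[M] ≫ e.hom = (e.inv ⊗ₘ e.inv) ≫ μ[M] ≫ e.hom
  rw [← BraidedCategory.braiding_naturality_assoc, IsCommMonObj.mul_comm_assoc]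

theorem nil_eq (A : Fin 0 → Formula α) (i : Empty) :
    bangs A (Equiv.equivOfIsEmpty Empty (Fin 0) i) = emp i := i.elim

theorem cons_eq {r : ℕ} (A : Fin (r + 1) → Formula α) :
    ∀ i, bangs A ((headTail r).symm i) =
      (single (A 0).bang ∔ bangs fun i : Fin r => A i.succ) i := by
  rintro (_ | _) <;> rfl

/-- The context `!A₁, …, !Aᵣ` for `r = 0`. -/
def nilIso (A : Fin 0 → Formula α) : 𝟙_ (Ctx α) ≅ of (bangs A) :=
  iso (Equiv.equivOfIsEmpty Empty (Fin 0)) (nil_eq A)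

/-- The first formula and the rest of `!A₁, …, !Aᵣ`. -/
def consIso {r : ℕ} (A : Fin (r + 1) → Formula α) :
    of (single (A 0).bang) ⊗ of (bangs fun i : Fin r => A i.succ) ≅ of (bangs A) :=
  iso (X := of (single (A 0).bang) ⊗ of (bangs fun i : Fin r => A i.succ))
    (headTail r).symm (cons_eq A)

/-- The monoid structure is transported from iterated tensor products of the `!Aᵢ`, so `nilIso` and
`consIso` are homomorphisms by construction while the context keeps its index type `Fin r`. -/
instance monBangs : {r : ℕ} → (A : Fin r → Formula α) → MonObj (of (bangs A))
  | 0, A => MonObj.ofIso (nilIso A)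
  | r + 1, A => letI := monBangs fun i : Fin r => A i.succ; MonObj.ofIso (consIso A)

instance commBangs : {r : ℕ} → (A : Fin r → Formula α) → IsCommMonObj (of (bangs A))
  | 0, A => isCommMonObj_ofIso (nilIso A)
  | r + 1, A => letI := commBangs fun i : Fin r => A i.succ; isCommMonObj_ofIso (consIso A)

instance (A : Fin 0 → Formula α) : IsMonHom (nilIso A).hom := isMonHom_ofIso _

instance {r : ℕ} (A : Fin (r + 1) → Formula α) : IsMonHom (consIso A).hom :=
  isMonHom_ofIso _

end Ctx

end ILL

/-! ### Products of families of morphisms into a commutative monoid -/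

namespace ILL

variable {α : Type u}

open Cls CategoryTheory MonoidalCategory MonObj

/-- Two ways of splitting one element off a set pick either the same element or two different ones;
in the second case `R` is what is left after removing both. This is the combinatorics behind
reordering a product. -/
theorem exists_sum_decomposition {P Q : Type} (e : Unit ⊕ P ≃ Unit ⊕ Q) :
    (∃ g : P ≃ Q, e (Sum.inl ()) = Sum.inl () ∧ ∀ x, e (Sum.inr x) = Sum.inr (g x)) ∨
    ∃ (R : Type) (p : P ≃ Unit ⊕ R) (q : Q ≃ Unit ⊕ R),
      e (Sum.inl ()) = Sum.inr (q.symm (Sum.inl ())) ∧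
      e (Sum.inr (p.symm (Sum.inl ()))) = Sum.inl () ∧
      ∀ x, e (Sum.inr (p.symm (Sum.inr x))) = Sum.inr (q.symm (Sum.inr x)) := by
  classical
  let o (T : Type) : Unit ⊕ T ≃ Option T :=
    (Equiv.sumComm Unit T).trans (Equiv.optionEquivSumPUnit T).symm
  let E : Option P ≃ Option Q := (o P).symm.trans (e.trans (o Q))
  have hl : E none = o Q (e (Sum.inl ())) := rfl
  have hr (x : P) : E (some x) = o Q (e (Sum.inr x)) := rfl
  have on (T : Type) : (none : Option T) = o T (Sum.inl ()) := rfl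
  have os (T : Type) (x : T) : some x = o T (Sum.inr x) := rfl
  cases h : E none with
  | none =>
    refine Or.inl ⟨E.removeNone, (o Q).injective (hl ▸ h), fun x => (o Q).injective ?_⟩
    rw [← hr, ← os, Equiv.removeNone_some]
    cases hx : E (some x) with
    | none => exact absurd (E.injective (hx.trans h.symm)) (by simp)
    | some y => exact ⟨y, rfl⟩
  | some b =>
    cases hx : E.symm none with
    | none => rw [Equiv.symm_apply_eq] at hx; exact absurd (hx.trans h) (by simp)
    | some x₀ =>
      have hx' : E (some x₀) = none := by rw [← hx, Equiv.apply_symm_apply]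
      let p : P ≃ Unit ⊕ {x : P // x ≠ x₀} := (Equiv.optionSubtypeNe x₀).symm.trans (o _).symm
      -- `E.removeNone` sends `x₀` to `b` and agrees with `E` elsewhere, so the splitting of `Q` at
      -- `b` is the splitting of `P` at `x₀` carried along it.
      refine Or.inr ⟨{x : P // x ≠ x₀}, p, E.removeNone.symm.trans p, (o Q).injective ?_,
        (o Q).injective ?_, fun x => (o Q).injective ?_⟩
      · rw [← hl, ← os]
        exact (Equiv.removeNone_none E hx').symm
      · exact hx'
      · rw [← os]
        change E (some x.1) = some (E.removeNone x.1)
        rw [Equiv.removeNone_some]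
        cases hy : E (some x.1) with
        | none => exact absurd (E.injective (hy.trans hx'.symm)) (by simpa using x.2)
        | some y => exact ⟨y, rfl⟩

namespace Ctx

/-- A morphism from a single formula. -/
structure Leg (W : Ctx α) : Type (max u 1) where
  fm : Formula α
  hom : of (single fm) ⟶ W

/-- Composition of a leg with a morphism. -/
def Leg.map {W W' : Ctx α} (M : W ⟶ W') (a : Leg W) : Leg W' := ⟨a.fm, a.hom ≫ M⟩

/-- The product of a family of morphisms to a monoid object. -/
inductive IsProd (W : Ctx α) [MonObj W] : {κ : Type} → {D : κ → Formula α} → (κ → Leg W) →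
    (of D ⟶ W) → Prop
  | nil {κ : Type} {D : κ → Formula α} (φ : κ → Leg W) (e : κ ≃ Empty)
      (h : ∀ i, emp (e i) = D i) :
      IsProd W φ (re (X := of D) (Y := 𝟙_ (Ctx α)) e h ≫ η[W])
  | cons {κ κ' : Type} {D : κ → Formula α} {D' : κ' → Formula α} (φ : κ → Leg W) (a : Leg W)
      (φ' : κ' → Leg W) (e : κ ≃ Unit ⊕ κ') (h : ∀ i, (single a.fm ∔ D') (e i) = D i)
      (hφ : ∀ i, φ i = Sum.elim (fun _ => a) φ' (e i)) {S : of D' ⟶ W} (hS : IsProd W φ' S) :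
      IsProd W φ (re (X := of D) (Y := of (single a.fm) ⊗ of D') e h ≫ (a.hom ⊗ₘ S) ≫ μ[W])

namespace IsProd

variable {W W' : Ctx α} [MonObj W] [MonObj W'] {κ κ' : Type} {D : κ → Formula α}
  {D' : κ' → Formula α} {φ : κ → Leg W} {φ' : κ' → Leg W} {S T : of D ⟶ W} {S' : of D' ⟶ W}

theorem fm_eq (h : IsProd W φ S) (i : κ) : D i = (φ i).fm := by
  induction h with
  | nil φ e h => exact (e i).elim
  | cons φ a φ' e h hφ hS ih =>
    rw [← h, hφ]
    cases e i with
    | inl _ => rfl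
    | inr j => exact ih j

theorem finite (h : IsProd W φ S) : Finite κ := by
  induction h with
  | nil φ e h => exact Finite.of_equiv _ e.symm
  | cons φ a φ' e h hφ hS ih => exact Finite.of_equiv _ e.symm

/-- Reindexing a product. -/
theorem reindex (hS : IsProd W φ S) (g : κ' ≃ κ) (h : ∀ i, D (g i) = D' i)
    (hφ : ∀ i, φ' i = φ (g i)) : IsProd W φ' (re (X := of D') (Y := of D) g h ≫ S) := by
  cases hS with
  | nil _ e k =>
    rw [← Category.assoc, re_comp]
    exact nil _ _ _
  | cons _ a φ₁ e k hφ₁ hS =>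
    rw [← Category.assoc, re_comp]
    exact cons _ a φ₁ _ _ (fun i => (hφ i).trans (hφ₁ _)) hS

theorem exists_isProd [Finite κ] (φ : κ → Leg W) (h : ∀ i, D i = (φ i).fm) :
    ∃ S : of D ⟶ W, IsProd W φ S := by
  induction κ using Finite.induction_empty_option with
  | of_equiv e ih =>
    obtain ⟨S, hS⟩ := ih (D := fun i => D (e i)) (fun i => φ (e i)) fun i => h _
    exact ⟨_, hS.reindex e.symm (fun i => congrArg D (e.apply_symm_apply i))
      fun i => congrArg φ (e.apply_symm_apply i).symm⟩
  | h_empty => exact ⟨_, nil φ (Equiv.equivOfIsEmpty _ _) fun i => i.elim⟩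
  | h_option ih =>
    obtain ⟨S, hS⟩ := ih (D := fun i => D (some i)) (fun i => φ (some i)) fun i => h _
    refine ⟨_, cons φ (φ none) _ ((Equiv.optionEquivSumPUnit _).trans (Equiv.sumComm _ _)) ?_ ?_
      hS⟩
    · rintro (_ | i)
      exacts [(h none).symm, rfl]
    · rintro (_ | i) <;> rfl

theorem mul_assoc_tensorHom {X Y Z : Ctx α} (a : X ⟶ W) (b : Y ⟶ W) (c : Z ⟶ W) :
    (((a ⊗ₘ b) ≫ μ) ⊗ₘ c) ≫ μ = (α_ X Y Z).hom ≫ (a ⊗ₘ ((b ⊗ₘ c) ≫ μ)) ≫ μ := by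
  have h₁ : ((a ⊗ₘ b) ≫ μ) ⊗ₘ c = ((a ⊗ₘ b) ⊗ₘ c) ≫ μ[W] ▷ W := by
    rw [← tensorHom_id, tensorHom_comp_tensorHom, Category.comp_id]
  have h₂ : a ⊗ₘ ((b ⊗ₘ c) ≫ μ) = (a ⊗ₘ (b ⊗ₘ c)) ≫ W ◁ μ[W] := by
    rw [← id_tensorHom, tensorHom_comp_tensorHom, Category.comp_id]
  rw [h₁, h₂, Category.assoc, MonObj.mul_assoc, associator_naturality_assoc, Category.assoc]

theorem mul_left_comm [IsCommMonObj W] {X Y Z : Ctx α} (a : X ⟶ W) (b : Y ⟶ W) (c : Z ⟶ W) :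
    (a ⊗ₘ ((b ⊗ₘ c) ≫ μ)) ≫ μ =
      (α_ X Y Z).inv ≫ (β_ X Y).hom ▷ Z ≫ (α_ Y X Z).hom ≫ (b ⊗ₘ ((a ⊗ₘ c) ≫ μ)) ≫ μ := by
  rw [← mul_assoc_tensorHom, ← cancel_epi (α_ X Y Z).hom, ← mul_assoc_tensorHom,
    Iso.hom_inv_id_assoc, ← tensorHom_id, tensorHom_comp_tensorHom_assoc, Category.id_comp,
    ← BraidedCategory.braiding_naturality_assoc, IsCommMonObj.mul_comm]

theorem re_tensorHom {X Y Z V : Ctx α} (e : X.ix ≃ Y.ix) (h : ∀ i, Y.fm (e i) = X.fm i)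
    (a : Y ⟶ V) (b : Z ⟶ V) : (re e h ≫ a) ⊗ₘ b = re (X := X ⊗ Z) (Y := Y ⊗ Z)
      (Equiv.sumCongr e (Equiv.refl Z.ix)) (sumCongr_left h Z.fm) ≫ (a ⊗ₘ b) := by
  rw [← re_whiskerRight, ← tensorHom_id, tensorHom_comp_tensorHom, Category.id_comp]

theorem tensorHom_re {X Y Z V : Ctx α} (e : X.ix ≃ Y.ix) (h : ∀ i, Y.fm (e i) = X.fm i)
    (a : Y ⟶ V) (b : Z ⟶ V) : b ⊗ₘ (re e h ≫ a) = re (X := Z ⊗ X) (Y := Z ⊗ Y)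
      (Equiv.sumCongr (Equiv.refl Z.ix) e) (sumCongr_right h Z.fm) ≫ (b ⊗ₘ a) := by
  rw [← re_whiskerLeft, ← id_tensorHom, tensorHom_comp_tensorHom, Category.id_comp]

/-- Any element can be split off a product. -/
theorem exists_cons [IsCommMonObj W] (hS : IsProd W φ S) (e : κ ≃ Unit ⊕ κ') (a : Leg W)
    (h : ∀ i, (single a.fm ∔ D') (e i) = D i)
    (hφ : ∀ i, φ i = Sum.elim (fun _ => a) φ' (e i)) :
    ∃ S' : of D' ⟶ W, IsProd W φ' S' ∧
      S = re (X := of D) (Y := of (single a.fm) ⊗ of D') e h ≫ (a.hom ⊗ₘ S') ≫ μ[W] := by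
  induction hS generalizing κ' with
  | nil φ e₁ h₁ => exact (e₁ (e.symm (Sum.inl ()))).elim
  | @cons κ κ₁ D D₁ φ a₁ φ₁ e₁ h₁ hφ₁ S hS ih =>
    -- The factor to be split off is compared with the head `a₁` of the given product. If they
    -- coincide, the two tails differ by the renaming `g`. Otherwise induction splits `a` off the
    -- tail, and `a₁ · (a · S₂)` is reordered to `a · (a₁ · S₂)` by `mul_left_comm`.
    rcases exists_sum_decomposition (e₁.symm.trans e) with ⟨g, hl, hr⟩ | ⟨R, p, q, hl, hp, hr⟩
    · have ha : a₁ = a := by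
        have h₁ := hφ₁ (e₁.symm (Sum.inl ()))
        rw [hφ, show e (e₁.symm (Sum.inl ())) = Sum.inl () from hl, Equiv.apply_symm_apply] at h₁
        exact h₁.symm
      subst ha
      have hg (i : κ₁) : e (e₁.symm (Sum.inr i)) = Sum.inr (g i) := hr i
      have hgD (i : κ') : D₁ (g.symm i) = D' i := by
        rw [← Equiv.apply_symm_apply g i, Equiv.symm_apply_apply]
        have h₂ := h (e₁.symm (Sum.inr (g.symm i)))
        have h₃ := h₁ (e₁.symm (Sum.inr (g.symm i)))
        rw [hg] at h₂
        rw [Equiv.apply_symm_apply] at h₃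
        exact h₃.trans h₂.symm
      refine ⟨re (X := of D') (Y := of D₁) g.symm hgD ≫ S,
        hS.reindex g.symm hgD fun i => ?_, ?_⟩
      · have h₂ := hφ (e₁.symm (Sum.inr (g.symm i)))
        rw [hg, hφ₁, Equiv.apply_symm_apply, Equiv.apply_symm_apply] at h₂
        exact h₂.symm
      · rw [tensorHom_re, Category.assoc,
          ← Category.assoc (re (X := of D) (Y := of (single a₁.fm) ⊗ of D') e h), re_comp]
        congr 1
        refine re_congr (fun i => ?_) _ _
        obtain ⟨x, rfl⟩ := e₁.symm.surjective i
        rw [Equiv.apply_symm_apply, Equiv.trans_apply]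
        rcases x with ⟨⟩ | x
        · rw [show e (e₁.symm (Sum.inl ())) = Sum.inl () from hl]
          rfl
        · rw [hg]
          exact congrArg Sum.inr (g.symm_apply_apply x).symm
    · have hl' : e (e₁.symm (Sum.inl ())) = Sum.inr (q.symm (Sum.inl ())) := hl
      have hp' : e (e₁.symm (Sum.inr (p.symm (Sum.inl ())))) = Sum.inl () := hp
      have hr' (x : R) : e (e₁.symm (Sum.inr (p.symm (Sum.inr x)))) =
        Sum.inr (q.symm (Sum.inr x)) := hr x
      have ha : φ₁ (p.symm (Sum.inl ())) = a := by
        have h₂ := hφ (e₁.symm (Sum.inr (p.symm (Sum.inl ()))))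
        rw [hp', hφ₁, Equiv.apply_symm_apply] at h₂
        exact h₂
      have ha₁ : φ' (q.symm (Sum.inl ())) = a₁ := by
        have h₂ := hφ (e₁.symm (Sum.inl ()))
        rw [hl', hφ₁, Equiv.apply_symm_apply] at h₂
        exact h₂.symm
      have hR (x : R) : φ' (q.symm (Sum.inr x)) = φ₁ (p.symm (Sum.inr x)) := by
        have h₂ := hφ (e₁.symm (Sum.inr (p.symm (Sum.inr x))))
        rw [hr', hφ₁, Equiv.apply_symm_apply] at h₂
        exact h₂.symm
      have hD' (i : κ') : D' i = (φ' i).fm := by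
        have h₂ := h (e.symm (Sum.inr i))
        have h₃ := hφ (e.symm (Sum.inr i))
        rw [Equiv.apply_symm_apply] at h₂ h₃
        rw [show φ' i = φ (e.symm (Sum.inr i)) from h₃.symm,
          ← (cons φ a₁ φ₁ e₁ h₁ hφ₁ hS).fm_eq]
        exact h₂
      have hq (i : κ') : (single a₁.fm ∔ fun x => D₁ (p.symm (Sum.inr x))) (q i) = D' i := by
        obtain ⟨x, rfl⟩ := q.symm.surjective i
        rw [Equiv.apply_symm_apply, hD']
        rcases x with ⟨⟩ | x
        · rw [ha₁]
          rfl
        · rw [hR]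
          exact hS.fm_eq _
      obtain ⟨S₂, hS₂, hSS⟩ := ih (D' := fun x => D₁ (p.symm (Sum.inr x)))
        (φ' := fun x => φ₁ (p.symm (Sum.inr x))) p (fun i => by
          obtain ⟨x, rfl⟩ := p.symm.surjective i
          rw [Equiv.apply_symm_apply]
          rcases x with ⟨⟩ | x
          · rw [hS.fm_eq, ha]
            rfl
          · rfl) (fun i => by
          obtain ⟨x, rfl⟩ := p.symm.surjective i
          rw [Equiv.apply_symm_apply]
          rcases x with ⟨⟩ | x
          · exact ha
          · rfl)
      refine ⟨_, cons φ' a₁ _ q hq (fun i => ?_) hS₂, ?_⟩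
      · obtain ⟨x, rfl⟩ := q.symm.surjective i
        rw [Equiv.apply_symm_apply]
        rcases x with ⟨⟩ | x
        exacts [ha₁, hR x]
      · rw [hSS, tensorHom_re, tensorHom_re, Category.assoc, Category.assoc, mul_left_comm]
        simp only [associator_inv_eq, associator_hom_eq, braiding_hom_eq, re_whiskerRight]
        simp only [← Category.assoc, re_comp]
        congr 2
        refine re_congr (fun i => ?_) _ _
        obtain ⟨x, rfl⟩ := e₁.symm.surjective i
        simp only [Equiv.trans_apply, Equiv.apply_symm_apply]
        rcases x with ⟨⟩ | x
        · rw [hl']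
          exact congrArg Sum.inr (q.apply_symm_apply _).symm
        -- The bijection underlying the associators and the braiding in `mul_left_comm`.
        · let σ := (Equiv.sumAssoc Unit Unit R).symm.trans
            ((Equiv.sumCongr (Equiv.sumComm Unit Unit) (Equiv.refl R)).trans
              (Equiv.sumAssoc Unit Unit R))
          obtain ⟨y, rfl⟩ := p.symm.surjective x
          rcases y with ⟨⟩ | y
          · rw [hp']
            exact congrArg (fun z => σ (Sum.inr z)) (p.apply_symm_apply _)
          · rw [hr']
            exact (congrArg (fun z => σ (Sum.inr z)) (p.apply_symm_apply _)).trans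
              (congrArg Sum.inr (q.apply_symm_apply _).symm)

/-- Both products can be made to start with the same factor, by `exists_cons`, and their tails agree
by induction. This is the main tool for identifying proofs: differently ordered contractions and
weakenings need only be compared through their factors. -/
theorem unique [IsCommMonObj W] (hS : IsProd W φ S) (hT : IsProd W φ T) : S = T := by
  induction hS with
  | nil φ e₁ h₁ =>
    cases hT with
    | nil _ e₂ h₂ =>
      congr 1
      exact re_congr (fun i => Empty.elim (e₁ i)) _ _
    | cons _ a φ' e h hφ hS => exact (e₁ (e.symm (Sum.inl ()))).elim
  | cons φ a φ' e h hφ hS ih =>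
    obtain ⟨T', hT', rfl⟩ := hT.exists_cons e a h hφ
    rw [ih hT']

/-- The product of a family of morphisms is compatible with monoid homomorphisms. -/
theorem map (hS : IsProd W φ S) (M : W ⟶ W') [IsMonHom M] :
    IsProd W' (fun i => (φ i).map M) (S ≫ M) := by
  induction hS with
  | nil φ e h =>
    rw [Category.assoc, IsMonHom.one_hom]
    exact nil _ e h
  | @cons κ κ' D D' φ a φ' e h hφ S hS ih =>
    have h₁ : (re (X := of D) (Y := of (single a.fm) ⊗ of D') e h ≫ (a.hom ⊗ₘ S) ≫ μ[W]) ≫ M =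
        re (X := of D) (Y := of (single a.fm) ⊗ of D') e h ≫ ((a.map M).hom ⊗ₘ (S ≫ M)) ≫
          μ[W'] := by
      simp [Leg.map]
    rw [h₁]
    refine cons (a := a.map M) _ _ e h (fun i => ?_) ih
    rw [hφ]
    cases e i <;> rfl

/-- The product of two families. -/
theorem sum (hS : IsProd W φ S) (hS' : IsProd W φ' S') :
    IsProd W (D := D ∔ D') (Sum.elim φ φ') ((S ⊗ₘ S') ≫ μ[W]) := by
  induction hS with
  | @nil κ D φ e h =>
    have h₁ : ((re (X := of D) (Y := 𝟙_ (Ctx α)) e h ≫ η[W]) ⊗ₘ S') ≫ μ[W] =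
        re (X := of (D ∔ D')) (Y := of D') ((Equiv.sumCongr e (Equiv.refl κ')).trans
          (Equiv.emptySum Empty κ')) (trans_eq (sumCongr_left h D') (empty_left_eq D')) ≫ S' := by
      rw [re_tensorHom, Category.assoc, one_mul_hom, leftUnitor_hom_eq, ← Category.assoc, re_comp]
    rw [h₁]
    refine hS'.reindex _ _ ?_
    rintro (i | i)
    exacts [(e i).elim, rfl]
  | @cons κ κ₁ D D₁ φ a φ₁ e h hφ S hS ih =>
    have h₁ : ((re (X := of D) (Y := of (single a.fm) ⊗ of D₁) e h ≫ (a.hom ⊗ₘ S) ≫ μ[W]) ⊗ₘ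
        S') ≫ μ[W] = re (X := of (D ∔ D')) (Y := of (single a.fm) ⊗ of (D₁ ∔ D'))
          ((Equiv.sumCongr e (Equiv.refl κ')).trans (Equiv.sumAssoc Unit κ₁ κ'))
          (trans_eq (sumCongr_left h D') (assoc_eq (single a.fm) D₁ D')) ≫
            (a.hom ⊗ₘ ((S ⊗ₘ S') ≫ μ[W])) ≫ μ[W] := by
      rw [re_tensorHom, Category.assoc, mul_assoc_tensorHom, associator_hom_eq,
        ← Category.assoc, re_comp]
    rw [h₁]
    refine cons _ a _ _ _ ?_ ih
    rintro (i | i)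
    · change φ i = Sum.elim _ _ (Equiv.sumAssoc Unit κ₁ κ' (Sum.inl (e i)))
      rw [hφ]
      cases e i <;> rfl
    · rfl

end IsProd

end Ctx

end ILL

/-! ### The action of morphisms on proofs; substitution and dereliction -/

namespace ILL

variable {α : Type u}

open Cls CategoryTheory MonoidalCategory

namespace Cls

variable {ι κ θ : Type} {Γ : ι → Formula α} {Δ : κ → Formula α} {Θ : θ → Formula α}
  {A B C : Formula α}

/-- Cut commutes with the right tensor rule, so a premise can be replaced by an axiom and cut in
afterwards. A morphism acting on the context of that premise can thereby be moved in and out of the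
rule, as `act_tensorR` requires. -/
theorem tensorR_eq_cut (x : Cls Γ A) (y : Cls Δ B) :
    tensorR x y = cut x (tensorR (ax A) y) := by
  have h := cut_tensorR_left x (pad (ax A)) y
  rw [cut_ax_right, pad, pad, ex_tensorR_left, ex_tensorR_left] at h
  have h₁ : assoc (Θ := Δ) (exLeft _ (app_sumEmpty (single A)) (tensorR (ax A) y)) =
      exRight (Equiv.emptySum Empty κ).symm (app_emptySum emp Δ) (tensorR (ax A) y) := by
    simp only [assoc, exLeft, exRight, ex_ex]
    refine ex_congr ?_ _
    rintro (_ | _) <;> rfl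
  have h₂ : assoc (Θ := Δ) (exLeft _ (app_sumEmpty Γ) (tensorR x y)) =
      exRight (Equiv.emptySum Empty κ).symm (app_emptySum emp Δ) (tensorR x y) := by
    simp only [assoc, exLeft, exRight, ex_ex]
    refine ex_congr ?_ _
    rintro (_ | _) <;> rfl
  rw [h₁, h₂, ex_cut_right] at h
  have h₃ (z : Cls (Γ ∔ Δ) (A.tensor B)) : exRight (Equiv.emptySum Empty κ)
      (by rintro (x | _); exacts [x.elim, rfl])
      (exRight (Equiv.emptySum Empty κ).symm (app_emptySum emp Δ) z) = z := by
    simp only [exRight, ex_ex]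
    refine ex_refl _ ?_ _ _
    rintro (_ | _) <;> rfl
  rw [← h₃ (tensorR x y), ← h, h₃]

/-- Exchange of two parts of a context. -/
def swap (x : Cls (Γ ∔ Δ) A) : Cls (Δ ∔ Γ) A :=
  ex (Equiv.sumComm ι κ) (by rintro (_ | _) <;> rfl) x

theorem swap_swap (x : Cls (Γ ∔ Δ) A) : swap (swap x) = x := by
  simp only [swap, ex_ex]
  refine ex_refl _ ?_ _ _
  rintro (_ | _) <;> rfl

theorem swap_tensorR_eq_cut (x : Cls Γ A) (y : Cls Δ B) :
    swap (tensorR x y) = cut y (swap (tensorR x (ax B))) := by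
  have h := cut_tensorR_right y x (pad (ax B))
  rw [cut_ax_right, pad, pad, ex_tensorR_right, ex_tensorR_right] at h
  have h₁ : exl (exRight _ (app_sumEmpty (single B)) (tensorR x (ax B))) =
      exRight (Equiv.sumEmpty ι Empty).symm (app_sumEmpty Γ) (swap (tensorR x (ax B))) := by
    simp only [exl, swap, exRight, ex_ex]
    refine ex_congr ?_ _
    rintro (_ | _) <;> rfl
  have h₂ : exl (exRight _ (app_sumEmpty Δ) (tensorR x y)) =
      exRight (Equiv.sumEmpty ι Empty).symm (app_sumEmpty Γ) (swap (tensorR x y)) := by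
    simp only [exl, swap, exRight, ex_ex]
    refine ex_congr ?_ _
    rintro (_ | _) <;> rfl
  rw [h₁, h₂, ex_cut_right] at h
  have h₃ (z : Cls (Δ ∔ Γ) (A.tensor B)) : exRight (Equiv.sumEmpty ι Empty)
      (by rintro (_ | x); exacts [rfl, x.elim])
      (exRight (Equiv.sumEmpty ι Empty).symm (app_sumEmpty Γ) z) = z := by
    simp only [exRight, ex_ex]
    refine ex_refl _ ?_ _ _
    rintro (_ | _) <;> rfl
  rw [← h₃ (swap (tensorR x y)), ← h, h₃]

/-- The dereliction of an axiom. -/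
def derAx (A : Formula α) : Cls (single A.bang) A := unpad (der (pad (ax A)))

/-- Dereliction is a cut against the derelicted axiom. This allows `derM` to be a substitution,
whose centrality is automatic. -/
theorem cut_derAx (x : Cls (single A ∔ Γ) B) : cut (derAx A) x = der x := by
  have h : assoc (Θ := Γ) (exLeft (Equiv.sumEmpty Unit Empty).symm (app_sumEmpty (single A)) x) =
      exRight (Equiv.emptySum Empty ι).symm (app_emptySum emp Γ) x := by
    simp only [assoc, exLeft, exRight, ex_ex]
    refine ex_congr ?_ _
    rintro (_ | _) <;> rfl
  rw [derAx, unpad, ex_cut_left, cut_der_left, pad, ex_cut_left, cut_ax_left, h, ex_der]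
  simp only [unassoc, exLeft, exRight, ex_ex]
  refine ex_refl _ ?_ _ _
  rintro (_ | _) <;> rfl

end Cls

namespace Ctx

variable {X X' Y Y' Z : Ctx α} {ι θ : Type} {Γ : ι → Formula α} {Θ : θ → Formula α}
  {A B E : Formula α}

/-- The action of a morphism on proofs. -/
def act (F : X ⟶ Y) (x : Cls X.fm E) : Cls Y.fm E := unpad (app F (pad x))

@[simp]
theorem act_comp (F : X ⟶ Y) (G : Y ⟶ Z) (x : Cls X.fm E) :
    act (F ≫ G) x = act G (act F x) := by
  rw [act, act, act, comp_app, pad_unpad]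

theorem act_re (e : X.ix ≃ Y.ix) (h : ∀ i, Y.fm (e i) = X.fm i) (x : Cls X.fm E) :
    act (re e h) x = ex e h x := by
  rw [act, re_app]
  simp only [pad, unpad, exLeft, ex_ex]
  exact ex_congr (fun _ => rfl) _

theorem cut_act (F : X ⟶ Y) (x : Cls X.fm A) (y : Cls (single A ∔ Θ) E) :
    cut (act F x) y = app F (cut x y) :=
  NatOp.cut_act (Op.toNatOp F) x y

theorem app_exRight (F : X ⟶ Y) {θ' : Type} {Θ' : θ' → Formula α} (e : θ ≃ θ')
    (h : ∀ i, Θ' (e i) = Θ i) (x : Cls (X.fm ∔ Θ) E) :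
    app F (exRight e h x) = exRight e h (app F x) :=
  NatOp.app_ex (Op.toNatOp F) e h x

theorem act_whiskerRight (F : X ⟶ Y) (x : Cls (X ⊗ Z).fm E) : act (F ▷ Z) x = app F x := by
  have h : assoc (Γ := X.fm) (Δ := Z.fm) (pad x) =
      exRight (Equiv.sumEmpty _ _).symm (app_sumEmpty Z.fm) x := by
    simp only [assoc, pad, exRight, ex_ex]
    refine ex_congr ?_ _
    rintro (_ | _) <;> rfl
  rw [act, whiskerRight_app, h, app_exRight]
  simp only [unassoc, unpad, exRight, ex_ex]
  refine ex_refl _ ?_ _ _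
  rintro (_ | _) <;> rfl

theorem act_whiskerLeft (F : X ⟶ Y) (x : Cls (Z ⊗ X).fm E) :
    act (Z ◁ F) x = Cls.swap (app F (Cls.swap (Γ := Z.fm) x)) := by
  change act ((swap Z X).hom ≫ F ▷ Z ≫ (swap Y Z).hom) x = _
  rw [act_comp, act_comp, act_whiskerRight, swap_hom_eq, swap_hom_eq, act_re, act_re]
  rfl

theorem act_tensorR (F : X ⟶ Y) (G : X' ⟶ Y') (x : Cls X.fm A) (y : Cls X'.fm B) :
    act (F ⊗ₘ G) (tensorR x y) = tensorR (act F x) (act G y) := by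
  rw [MonoidalCategory.tensorHom_def, act_comp, act_whiskerRight]
  erw [act_whiskerLeft]
  rw [tensorR_eq_cut x y, ← cut_act, ← tensorR_eq_cut, swap_tensorR_eq_cut, ← cut_act,
    ← swap_tensorR_eq_cut, swap_swap]

/-- The morphism given by cutting against a proof. -/
def sub (x : Cls X.fm A) : of (single A) ⟶ X := Op.ofCut x

theorem sub_app (x : Cls X.fm A) (y : Cls (single A ∔ Θ) E) : app (sub x) y = cut x y := rfl

theorem sub_comp (x : Cls X.fm A) (F : X ⟶ Y) : sub x ≫ F = sub (act F x) := by
  ext θ Θ E y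
  rw [comp_app, sub_app, sub_app, cut_act]

theorem act_sub_ax (x : Cls X.fm A) : act (X := of (single A)) (sub x) (ax A) = x := by
  rw [act, sub_app, cut_ax_right, unpad_pad]

/-- Dereliction as a morphism. -/
def derM (A : Formula α) : of (single A) ⟶ of (single A.bang) :=
  sub (X := of (single A.bang)) (derAx A)

theorem derM_app (x : Cls (single A ∔ Θ) E) : app (X := of (single A)) (derM A) x = der x :=
  cut_derAx x

theorem derM_sub_prom (h : ∀ i, ∃ B : Formula α, X.fm i = B.bang) (x : Cls X.fm A) :
    derM A ≫ sub (prom h x) = sub x := by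
  ext θ Θ E y
  rw [comp_app, sub_app, sub_app, derM_app, cut_prom_der]

/-- The axiom for `B₀, …, Bₛ ⊢ B₀ ⊗ ⋯ ⊗ Bₛ`. -/
def tensorAx : {s : ℕ} → (B : Fin (s + 1) → Formula α) → Cls B (bigTensor B)
  | 0, B => ex finOneEquiv.symm (fun _ => rfl) (ax (B 0))
  | s + 1, B => ex (Γ := single (B 0) ∔ fun i : Fin (s + 1) => B i.succ) (headTail (s + 1)).symm
      (by rintro (_ | _) <;> rfl) (tensorR (ax (B 0)) (tensorAx fun i => B i.succ))

/-- Each left tensor introduction meets a right tensor rule in a principal cut, and the first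
premise of that rule is an axiom, so the cuts undo the introductions one at a time. -/
theorem cut_tensorAx {s : ℕ} (B : Fin (s + 1) → Formula α) {κ : Type} {Δ : κ → Formula α}
    {C : Formula α} (π : Proof (B ∔ Δ) C) :
    cut (tensorAx B) (Cls.mk (Proof.tensorLAll π)) = Cls.mk π := by
  induction s generalizing κ with
  | zero =>
    refine (ex_cut_left (A := B 0) (Γ := single (B 0)) _ _ _ _).trans ?_
    erw [cut_ax_left]
    change ex _ _ (ex _ _ (Cls.mk π)) = _
    refine (ex_ex (Γ := B ∔ Δ) (Δ := single (B 0) ∔ Δ) (Θ := B ∔ Δ) _ _ _ _ _).trans ?_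
    refine ex_refl _ ?_ _ _
    rintro (i | _)
    · exact congrArg Sum.inl (finOneEquiv.symm_apply_apply i)
    · rfl
  | succ s ih =>
    refine (ex_cut_left (A := (B 0).tensor (bigTensor fun i : Fin (s + 1) => B i.succ))
      (Γ := single (B 0) ∔ fun i : Fin (s + 1) => B i.succ) _ _ _ _).trans ?_
    have h : Cls.mk (Proof.tensorLAll π) = Cls.tensorL (exl (Cls.mk (Proof.tensorLAll
      (Proof.exl (Proof.uncons π))))) := rfl
    rw [h]
    erw [cut_tensor]
    rw [cut_ax_left, exl_exl, ih]
    change exLeft _ _ (unassoc (exl (exl (ex _ _ (Cls.mk π))))) = Cls.mk π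
    rw [exl_exl]
    simp only [unassoc, exLeft, ex_ex]
    refine ex_refl _ ?_ _ _
    rintro (i | _)
    · exact Fin.cases rfl (fun _ => rfl) i
    · rfl

end Ctx

end ILL

/-! ### Injections into `!A₁, …, !Aᵣ` and homomorphisms out of it -/

namespace ILL

variable {α : Type u}

open Cls CategoryTheory MonoidalCategory MonObj

section

variable {C : Type*} [Category C] [MonoidalCategory C]

theorem isMonHom_one (X : C) [MonObj X] : IsMonHom η[X] where
  one_hom := Category.id_comp _
  mul_hom := by
    rw [one_mul_hom]
    rfl

/-- Commutativity makes the multiplication a homomorphism; this is why a product of homomorphisms is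
again one. -/
theorem isMonHom_mul [BraidedCategory C] (X : C) [MonObj X] [IsCommMonObj X] : IsMonHom μ[X] where
  one_hom := by
    rw [MonObj.tensorObj.one_def, Category.assoc, one_mul_hom, Iso.inv_hom_id_assoc]
  mul_hom := by
    rw [MonObj.tensorObj.mul_def, Category.assoc, MonObj.mul_mul_mul_comm]

end

namespace Ctx

/-- In elements: `(x, 1) · (1, y) = (x, y)`. -/
theorem unit_tensor_unit_comp_mul (X Y : Ctx α) [MonObj X] [MonObj Y] :
    (((ρ_ X).inv ≫ X ◁ η[Y]) ⊗ₘ ((λ_ Y).inv ≫ η[X] ▷ Y)) ≫ μ[X ⊗ Y] = 𝟙 (X ⊗ Y) := by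
  have h : ((ρ_ X).inv ⊗ₘ (λ_ Y).inv) ≫ tensorμ X (𝟙_ (Ctx α)) (𝟙_ (Ctx α)) Y =
      ((ρ_ X).inv ⊗ₘ (λ_ Y).inv) := by
    rw [tensorμ, ← cancel_epi ((ρ_ X).hom ⊗ₘ (λ_ Y).hom), tensorHom_comp_tensorHom_assoc,
      Iso.hom_inv_id, Iso.hom_inv_id, id_tensorHom_id, Category.id_comp]
    simp only [associator_inv_eq, associator_hom_eq, braiding_hom_eq, re_whiskerRight,
      re_whiskerLeft, re_comp]
    rw [tensorHom_comp_tensorHom, Iso.hom_inv_id, Iso.hom_inv_id, id_tensorHom_id]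
    refine re_refl ?_ _
    rintro ((_ | x) | (x | _))
    exacts [rfl, x.elim, x.elim, rfl]
  rw [MonObj.tensorObj.mul_def, ← tensorHom_comp_tensorHom, Category.assoc, ← id_tensorHom,
    ← tensorHom_id, ← Category.assoc (_ ⊗ₘ _) (tensorμ _ _ _ _), tensorμ_natural, Category.assoc,
    tensorHom_comp_tensorHom, mul_one_hom, one_mul_hom, Category.comp_id, Category.comp_id,
    ← Category.assoc, h, tensorHom_comp_tensorHom, Iso.inv_hom_id, Iso.inv_hom_id,
    id_tensorHom_id]

section

variable {r : ℕ} (A : Fin (r + 1) → Formula α)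

/-- The first formula of `!A₁, …, !Aᵣ`, with the others obtained by weakening. -/
def headM : of (single (A 0).bang) ⟶ of (bangs A) :=
  (ρ_ (of (single (A 0).bang))).inv ≫
    of (single (A 0).bang) ◁ η[of (bangs fun i : Fin r => A i.succ)] ≫ (consIso A).hom

/-- All but the first formula of `!A₁, …, !Aᵣ`, with the first obtained by weakening. -/
def tailM : of (bangs fun i : Fin r => A i.succ) ⟶ of (bangs A) :=
  (λ_ (of (bangs fun i : Fin r => A i.succ))).inv ≫
    η[of (single (A 0).bang)] ▷ of (bangs fun i : Fin r => A i.succ) ≫ (consIso A).hom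

instance : IsMonHom (tailM A) := by
  have := isMonHom_one (of (single (A 0).bang))
  unfold tailM
  infer_instance

instance : IsMonHom (headM A) := by
  have := isMonHom_one (of (bangs fun i : Fin r => A i.succ))
  unfold headM
  infer_instance

theorem headM_tensor_tailM_comp_mul :
    (headM A ⊗ₘ tailM A) ≫ μ[of (bangs A)] = (consIso A).hom := by
  rw [headM, tailM, ← Category.assoc, ← Category.assoc (λ_ _).inv, ← tensorHom_comp_tensorHom,
    Category.assoc, ← IsMonHom.mul_hom, ← Category.assoc, unit_tensor_unit_comp_mul,
    Category.id_comp]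

end

/-- The `i`-th formula of `!A₁, …, !Aᵣ`, with the others obtained by weakening. -/
def inj : {r : ℕ} → (A : Fin r → Formula α) → (i : Fin r) → (of (single (A i).bang) ⟶ of (bangs A))
  | 0, _, i => i.elim0
  | _ + 1, A, i => Fin.cases (motive := fun i => of (single (A i).bang) ⟶ of (bangs A)) (headM A)
      (fun i => inj (fun i => A i.succ) i ≫ tailM A) i

/-- `inj A i` as a leg. -/
def injLeg {r : ℕ} (A : Fin r → Formula α) (i : Fin r) : Leg (of (bangs A)) :=
  ⟨(A i).bang, inj A i⟩

/-- By uniqueness of products, any structural map built with exactly these factors is then the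
identity; `mk_ctrCtx` and `exists_tensorAll` rely on this. -/
theorem isProd_inj {r : ℕ} (A : Fin r → Formula α) :
    IsProd (of (bangs A)) (D := bangs A) (injLeg A) (𝟙 (of (bangs A))) := by
  induction r with
  | zero =>
    have h := IsProd.nil (W := of (bangs A)) (D := bangs A) (injLeg A)
      (Equiv.equivOfIsEmpty (Fin 0) Empty) fun i : Fin 0 => i.elim0
    have h₁ : re (X := of (bangs A)) (Y := 𝟙_ (Ctx α)) (Equiv.equivOfIsEmpty (Fin 0) Empty)
        (fun i : Fin 0 => i.elim0) ≫ η[of (bangs A)] = 𝟙 (of (bangs A)) := by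
      rw [← IsMonHom.one_hom (nilIso A).hom]
      change _ ≫ 𝟙 _ ≫ (nilIso A).hom = _
      rw [Category.id_comp, nilIso, iso_hom, re_comp]
      exact re_refl (fun i : Fin 0 => i.elim0) _
    rwa [h₁] at h
  | succ r ih =>
    have h := IsProd.cons (W := of (bangs A)) (D := bangs A) (injLeg A) ⟨(A 0).bang, headM A⟩ _
      (headTail r) (by intro i; refine Fin.cases rfl (fun _ => rfl) i)
      (by intro i; refine Fin.cases rfl (fun _ => rfl) i)
      ((ih fun i => A i.succ).map (tailM A))
    rw [Category.id_comp, headM_tensor_tailM_comp_mul, consIso, iso_hom, re_comp, re_refl] at h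
    · exact h
    · intro i
      exact (headTail r).symm_apply_apply i

/-- A product of monoid homomorphisms, indexed by the formulas of `!A₁, …, !Aᵣ`, is a monoid
homomorphism. -/
theorem isMonHom_of_isProd {r : ℕ} (A : Fin r → Formula α) {W : Ctx α} [MonObj W]
    [IsCommMonObj W] (f : ∀ i, of (single (A i).bang) ⟶ W) (hf : ∀ i, IsMonHom (f i))
    {S : of (bangs A) ⟶ W} (hS : IsProd W (fun i => ⟨(A i).bang, f i⟩) S) :
    IsMonHom S ∧ ∀ i, inj A i ≫ S = f i := by
  induction r with
  | zero =>
    have h := hS.unique ((IsProd.nil (W := W) (D := bangs A) (fun i => ⟨(A i).bang, f i⟩)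
      (Equiv.equivOfIsEmpty (Fin 0) Empty) fun i : Fin 0 => i.elim0))
    refine ⟨?_, fun i => i.elim0⟩
    rw [h]
    have := isMonHom_one W
    have h₁ : re (X := of (bangs A)) (Y := 𝟙_ (Ctx α)) (Equiv.equivOfIsEmpty (Fin 0) Empty)
        (fun i : Fin 0 => i.elim0) = (nilIso A).inv := by
      rw [nilIso, iso_inv]
      exact re_congr (fun i : Fin 0 => i.elim0) _ _
    rw [h₁]
    infer_instance
  | succ r ih =>
    obtain ⟨S', hS', rfl⟩ := hS.exists_cons (D' := bangs fun i : Fin r => A i.succ)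
      (φ' := fun i => ⟨(A i.succ).bang, f i.succ⟩) (headTail r) ⟨(A 0).bang, f 0⟩
      (by intro i; refine Fin.cases rfl (fun _ => rfl) i)
      (by intro i; refine Fin.cases rfl (fun _ => rfl) i)
    obtain ⟨h₁, h₂⟩ := ih (fun i => A i.succ) (fun i => f i.succ) (fun i => hf i.succ) hS'
    -- The renaming at the front of the product is the inverse of `consIso A`. The whole is
    -- therefore composed of homomorphisms: this isomorphism, `f 0 ⊗ₘ S'`, and the multiplication of
    -- the commutative monoid `W`.
    have h₀ : re (X := of (bangs A)) (Y := of (single (A 0).bang) ⊗ of (bangs fun i : Fin r =>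
        A i.succ)) (headTail r) (by intro i; refine Fin.cases rfl (fun _ => rfl) i) =
          (consIso A).inv := rfl
    have := hf 0
    have := isMonHom_mul W
    refine ⟨?_, ?_⟩
    · erw [h₀]
      infer_instance
    · intro i
      erw [h₀]
      refine Fin.cases ?_ (fun i => ?_) i
      · change headM A ≫ _ = f 0
        rw [headM, Category.assoc, Category.assoc, Iso.hom_inv_id_assoc, ← id_tensorHom,
          tensorHom_comp_tensorHom_assoc, IsMonHom.one_hom, mul_one_hom, Iso.inv_hom_id_assoc,
          Category.id_comp]
      · change (inj _ i ≫ tailM A) ≫ _ = f i.succ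
        rw [tailM, Category.assoc, Category.assoc, Category.assoc, Iso.hom_inv_id_assoc,
          ← tensorHom_id, tensorHom_comp_tensorHom_assoc, IsMonHom.one_hom, one_mul_hom,
          Iso.inv_hom_id_assoc, Category.id_comp, h₂]

end Ctx

end ILL

/-! ### Iterated contractions and weakenings as products -/

namespace ILL

variable {α : Type u}

open Cls CategoryTheory MonoidalCategory MonObj

namespace Ctx

theorem IsProd.of_unit {W : Ctx α} [MonObj W] {κ : Type} {D : κ → Formula α} (φ : κ → Leg W)
    (a : Leg W) (e : κ ≃ Unit) (h : ∀ i, single a.fm (e i) = D i) (hφ : ∀ i, φ i = a) :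
    IsProd W φ (re (X := of D) (Y := of (single a.fm)) e h ≫ a.hom) := by
  have h₀ : IsProd W (D := emp) (fun x : Empty => x.elim) η[W] := by
    have h₁ := IsProd.nil (W := W) (D := emp) (fun x : Empty => x.elim) (Equiv.refl Empty)
      fun _ => rfl
    have h₂ : re (X := of emp) (Y := 𝟙_ (Ctx α)) (Equiv.refl Empty) (fun _ => rfl) ≫ η[W] =
      η[W] := Category.id_comp _
    rwa [h₂] at h₁
  have h₁ := IsProd.cons φ a (fun x : Empty => x.elim) (e.trans (Equiv.sumEmpty Unit Empty).symm)
    (D' := emp) h hφ h₀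
  rw [mul_one_hom, rightUnitor_hom_eq,
    ← Category.assoc] at h₁
  erw [re_comp] at h₁
  exact h₁

/-- The multiplication on the factors of `!A, …, !A ⊢ B`. -/
theorem exists_contractOne (n : ℕ) (A : Formula α) :
    ∃ S : of (fun _ : Fin n => A.bang) ⟶ of (single A.bang),
      IsProd (of (single A.bang)) (fun _ => ⟨A.bang, 𝟙 _⟩) S ∧
      ∀ {κ : Type} {Δ : κ → Formula α} {B : Formula α}
        (π : Proof ((fun _ : Fin n => A.bang) ∔ Δ) B),
        Cls.mk (Proof.contractOne n π) = app S (Cls.mk π) := by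
  induction n with
  | zero =>
    have h (i : Fin 0) : emp (Equiv.equivOfIsEmpty (Fin 0) Empty i) = A.bang := i.elim0
    refine ⟨_, IsProd.nil _ (Equiv.equivOfIsEmpty (Fin 0) Empty) h, ?_⟩
    intro κ Δ B π
    change Cls.wk (ex _ _ (Cls.mk π)) = Cls.wk (ex _ _ (exLeft _ h (Cls.mk π)))
    congr 1
    rw [exLeft]
    refine Eq.trans ?_ (ex_ex (Γ := (fun _ : Fin 0 => A.bang) ∔ Δ) (Δ := emp ∔ Δ) (Θ := Δ)
      _ _ _ _ _).symm
    refine ex_congr ?_ _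
    rintro (i | _)
    exacts [i.elim0, rfl]
  | succ n ih =>
    -- A single copy is renamed without contracting it against a weakened copy, so this case is the
    -- one-factor product and not a factor times the unit.
    cases n with
    | zero =>
      refine ⟨_, IsProd.of_unit _ ⟨A.bang, 𝟙 _⟩ finOneEquiv (fun _ => rfl) fun _ => rfl, ?_⟩
      intro κ Δ B π
      rw [Category.comp_id]
      rfl
    | succ n =>
      obtain ⟨S, hS, hc⟩ := ih
      have h (i : Fin (n + 2)) :
          (single A.bang ∔ fun _ : Fin (n + 1) => A.bang) (headTail (n + 1) i) = A.bang :=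
        Fin.cases rfl (fun _ => rfl) i
      refine ⟨_, IsProd.cons _ ⟨A.bang, 𝟙 _⟩ _ (headTail (n + 1)) h ?_ hS, ?_⟩
      · intro i
        exact Fin.cases rfl (fun _ => rfl) i
      · intro κ Δ B π
        change Cls.ctr (Cls.mk (Proof.contractOne (n + 1) _)) = _
        -- The last contraction takes the already contracted copy first and the head second, while
        -- the product puts the head first; commutativity absorbs the difference.
        rw [hc, ← Cls.ctr_comm, id_tensorHom, comp_app, comp_app]
        erw [ctr_app, whiskerLeft_app, assoc_unassoc]
        congr 3
        change exl (ex _ _ (Cls.mk π)) = exl (assoc (exLeft _ h (Cls.mk π)))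
        congr 1
        simp only [assoc, exLeft, ex_ex]

/-- Contractions and weakenings act by products of the `inj A i`. -/
theorem exists_contract {r : ℕ} (A : Fin r → Formula α) (n : Fin r → ℕ) :
    ∃ S : of (fun p : Σ i, Fin (n i) => (A p.1).bang) ⟶ of (bangs A),
      IsProd (of (bangs A)) (fun p : Σ i, Fin (n i) => injLeg A p.1) S ∧
      ∀ {κ : Type} {Δ : κ → Formula α} {B : Formula α}
        (π : Proof ((fun p : Σ i, Fin (n i) => (A p.1).bang) ∔ Δ) B),
        Cls.mk (Proof.contract n π) = app S (Cls.mk π) := by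
  induction r with
  | zero =>
    refine ⟨_, (isProd_inj A).reindex (Equiv.equivOfIsEmpty _ (Fin 0)) (fun p => p.1.elim0)
      fun p => p.1.elim0, ?_⟩
    intro κ Δ B π
    rw [Category.comp_id]
    rfl
  | succ r ih =>
    obtain ⟨S₁, hS₁, hc₁⟩ := exists_contractOne (n 0) (A 0)
    obtain ⟨S₂, hS₂, hc₂⟩ := ih (fun i => A i.succ) fun i => n i.succ
    -- The copies of the first formula enter through `headM` and all others through `tailM`.
    -- Multiplying the two maps gives `consIso`, which reassembles the context.
    have h₁ := ((hS₁.map (headM A)).sum (hS₂.map (tailM A))).reindex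
      (D' := fun p : Σ i, Fin (n i) => (A p.1).bang)
      (φ' := fun p : Σ i, Fin (n i) => injLeg A p.1) (sigmaSucc n) ?_ ?_
    · refine ⟨_, h₁, ?_⟩
      intro κ Δ B π
      rw [← tensorHom_comp_tensorHom, Category.assoc, headM_tensor_tailM_comp_mul,
        MonoidalCategory.tensorHom_def]
      simp only [comp_app]
      erw [whiskerLeft_app, whiskerRight_app, assoc_unassoc]
      change ex _ _ (exl (Cls.mk (Proof.contract _ _))) = _
      rw [hc₂]
      change ex _ _ (exl (app S₂ (exl (Cls.mk (Proof.contractOne _ _))))) = _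
      rw [hc₁]
      refine Eq.trans ?_ (b := exLeft _ (cons_eq A) (unassoc _)) rfl
      rw [exLeft, unassoc, ex_ex]
      rfl
    · rintro ⟨i, k⟩
      revert k
      exact Fin.cases (fun _ => rfl) (fun _ _ => rfl) i
    · rintro ⟨i, k⟩
      revert k
      refine Fin.cases (fun _ => ?_) (fun _ _ => rfl) i
      exact congrArg (Leg.mk _) (Category.id_comp (headM A)).symm

end Ctx

end ILL

/-! ### Cutting against a promotion is a monoid homomorphism -/

namespace ILL

variable {α : Type u}

open Cls CategoryTheory MonoidalCategory MonObj

namespace Ctx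

variable {r : ℕ} {G : Fin r → Formula α} {κ : Type} {Δ : κ → Formula α} {A B : Formula α}

/-- Contracting two copies of the context one formula at a time and multiplying in the monoid `bangs
G` are both products of two copies of the injections, hence equal. In the same way `mk_wkCtx`
identifies two empty products. -/
theorem mk_ctrCtx (π : Proof (bangs G ∔ bangs G ∔ Δ) B) :
    Cls.mk (Proof.ctrCtx π) = app μ[of (bangs G)] (unassoc (Cls.mk π)) := by
  obtain ⟨S, hS, hc⟩ := exists_contract G fun _ => 2
  have h₁ := hS.reindex (D' := bangs G ∔ bangs G)
    (φ' := Sum.elim (injLeg G) (injLeg G)) (pairs r) (by rintro (_ | _) <;> rfl)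
    (by rintro (_ | _) <;> rfl)
  have h₂ := (isProd_inj G).sum (isProd_inj G)
  rw [id_tensorHom_id] at h₂
  erw [Category.id_comp] at h₂
  rw [h₂.unique h₁]
  exact hc _

theorem mk_wkCtx (π : Proof Δ B) : Cls.mk (Proof.wkCtx (A := G) π) =
    app η[of (bangs G)] (ex (Equiv.emptySum Empty κ).symm (app_emptySum emp Δ) (Cls.mk π)) := by
  obtain ⟨S, hS, hc⟩ := exists_contract G fun _ => 0
  have : IsEmpty (Σ _ : Fin r, Fin 0) := ⟨fun p => p.2.elim0⟩
  have h₁ := IsProd.nil (W := of (bangs G)) (D := fun p : Σ _ : Fin r, Fin 0 => (G p.1).bang)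
    (fun p : Σ _ : Fin r, Fin 0 => injLeg G p.1) (Equiv.equivOfIsEmpty _ _) fun i => isEmptyElim i
  refine (hc _).trans ?_
  rw [hS.unique h₁, comp_app, re_app]
  congr 1
  change ex _ _ (ex _ _ (Cls.mk π)) = _
  refine (ex_ex (Γ := Δ) (Δ := (fun p : Σ _ : Fin r, Fin 0 => (G p.1).bang) ∔ Δ)
    (Θ := emp ∔ Δ) _ _ _ _ _).trans ?_
  refine ex_congr ?_ _
  intro i
  rfl

/-- Cutting against a promotion is compatible with contraction and weakening. -/
theorem isMonHom_sub_prom (h : ∀ i, ∃ B : Formula α, bangs G i = B.bang) (x : Cls (bangs G) A) :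
    IsMonHom (M := of (single A.bang)) (N := of (bangs G))
      (sub (X := of (bangs G)) (prom h x)) where
  one_hom := by
    ext θ Θ E y
    change cut (prom h x) (Cls.wk (ex (Equiv.emptySum Empty θ) (empty_left_eq Θ) y)) = _
    have hy : y = ex (Equiv.emptySum Empty θ).symm (app_emptySum emp Θ)
        (ex (Equiv.emptySum Empty θ) (empty_left_eq Θ) y) := by
      rw [ex_ex]
      refine (ex_refl _ ?_ _ _).symm
      exact (Equiv.emptySum Empty θ).symm_apply_apply
    conv_rhs => rw [hy]
    generalize ex (Equiv.emptySum Empty θ) (empty_left_eq Θ) y = z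
    induction x using ind with | h π
    induction z using ind with | h ρ
    exact (sound (Conv.cut_prom_wk h π ρ)).trans (mk_wkCtx ρ)
  mul_hom := by
    ext θ Θ E y
    rw [MonoidalCategory.tensorHom_def]
    simp only [comp_app]
    erw [whiskerLeft_app, whiskerRight_app, assoc_unassoc]
    change cut (prom h x) (Cls.ctr (assoc y)) = app μ[of (bangs G)] (unassoc (exl
      (cut (prom h x) (exl (cut (prom h x) (assoc y))))))
    -- The principal cut leaves the two copies of the context in the opposite order to the tensor
    -- product of morphisms; commutativity removes the exchange.
    have hμ (z : Cls (bangs G ∔ bangs G ∔ Θ) E) :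
        app μ[of (bangs G)] (unassoc (exl z)) = app μ[of (bangs G)] (unassoc z) := by
      have h₁ : exl z = assoc (app (β_ (of (bangs G)) (of (bangs G))).hom (unassoc z)) := by
        rw [braiding_hom_eq, re_app]
        simp only [exLeft, assoc, unassoc, exl, ex_ex]
        refine ex_congr ?_ _
        rintro (_ | _ | _) <;> rfl
      rw [h₁, unassoc_assoc, ← comp_app, IsCommMonObj.mul_comm]
    rw [hμ]
    generalize assoc y = z
    induction x using ind with | h π
    induction z using ind with | h ρ
    exact (sound (Conv.cut_prom_ctr h π ρ)).trans (mk_ctrCtx _)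

end Ctx

end ILL

/-! ### Morphisms that commute with promotion -/

namespace ILL

variable {α : Type u}

open Cls CategoryTheory MonoidalCategory MonObj

namespace Ctx

/-- All formulas of the context are of the form `!B`. -/
abbrev IsBang (X : Ctx α) : Prop := ∀ i, ∃ B : Formula α, X.fm i = B.bang

theorem IsBang.tensor {X Y : Ctx α} (hX : IsBang X) (hY : IsBang Y) : IsBang (X ⊗ Y) := by
  rintro (i | i)
  exacts [hX i, hY i]

theorem isBang_unit : IsBang (𝟙_ (Ctx α)) := fun x => Empty.elim x

theorem isBang_bangs {ι' : Type} (Γ : ι' → Formula α) : IsBang (of (bangs Γ)) := fun i => ⟨Γ i, rfl⟩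

/-- A morphism that commutes with promotion. -/
structure Promotes {X Y : Ctx α} (F : X ⟶ Y) : Prop where
  app_prom {θ : Type} {Θ : θ → Formula α} {E : Formula α}
    (h : ∀ i, ∃ B : Formula α, (X.fm ∔ Θ) i = B.bang)
    (h' : ∀ i, ∃ B : Formula α, (Y.fm ∔ Θ) i = B.bang) (x : Cls (X.fm ∔ Θ) E) :
    app F (prom h x) = prom h' (app F x)

namespace Promotes

variable {X X' Y Y' Z : Ctx α} {F : X ⟶ Y} {G : Y ⟶ Z} {F' : X' ⟶ Y'}

/-- The condition on `Y` is what makes promotion legal in the intermediate context. -/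
theorem comp (hF : Promotes F) (hG : Promotes G) (hY : IsBang Y) : Promotes (F ≫ G) := by
  refine ⟨fun {θ Θ E} h h' x => ?_⟩
  have h₁ : ∀ i, ∃ B : Formula α, (Y.fm ∔ Θ) i = B.bang := by
    rintro (i | i)
    exacts [hY i, h (Sum.inr i)]
  rw [comp_app, hF.app_prom h h₁, hG.app_prom h₁ h', comp_app]

theorem re (e : X.ix ≃ Y.ix) (h : ∀ i, Y.fm (e i) = X.fm i) : Promotes (re e h) := by
  refine ⟨fun {θ Θ E} h₁ h₂ x => ?_⟩
  rw [re_app, re_app, exLeft, exLeft, ex_prom]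

theorem whiskerRight (hF : Promotes F) (hY : IsBang Y) (Z : Ctx α) : Promotes (F ▷ Z) := by
  refine ⟨fun {θ Θ E} h h' x => ?_⟩
  have h₁ : ∀ i, ∃ B : Formula α, (X.fm ∔ Z.fm ∔ Θ) i = B.bang := by
    rintro (i | i | i)
    exacts [h (Sum.inl (Sum.inl i)), h (Sum.inl (Sum.inr i)), h (Sum.inr i)]
  have h₂ : ∀ i, ∃ B : Formula α, (Y.fm ∔ Z.fm ∔ Θ) i = B.bang := by
    rintro (i | i | i)
    exacts [hY i, h (Sum.inl (Sum.inr i)), h (Sum.inr i)]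
  rw [whiskerRight_app, whiskerRight_app, assoc, assoc, ← ex_prom _ _ _ h₁, hF.app_prom h₁ h₂,
    unassoc, unassoc, ← ex_prom _ _ _ h']

theorem whiskerLeft (hF : Promotes F) (hX : IsBang X) (hY : IsBang Y) {Z : Ctx α}
    (hZ : IsBang Z) : Promotes (Z ◁ F) :=
  ((re _ _).comp ((hF.whiskerRight hY Z).comp (re _ _) (hY.tensor hZ)) (hX.tensor hZ))

theorem tensor (hF : Promotes F) (hF' : Promotes F') (hY : IsBang Y) (hX' : IsBang X')
    (hY' : IsBang Y') : Promotes (F ⊗ₘ F') := by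
  rw [MonoidalCategory.tensorHom_def]
  exact (hF.whiskerRight hY X').comp (hF'.whiskerLeft hX' hY' hY) (hY.tensor hX')

theorem sub (h : ∀ i, ∃ B : Formula α, X.fm i = B.bang) {A : Formula α} (x : Cls X.fm A) :
    Promotes (sub (prom h x)) :=
  ⟨fun h₁ h₂ y => cut_prom_prom h x h₁ y h₂⟩

theorem act (hF : Promotes F) (hX : IsBang X) (hY : IsBang Y) {E : Formula α} (x : Cls X.fm E) :
    Ctx.act F (prom hX x) = prom hY (Ctx.act F x) := by
  rw [Ctx.act, Ctx.act, pad, ← ex_prom _ _ _ ?_, hF.app_prom, unpad, ← ex_prom]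
  · rfl
  · rintro (i | i)
    exacts [hY i, i.elim]
  · rintro (i | i)
    exacts [hX i, i.elim]

theorem one_ofIso [MonObj X] (e : X ≅ Y) (hX : IsBang X) (hη : Promotes η[X])
    (he : Promotes e.hom) : letI := MonObj.ofIso e; Promotes η[Y] :=
  hη.comp he hX

theorem mul_ofIso [MonObj X] (e : X ≅ Y) (hX : IsBang X) (hY : IsBang Y) (hμ : Promotes μ[X])
    (he : Promotes e.hom) (he' : Promotes e.inv) : letI := MonObj.ofIso e; Promotes μ[Y] :=
  (he'.tensor he' hX hY hX).comp (hμ.comp he hX) (hX.tensor hX)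

/-- For a single `!A` these are the commutations of weakening and contraction with promotion. They
pass to the whole context because renamings commute with promotion too. -/
theorem one_mul {r : ℕ} (A : Fin r → Formula α) :
    Promotes η[of (bangs A)] ∧ Promotes μ[of (bangs A)] := by
  induction r with
  | zero =>
    refine ⟨one_ofIso (nilIso A) isBang_unit ?_ (re _ _),
      mul_ofIso (nilIso A) isBang_unit (isBang_bangs A) ?_ (re _ _) (re _ _)⟩
    · exact re (Equiv.refl _) fun _ => rfl
    · exact re _ _
  | succ r ih =>
    obtain ⟨h₁, h₂⟩ := ih fun i => A i.succ
    have k₁ : Promotes η[of (single (A 0).bang)] := by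
      refine ⟨fun {θ Θ E} h h' x => ?_⟩
      have h₃ : ∀ i, ∃ B : Formula α, Θ i = B.bang := fun i => h (Sum.inr i)
      change Cls.wk (ex _ _ (prom h x)) = prom h' (Cls.wk (ex _ _ x))
      rw [← ex_prom _ _ _ h₃, prom_wk]
    have k₂ : Promotes μ[of (single (A 0).bang)] := by
      refine ⟨fun {θ Θ E} h h' x => ?_⟩
      have h₃ : ∀ i, ∃ B : Formula α, (single (A 0).bang ∔ single (A 0).bang ∔ Θ) i = B.bang := by
        rintro (i | i | i)
        exacts [⟨_, rfl⟩, ⟨_, rfl⟩, h (Sum.inr i)]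
      change Cls.ctr (assoc (prom h x)) = prom h' (Cls.ctr (assoc x))
      rw [assoc, ← ex_prom _ _ _ h₃, prom_ctr]
      rfl
    have b₁ : IsBang (of (single (A 0).bang)) := fun _ => ⟨_, rfl⟩
    have b₂ := isBang_bangs fun i : Fin r => A i.succ
    refine ⟨one_ofIso (consIso A) (b₁.tensor b₂) ?_ (re _ _),
      mul_ofIso (consIso A) (b₁.tensor b₂) (isBang_bangs A) ?_ (re _ _) (re _ _)⟩
    · rw [MonObj.tensorObj.one_def]
      exact (re _ _).comp (k₁.tensor h₁ b₁ isBang_unit b₂) (isBang_unit.tensor isBang_unit)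
    · rw [MonObj.tensorObj.mul_def]
      refine comp ?_ (k₂.tensor h₂ b₁ (b₂.tensor b₂) b₂) ((b₁.tensor b₁).tensor (b₂.tensor b₂))
      rw [tensorμ]
      simp only [associator_inv_eq, associator_hom_eq, braiding_hom_eq, re_whiskerRight,
        re_whiskerLeft, re_comp]
      exact re _ _

/-- A product is assembled from its factors by renaming, tensor, unit and multiplication, all of
which preserve commutation with promotion as long as every context met on the way consists of
formulas `!B`. -/
theorem of_isProd {r : ℕ} {A : Fin r → Formula α} {κ : Type} {D : κ → Formula α}
    {φ : κ → Leg (of (bangs A))} {S : of D ⟶ of (bangs A)} (hS : IsProd (of (bangs A)) φ S)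
    (hD : IsBang (of D)) (hφ : ∀ i, Promotes (φ i).hom) : Promotes S := by
  obtain ⟨h₁, h₂⟩ := one_mul A
  have b := isBang_bangs A
  induction hS with
  | nil φ e h => exact (re _ _).comp h₁ isBang_unit
  | @cons κ κ' D D' φ a φ' e h hφ' S hS ih =>
    have b' : IsBang (of D') := fun i => by
      have := hD (e.symm (Sum.inr i))
      change ∃ B, D _ = _ at this
      rw [← h, Equiv.apply_symm_apply] at this
      exact this
    have ba : IsBang (of (single a.fm)) := fun i => by
      have := hD (e.symm (Sum.inl ()))
      change ∃ B, D _ = _ at this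
      rw [← h, Equiv.apply_symm_apply] at this
      exact this
    have ha : Promotes a.hom := by
      have := hφ (e.symm (Sum.inl ()))
      rw [hφ', Equiv.apply_symm_apply] at this
      exact this
    refine (re _ _).comp (((ha.tensor (ih b' fun i => ?_) b b' b)).comp h₂ (b.tensor b))
      (ba.tensor b')
    have := hφ (e.symm (Sum.inr i))
    rw [hφ', Equiv.apply_symm_apply] at this
    exact this

end Promotes

end Ctx

end ILL

/-! ### Derelictions and plain proofs -/

namespace ILL

variable {α : Type u}

open Cls CategoryTheory MonoidalCategory MonObj

namespace Ctx

theorem headTail_eq {m : ℕ} (Γ : Fin (m + 1) → Formula α) :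
    ∀ i, (single (Γ 0) ∔ fun i : Fin m => Γ i.succ) (headTail m i) = Γ i :=
  fun i => Fin.cases rfl (fun _ => rfl) i

/-- Derelictions turn products of morphisms `g k` into products of the `derM ≫ g k`. -/
theorem exists_derFin {m : ℕ} (Γ : Fin m → Formula α) :
    ∃ F : of Γ ⟶ of (bangs Γ),
      (∀ {κ : Type} {Δ : κ → Formula α} {B : Formula α} (π : Proof (Γ ∔ Δ) B),
        Cls.mk (Proof.derFin m π) = app F (Cls.mk π)) ∧
      ∀ (W : Ctx α) [MonObj W] [IsCommMonObj W] (g : ∀ k, of (single (Γ k).bang) ⟶ W)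
        (S : of (bangs Γ) ⟶ W), IsProd W (fun k => ⟨(Γ k).bang, g k⟩) S →
          IsProd W (fun k => ⟨Γ k, derM (Γ k) ≫ g k⟩) (F ≫ S) := by
  induction m with
  | zero =>
    refine ⟨re (X := of Γ) (Y := of (bangs Γ)) (Equiv.refl (Fin 0)) fun i : Fin 0 => i.elim0,
      fun π => ?_, fun W _ _ g S hS => hS.reindex _ _ fun i : Fin 0 => i.elim0⟩
    change ex _ _ (Cls.mk π) = ex _ _ (Cls.mk π)
    refine ex_congr ?_ _
    rintro (_ | _) <;> rfl
  | succ m ih =>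
    obtain ⟨F, hF, hS⟩ := ih fun i => Γ i.succ
    refine ⟨re (X := of Γ) (Y := of (single (Γ 0)) ⊗ of fun i : Fin m => Γ i.succ) (headTail m)
      (headTail_eq Γ) ≫ (derM (Γ 0) ⊗ₘ F) ≫ (consIso Γ).hom, fun {κ Δ B} π => ?_,
      fun W _ _ g S hS' => ?_⟩
    · change ex _ _ (exl (Cls.mk (Proof.derFin m _))) = _
      rw [hF, MonoidalCategory.tensorHom_def]
      simp only [comp_app]
      erw [whiskerLeft_app, whiskerRight_app, assoc_unassoc, derM_app]
      refine Eq.trans ?_ (b := exLeft _ (cons_eq Γ) (unassoc _)) rfl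
      rw [exLeft, unassoc, ex_ex]
      have h : Cls.mk π.uncons = assoc (exLeft (headTail m) (headTail_eq Γ) (Cls.mk π)) := by
        simp only [assoc, exLeft, ex_ex]
        rfl
      change ex _ _ (exl (app F (exl (Cls.der (Cls.mk π.uncons))))) = _
      rw [h]
      rfl
    · obtain ⟨S', hT, rfl⟩ := hS'.exists_cons (D' := bangs fun i : Fin m => Γ i.succ)
        (φ' := fun i => ⟨(Γ i.succ).bang, g i.succ⟩) (headTail m) ⟨(Γ 0).bang, g 0⟩
        (headTail_eq (bangs Γ)) (fun i => Fin.cases rfl (fun _ => rfl) i)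
      have h₀ : re (X := of (bangs Γ)) (Y := of (single (Γ 0).bang) ⊗ of (bangs fun i : Fin m =>
        Γ i.succ)) (headTail m) (headTail_eq (bangs Γ)) = (consIso Γ).inv := rfl
      have h₁ := IsProd.cons (D := Γ) (fun k => ⟨Γ k, derM (Γ k) ≫ g k⟩)
        ⟨Γ 0, derM (Γ 0) ≫ g 0⟩ _ (headTail m) (headTail_eq Γ)
        (fun i => Fin.cases rfl (fun _ => rfl) i) (hS W (fun i => g i.succ) S' hT)
      rw [← tensorHom_comp_tensorHom, Category.assoc] at h₁
      rw [Category.assoc, Category.assoc]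
      erw [h₀]
      rw [Iso.hom_inv_id_assoc]
      exact h₁

variable {r : ℕ} {A : Fin r → Formula α} {B : Formula α}

/-- The dereliction of the `i`-th formula of `!A₁, …, !Aᵣ`. -/
def derLeg (A : Fin r → Formula α) (i : Fin r) : Leg (of (bangs A)) :=
  ⟨A i, derM (A i) ≫ inj A i⟩

/-- The derelictions come before the contractions in the proof, so each factor `inj A i` of the
contraction map is precomposed with a dereliction. -/
theorem exists_contract_derAll (A : Fin r → Formula α) (n : Fin r → ℕ) :
    ∃ S : of (fun p : Σ i, Fin (n i) => A p.1) ⟶ of (bangs A),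
      IsProd (of (bangs A)) (fun p : Σ i, Fin (n i) => derLeg A p.1) S ∧
      ∀ {B : Formula α} (π : Proof (fun p : Σ i, Fin (n i) => A p.1) B),
        Cls.mk (Proof.unpad (Proof.contract n (Proof.pad (Proof.derAll n π)))) =
          act S (Cls.mk π) := by
  obtain ⟨S, hS, hc⟩ := exists_contract A n
  obtain ⟨F, hF, hF'⟩ := exists_derFin fun k => A (finSigmaFinEquiv (n := n) |>.symm k).1
  have h₁ (p : Σ i, Fin (n i)) :
      A (finSigmaFinEquiv.symm (finSigmaFinEquiv p)).1 = A p.1 := by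
    rw [Equiv.symm_apply_apply]
  have h₂ := hF' _ (fun k => inj A (finSigmaFinEquiv (n := n) |>.symm k).1) _
    (hS.reindex (D' := bangs fun k => A (finSigmaFinEquiv (n := n) |>.symm k).1)
      finSigmaFinEquiv.symm (fun _ => rfl) fun _ => rfl)
  have h₃ := h₂.reindex (D' := fun p : Σ i, Fin (n i) => A p.1)
    (φ' := fun p : Σ i, Fin (n i) => derLeg A p.1) finSigmaFinEquiv h₁ fun p => by
      rw [Equiv.symm_apply_apply]
      rfl
  refine ⟨_, h₃, fun π => ?_⟩
  rw [act_comp, act_comp, act_comp, act_re, act_re]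
  change unpad (Cls.mk (Proof.contract n _)) = _
  rw [hc]
  change act S (ex _ _ (unpad (Cls.mk (Proof.derFin _ _)))) = _
  rw [hF]
  rfl

/-- The classes of plain proofs: those obtained from a proof of `A_{j 1}, …, A_{j n} ⊢ B` by
derelictions, contractions and weakenings. -/
def IsPlain (x : Cls (bangs A) B) : Prop :=
  ∃ (κ : Type) (j : κ → Fin r) (D : κ → Formula α) (y : Cls D B) (S : of D ⟶ of (bangs A)),
    IsProd (of (bangs A)) (fun k => derLeg A (j k)) S ∧ x = act (X := of D) S y

/-- Dropping the grouping into `nᵢ` consecutive copies frees the index type: plain proofs can then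
be combined by disjoint unions of indices, and the grouping is recovered at the end by uniqueness of
products. -/
theorem plain_iff (ψ : Proof (bangs A) B) : ψ.Plain ↔ IsPlain (Cls.mk ψ) := by
  constructor
  · rintro ⟨n, π, h⟩
    obtain ⟨S, hS, hc⟩ := exists_contract_derAll A n
    exact ⟨_, _, _, Cls.mk π, S, hS, (sound h).trans (hc π)⟩
  · rintro ⟨κ, j, D, y, S, hS, h⟩
    have := hS.finite
    -- The number of copies of `Aᵢ` is the size of the fibre of `j` over `i`, and `e` sorts the
    -- occurrences by fibre.
    let n (i : Fin r) : ℕ := Nat.card {k // j k = i}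
    let e : κ ≃ Σ i, Fin (n i) := (Equiv.sigmaFiberEquiv j).symm.trans
      (Equiv.sigmaCongrRight fun i => Finite.equivFin {k // j k = i})
    have he (k : κ) : (e k).1 = j k := rfl
    obtain ⟨T, hT, hc⟩ := exists_contract_derAll A n
    have hD (k : κ) : A (e k).1 = D k := (hS.fm_eq k).symm
    obtain ⟨π, hπ⟩ : ∃ π : Proof (fun p : Σ i, Fin (n i) => A p.1) B, Cls.mk π = ex e hD y :=
      Quotient.exists_rep _
    refine ⟨n, π, mk_eq_mk.1 ?_⟩
    rw [hc, hπ, h, hS.unique (hT.reindex e hD fun _ => rfl), act_comp, act_re]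

end Ctx

end ILL

/-! ### Component-wise plain proofs and their composition -/

namespace ILL

variable {α : Type u}

open Cls CategoryTheory MonoidalCategory MonObj

namespace Ctx

variable {r s : ℕ} {A : Fin r → Formula α}

/-- Each premise is a substitution into an axiom, so the tensor product is a morphism applied to the
tensor axiom. No monoid structure has been put on the `s + 1` uncontracted copies of the context, so
the claim about products is made only after a contraction `T`. -/
theorem exists_tensorAll {B : Fin (s + 1) → Formula α} (ψ : ∀ i, Proof (bangs A) (B i)) :
    ∃ V : of B ⟶ of (fun p : Fin (s + 1) × Fin r => bangs A p.2),
      Cls.mk (Proof.tensorAll ψ) = act (X := of B) V (tensorAx B) ∧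
      ∀ T : of (fun p : Fin (s + 1) × Fin r => bangs A p.2) ⟶ of (bangs A),
        IsProd (of (bangs A)) (fun p : Fin (s + 1) × Fin r => injLeg A p.2) T →
        IsProd (of (bangs A)) (fun i => ⟨B i, sub (X := of (bangs A)) (Cls.mk (ψ i))⟩)
          (V ≫ T) := by
  induction s with
  | zero =>
    have h (i : Fin 1) : single (B 0) (finOneEquiv i) = B i := by
      rw [Subsingleton.elim i 0]
    refine ⟨re (X := of B) (Y := of (single (B 0))) finOneEquiv h ≫
      sub (X := of (bangs A)) (Cls.mk (ψ 0)) ≫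
      re (X := of (bangs A)) (Y := of fun p : Fin 1 × Fin r => bangs A p.2)
        (Equiv.uniqueProd (Fin r) (Fin 1)).symm (uniqueProd_snd (bangs A)), ?_, fun T hT => ?_⟩
    · rw [act_comp, act_comp, act_re, act_re]
      have h₁ : ex finOneEquiv h (tensorAx B) = ax (B 0) := by
        refine (ex_ex (Γ := single (B 0)) (Δ := B) (Θ := single (B 0)) _ _ _ _ _).trans ?_
        exact ex_refl _ (fun _ => rfl) _ _
      erw [h₁, act_sub_ax]
      rfl
    · have h₁ := hT.reindex (D' := bangs A) (φ' := injLeg A)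
        (Equiv.uniqueProd (Fin r) (Fin 1)).symm (uniqueProd_snd (bangs A)) fun _ => rfl
      rw [Category.assoc, Category.assoc, h₁.unique (isProd_inj A), Category.comp_id]
      refine IsProd.of_unit _ ⟨B 0, sub (X := of (bangs A)) (Cls.mk (ψ 0))⟩ _ _ fun i => ?_
      rw [show i = 0 from Subsingleton.elim (α := Fin 1) i 0]
  | succ s ih =>
    obtain ⟨V, hV, hP⟩ := ih fun i => ψ i.succ
    have h : ∀ i, (fun p : Fin (s + 2) × Fin r => bangs A p.2) (copiesSucc (s + 1) (Fin r) i) =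
        (bangs A ∔ fun p : Fin (s + 1) × Fin r => bangs A p.2) i := by
      rintro (_ | _) <;> rfl
    refine ⟨re (X := of B) (Y := of (single (B 0)) ⊗ of fun i : Fin (s + 1) => B i.succ)
      (headTail (s + 1)) (headTail_eq B) ≫ (sub (X := of (bangs A)) (Cls.mk (ψ 0)) ⊗ₘ V) ≫
      re (X := of (bangs A) ⊗ of fun p : Fin (s + 1) × Fin r => bangs A p.2)
        (Y := of fun p : Fin (s + 2) × Fin r => bangs A p.2) (copiesSucc (s + 1) (Fin r)) h,
      ?_, fun T hT => ?_⟩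
    · rw [act_comp, act_comp, act_re, act_re]
      have h₁ : ex (headTail (s + 1)) (headTail_eq B) (tensorAx B) =
          tensorR (ax (B 0)) (tensorAx fun i : Fin (s + 1) => B i.succ) := by
        refine (ex_ex (Γ := single (B 0) ∔ fun i : Fin (s + 1) => B i.succ) (Δ := B)
          (Θ := single (B 0) ∔ fun i : Fin (s + 1) => B i.succ) _ _ _ _ _).trans ?_
        exact ex_refl _ (headTail (s + 1)).apply_symm_apply _ _
      erw [h₁, act_tensorR, act_sub_ax, ← hV]
      rfl
    · have h₁ := hT.reindex (φ' := Sum.elim (injLeg A) fun p : Fin (s + 1) × Fin r => injLeg A p.2)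
        (copiesSucc (s + 1) (Fin r)) h (by rintro (_ | _) <;> rfl)
      -- `T` is replaced by the identity on the first copy times a contraction `T'` of the remaining
      -- copies, to which the induction hypothesis applies.
      obtain ⟨T', hT'⟩ := IsProd.exists_isProd (D := fun p : Fin (s + 1) × Fin r => bangs A p.2)
        (fun p : Fin (s + 1) × Fin r => injLeg A p.2) fun _ => rfl
      rw [Category.assoc, Category.assoc]
      erw [h₁.unique ((isProd_inj A).sum hT')]
      rw [tensorHom_comp_tensorHom_assoc, Category.comp_id]
      exact IsProd.cons _ ⟨B 0, sub (X := of (bangs A)) (Cls.mk (ψ 0))⟩ _ (headTail (s + 1))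
        (headTail_eq B) (fun i => Fin.cases rfl (fun _ => rfl) i) (hP T' hT')

/-- A component of a component-wise plain proof. -/
def promLeg {B : Formula α} (x : Cls (bangs A) B) : Leg (of (bangs A)) :=
  ⟨B.bang, sub (X := of (bangs A)) (prom (fun j => ⟨A j, rfl⟩) x)⟩

theorem exists_ofComponents {B : Fin (s + 1) → Formula α} (ψ : ∀ i, Proof (bangs A) (B i)) :
    ∃ U : of (bangs B) ⟶ of (bangs A),
      IsProd (of (bangs A)) (fun i => promLeg (Cls.mk (ψ i))) U ∧
      Cls.mk (Proof.ofComponents ψ) = act U (tensorAx (bangs B)) := by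
  obtain ⟨V, hV, hP⟩ := exists_tensorAll (B := bangs B)
    fun i => Proof.prom (fun j => ⟨A j, rfl⟩) (ψ i)
  obtain ⟨S, hS, hc⟩ := exists_contract A fun _ => s + 1
  refine ⟨_, hP _ (hS.reindex (D' := fun p : Fin (s + 1) × Fin r => bangs A p.2) (group (s + 1) r)
    (group_fst (bangs A)) fun _ => rfl), ?_⟩
  rw [act_comp, act_comp, ← hV, act_re]
  change unpad (Cls.mk (Proof.contract _ _)) = _
  rw [hc]
  rfl

/-- `U` can be pulled out of the cut, and the tensor axiom left behind cancels the left tensor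
introductions. -/
theorem mk_comp {X : Ctx α} {B : Fin (s + 1) → Formula α} {C : Formula α} (φ : Proof B C)
    (ψ : Proof X.fm (bigTensor B)) (U : of B ⟶ X) (h : Cls.mk ψ = act U (tensorAx B)) :
    Cls.mk (Proof.comp φ ψ) = act U (Cls.mk φ) := by
  change unpad (cut (Cls.mk ψ) (Cls.mk (Proof.tensorLAll (Proof.pad φ)))) = _
  rw [h, cut_act, cut_tensorAx]
  rfl

/-- A product of plain proofs transforms any proof to one obtained by derelictions, contractions
and weakenings. -/
theorem exists_derLeg_app {κ : Type} {D : κ → Formula α} {φ : κ → Leg (of (bangs A))}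
    {S : of D ⟶ of (bangs A)} (hS : IsProd (of (bangs A)) φ S)
    (hφ : ∀ k, ∃ x : Cls (bangs A) (φ k).fm, IsPlain x ∧ (φ k).hom = sub (X := of (bangs A)) x)
    {θ : Type} {Θ : θ → Formula α} {E : Formula α} (y : Cls (D ∔ Θ) E) :
    ∃ (κ' : Type) (j : κ' → Fin r) (D' : κ' → Formula α) (y' : Cls (D' ∔ Θ) E)
      (S' : of D' ⟶ of (bangs A)), IsProd (of (bangs A)) (fun k => derLeg A (j k)) S' ∧
        app (X := of D) S y = app (X := of D') S' y' := by
  induction hS generalizing θ with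
  | nil φ e h =>
    exact ⟨_, fun k => (e k).elim, _, y, _, IsProd.nil _ e h, rfl⟩
  | @cons κ κ₁ D D₁ φ a φ₁ e h hφ' S hS ih =>
    obtain ⟨x, ⟨κ₂, j₂, D₂, y₂, S₂, hS₂, rfl⟩, ha⟩ : ∃ x : Cls (bangs A) a.fm, IsPlain x ∧
        a.hom = sub (X := of (bangs A)) x := by
      have := hφ (e.symm (Sum.inl ()))
      rw [hφ', Equiv.apply_symm_apply] at this
      exact this
    -- The tail is treated first with the head formula waiting in the passive context, which is why
    -- the induction ranges over all `Θ`.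
    obtain ⟨κ₃, j₃, D₃, y₃, S₃, hS₃, h₃⟩ := ih (fun i => by
      have := hφ (e.symm (Sum.inr i))
      rw [hφ', Equiv.apply_symm_apply] at this
      exact this) (exl (assoc (Γ := single a.fm) (Δ := D₁) (exLeft e h y)))
    -- The head factor is `sub y₂` followed by `S₂`: the proof `y₂` is cut into `y₃`, and the two
    -- families of derelicted formulas are multiplied together.
    refine ⟨κ₂ ⊕ κ₃, Sum.elim j₂ j₃, D₂ ∔ D₃, unassoc (cut y₂ (exl y₃)),
      (S₂ ⊗ₘ S₃) ≫ μ[of (bangs A)], ?_, ?_⟩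
    · have := hS₂.sum hS₃
      convert this using 1
      ext i
      cases i <;> rfl
    · rw [comp_app, comp_app, comp_app, re_app]
      congr 1
      rw [tensorHom_def', MonoidalCategory.tensorHom_def, comp_app, comp_app, whiskerLeft_app]
      erw [h₃]
      have h₄ : unassoc (Γ := single a.fm) (Δ := bangs A) (exl (app S₃ y₃)) =
          app (of (single a.fm) ◁ S₃) (unassoc (Γ := single a.fm) (Δ := D₃) (exl y₃)) := by
        rw [whiskerLeft_app]
        erw [assoc_unassoc, exl_exl]
      erw [h₄]
      -- Interchange brings the substitution for the head in front of `S₃`, so that `y₂` is cut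
      -- directly into `y₃`.
      rw [← comp_app, whisker_exchange, comp_app]
      congr 1
      rw [ha, whiskerRight_app, whiskerRight_app, sub_app]
      erw [assoc_unassoc, assoc_unassoc]
      rw [cut_act]

theorem IsPlain.act {κ : Type} {D : κ → Formula α} {φ : κ → Leg (of (bangs A))}
    {S : of D ⟶ of (bangs A)} (hS : IsProd (of (bangs A)) φ S)
    (hφ : ∀ k, ∃ x : Cls (bangs A) (φ k).fm, IsPlain x ∧ (φ k).hom = sub (X := of (bangs A)) x)
    {E : Formula α} (y : Cls D E) : IsPlain (Ctx.act (X := of D) S y) := by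
  obtain ⟨κ', j, D', y', S', hS', h⟩ := exists_derLeg_app hS hφ (pad y)
  refine ⟨κ', j, D', unpad y', S', hS', ?_⟩
  rw [Ctx.act, Ctx.act, h, pad_unpad]

end Ctx

open Ctx

theorem Proof.ComponentwisePlain.comp {r s t : ℕ} {A : Fin r → Formula α}
    {B : Fin (s + 1) → Formula α}
    {C : Fin (t + 1) → Formula α} {ψ : Proof (bangs A) (bigTensor (bangs B))}
    {φ : Proof (bangs B) (bigTensor (bangs C))} (hψ : ψ.ComponentwisePlain)
    (hφ : φ.ComponentwisePlain) : (Proof.comp φ ψ).ComponentwisePlain := by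
  obtain ⟨ψ', hψ', hψ⟩ := hψ
  obtain ⟨φ', hφ', hφ⟩ := hφ
  obtain ⟨U, hU, hUψ⟩ := exists_ofComponents ψ'
  obtain ⟨V, hV, hVφ⟩ := exists_ofComponents φ'
  obtain ⟨hU₁, hU₂⟩ := isMonHom_of_isProd B
    (fun i => sub (X := of (bangs A)) (Cls.prom (fun j => ⟨A j, rfl⟩) (Cls.mk (ψ' i))))
    (fun i => isMonHom_sub_prom _ _) hU
  have hU₃ : Promotes U :=
    Promotes.of_isProd hU (isBang_bangs B) fun i => Promotes.sub (X := of (bangs A)) _ _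
  -- The components of the composite: `φ' k` with the promotions of the `ψ' i` substituted for its
  -- hypotheses and the resulting contexts contracted.
  choose χ hχ using fun k => Quotient.exists_rep (act U (Cls.mk (φ' k)))
  change ∀ k, Cls.mk (χ k) = _ at hχ
  obtain ⟨W, hW, hWχ⟩ := exists_ofComponents χ
  refine ⟨χ, fun k => (plain_iff _).2 ?_, mk_eq_mk.1 ?_⟩
  · obtain ⟨κ, j, D, y, S, hS, h⟩ := (plain_iff _).1 (hφ' k)
    rw [hχ, h, ← act_comp]
    -- As `U` is a homomorphism, `S ≫ U` is again a product. Its factors are `derM` followed by the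
    -- substitution of the promoted `ψ' (j i)`; dereliction cancels promotion and leaves the plain
    -- proof `ψ' (j i)`.
    refine IsPlain.act (hS.map U) (fun i => ⟨Cls.mk (ψ' (j i)), (plain_iff _).1 (hψ' _), ?_⟩) y
    change (derM _ ≫ inj B (j i)) ≫ U = _
    rw [Category.assoc, hU₂]
    exact derM_sub_prom (X := of (bangs A)) _ _
  · rw [mk_comp (X := of (bangs A)) φ ψ U ((sound hψ).trans hUψ), sound hφ, hVφ, hWχ, ← act_comp]
    congr 1
    -- `V ≫ U` and `W` have the same factors: substituting `prom (φ' k)` and then applying `U`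
    -- substitutes `prom (act U (φ' k))`, because `U` commutes with promotion.
    refine (hV.map U).unique ?_
    convert hW using 1
    ext k
    rw [hχ]
    refine congrArg (Leg.mk (C k).bang) ?_
    rw [← hU₃.act (isBang_bangs B) (isBang_bangs A)]
    exact sub_comp _ U

end ILL

/-- The class of component-wise plain proofs is closed under composition. -/
theorem mainTheorem3 {α : Type u} {r s t : ℕ}
    (A : Fin r → ILL.Formula α) (B : Fin (s + 1) → ILL.Formula α)
    (C : Fin (t + 1) → ILL.Formula α)
    (ψ : ILL.Proof (ILL.bangs A) (ILL.bigTensor (ILL.bangs B)))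
    (φ : ILL.Proof (ILL.bangs B) (ILL.bigTensor (ILL.bangs C)))
    (hψ : ψ.ComponentwisePlain) (hφ : φ.ComponentwisePlain) :
    (ILL.Proof.comp φ ψ).ComponentwisePlain := hψ.comp hφ
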